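/- **Conventions.** Let $n\ge 1$, $\mathbb J=\begin{pmatrix}0&1\\-1&0\end{pmatrix}$ and $\mathbb J_n=I_n\otimes\mathbb J$. A real $2n\times 2n$ matrix $T$ is symplectic if $T^\top\mathbb J_nT=\mathbb J_n$. A $2n\times 2n$ matrix is lower $2\times2$ block triangular if, partitioned into $2\times2$ blocks, all blocks above the block diagonal vanish. A subset of a topological space is *generic* if it contains an open dense subset of that space. A real $2n\times 2n$ matrix $A$ is *admissible* if there is a real invertible matrix $V$ with columns $v_1,\dots,v_{2n}$ such that (i) $V^{-1}AV$ is a real Jordan canonical form $\mathrm{diag}(F_r,F_c)$, where $F_r$ consists of the Jordan blocks of the real eigenvalues and $F_c$ of the real Jordan blocks of the pairs of non-real eigenvalues $a\pm ib$ (with $2\times 2$ blocks $\begin{pmatrix}a&b\\-b&a\end{pmatrix}$ on the block diagonal and $I_2$ on the block superdiagonal); and (ii) for $i=1,\dots,n-1$ the matrix $[v_1\ \cdots\ v_{2i}]^\top\mathbb J_n[v_1\ \cdots\ v_{2i}]$, i.e. the leading principal $2i\times2i$ block of $V^\top\mathbb J_nV$, is invertible. $A$ has a *symplectic Schur decomposition*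 if $A=S^{-1}US$ with $S$ symplectic and $U$ lower $2\times 2$ block triangular. A *system* with $n$ degrees of freedom and $m$ fields is a quadruple $G=(A,B,C,D)$ of real matrices of sizes $2n\times2n$, $2n\times2m$, $2m\times2n$, $2m\times2m$ ($dx=Ax\,dt+B\,dw$, $dy=Cx\,dt+D\,dw$); its transfer function is $\Xi_G(s)=C(sI-A)^{-1}B+D$. It is *physically realizable* if $A\mathbb J_n+\mathbb J_nA^\top+B\mathbb J_mB^\top=0$, $\mathbb J_nC^\top+B\mathbb J_mD^\top=0$ and $D\mathbb J_mD^\top=\mathbb J_m$. The series product $G_2\triangleleft G_1$ feeds the output of $G_1$ into $G_2$: with state $(x_1,x_2)$ it is $$\left(\begin{pmatrix}A_1&0\\B_2C_1&A_2\end{pmatrix},\begin{pmatrix}B_1\\B_2D_1\end{pmatrix},\begin{pmatrix}D_2C_1&C_2\end{pmatrix},D_2D_1\right).$$ A physically realizable $G$ with $n$ degrees of freedom *has a pure cascade realization of its transfer function* if there are a symplectic $T$ and physically realizable one degree of freedom systems $G_1,\dots,G_n$, where $G_1$ has the feedthrough matrix $D$ and $G_2,\dots,G_n$ have feedthrough matrix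 $I$, such that $G_n\triangleleft\cdots\triangleleft G_1=(TAT^{-1},TB,CT^{-1},D)$, and $\Xi_{G_n\triangleleft\cdots\triangleleft G_1}(s)=\Xi_G(s)$ for every $s\in\mathbb C$ that is not an eigenvalue of $A$. A system can also be given by parameters $(S,K,R)$: a unitary $m\times m$ scattering matrix $S$, a complex $m\times2n$ matrix $K$ (coupling $L=Kx$) and a real symmetric $2n\times 2n$ matrix $R$ (Hamiltonian $H=\frac12x^\top Rx$). Its quadruple is the quadrature form of $dx=2\mathbb J_n(R+\Im\{K^\dagger K\})x\,dt+4\mathbb J_n\Im\{K^\dagger S\,d\mathcal A\}$, $dY=Kx\,dt+S\,d\mathcal A$, with $w=2(\Re\mathcal A_1,\Im\mathcal A_1,\dots,\Re\mathcal A_m,\Im\mathcal A_m)^\top$ and $y$ formed from $Y$ in the same way. The series product of parameters is $G_2\triangleleft G_1=(S_2S_1,\,L_2+S_2L_1,\,H_1+H_2+\Im\{L_2^\dagger S_2L_1\})$. Here a pure cascade realization of the transfer function consists of a symplectic $T$ and one degree of freedom systems $G_1,\dots,G_n$, the first with scattering matrix $S$ and the others with scattering matrix $I$, such that $G_n\triangleleft\cdots\triangleleft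 G_1$ is $(S,KT^{-1},T^{-\top}RT^{-1})$ and has the same transfer function as $(S,K,R)$ at every $s\in\mathbb C$ that is not an eigenvalue of the matrix $A$ of $(S,K,R)$. **Theorem.** Let $n\ge1$. 1. The set of admissible matrices is generic in $\mathbb R^{2n\times2n}$. 2. The set of matrices that have a symplectic Schur decomposition is generic in $\mathbb R^{2n\times2n}$. 3. The set of those $A\in\mathbb R^{2n\times2n}$ for which every physically realizable system $(A,B,C,D)$ with this $A$, with any number of fields, has a pure cascade realization of its transfer function is generic in $\mathbb R^{2n\times 2n}$. 4. For every $m\ge1$, the set of systems that have a pure cascade realization of their transfer function is generic in the space of all physically realizable systems $(A,B,C,D)$ with $n$ degrees of freedom and $m$ fields. 5. For every $m\ge1$, the set of systems that have a pure cascade realization of their transfer function is generic in the space of all parameters $(S,K,R)$ of systems with $n$ degrees of freedom and $m$ fields. (The spaces in 4 and 5 carry the subspace topology of the matrix spaces.) -/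

import Mathlib

open Matrix

/-- A subset of a topological space is generic if it contains an open dense subset. -/
def IsGeneric {X : Type*} [TopologicalSpace X] (s : Set X) : Prop :=
  ∃ U : Set X, U ⊆ s ∧ IsOpen U ∧ Dense U

/-- The matrix `𝕁ₙ = Iₙ ⊗ 𝕁` with `𝕁 = !![0, 1; -1, 0]`: block diagonal, `n` blocks `𝕁`. -/
def JMat (n : ℕ) : Matrix (Fin (2 * n)) (Fin (2 * n)) ℝ :=
  Matrix.of fun i j =>
    if (i : ℕ) / 2 = (j : ℕ) / 2 then
      (!![0, 1; -1, 0] : Matrix (Fin 2) (Fin 2) ℝ)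
        ⟨(i : ℕ) % 2, Nat.mod_lt _ two_pos⟩ ⟨(j : ℕ) % 2, Nat.mod_lt _ two_pos⟩
    else 0

/-- Real `2n × 2n` symplectic matrices, with respect to `𝕁ₙ`. -/
def IsSymplectic {n : ℕ} (T : Matrix (Fin (2 * n)) (Fin (2 * n)) ℝ) : Prop :=
  Tᵀ * JMat n * T = JMat n

/-- Lower `2 × 2` block triangular matrices. -/
def IsLowerBlockTriangular {n : ℕ} (U : Matrix (Fin (2 * n)) (Fin (2 * n)) ℝ) : Prop :=
  ∀ i j : Fin (2 * n), (i : ℕ) / 2 < (j : ℕ) / 2 → U i j = 0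

/-- `A = S⁻¹ U S` with `S` symplectic and `U` lower `2 × 2` block triangular. -/
def HasSymplecticSchur {n : ℕ} (A : Matrix (Fin (2 * n)) (Fin (2 * n)) ℝ) : Prop :=
  ∃ S U : Matrix (Fin (2 * n)) (Fin (2 * n)) ℝ,
    IsSymplectic S ∧ IsLowerBlockTriangular U ∧ A = S⁻¹ * U * S

/-! ### Real Jordan canonical form -/

/-- Real Jordan blocks. `real k μ` is the `(k+1) × (k+1)` Jordan block with real eigenvalue `μ`;
`cplx k a b hb` is the `2(k+1) × 2(k+1)` real Jordan block of the pair `a ± b i` of non-real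
eigenvalues. -/
inductive RealJordanBlock where
  | real (k : ℕ) (μ : ℝ) : RealJordanBlock
  | cplx (k : ℕ) (a b : ℝ) (hb : b ≠ 0) : RealJordanBlock

namespace RealJordanBlock

/-- The number of rows of a block. -/
def size : RealJordanBlock → ℕ
  | real k _ => k + 1
  | cplx k _ _ _ => 2 * (k + 1)

/-- Whether the block belongs to a real eigenvalue. -/
def IsReal : RealJordanBlock → Prop
  | real _ _ => True
  | cplx _ _ _ _ => False

/-- The entry of a block in row `i` and column `j` (counted from `0`, both below the size).
A complex block has the `2 × 2` blocks `!![a, b; -b, a]` on its block diagonal and `I₂` on its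
block superdiagonal. -/
def entry : RealJordanBlock → ℕ → ℕ → ℝ
  | real _ μ, i, j => if i = j then μ else if j = i + 1 then 1 else 0
  | cplx _ a b _, i, j =>
      if i / 2 = j / 2 then
        (!![a, b; -b, a] : Matrix (Fin 2) (Fin 2) ℝ)
          ⟨i % 2, Nat.mod_lt _ two_pos⟩ ⟨j % 2, Nat.mod_lt _ two_pos⟩
      else if j = i + 2 then 1 else 0

/-- The entries of the block diagonal matrix with the blocks of a list, in that order. -/
def diagEntry : List RealJordanBlock → ℕ → ℕ → ℝ
  | [], _, _ => 0
  | b :: L, i, j =>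
      if i < b.size ∧ j < b.size then b.entry i j
      else if b.size ≤ i ∧ b.size ≤ j then diagEntry L (i - b.size) (j - b.size)
      else 0

end RealJordanBlock

/-- `F` is a real Jordan canonical form `diag(F_r, F_c)` in which all blocks of real eigenvalues
(`F_r`) stand before all blocks of complex conjugate pairs (`F_c`). -/
def IsOrderedRealJordanForm {N : ℕ} (F : Matrix (Fin N) (Fin N) ℝ) : Prop :=
  ∃ Lr Lc : List RealJordanBlock,
    (∀ b ∈ Lr, b.IsReal) ∧ (∀ b ∈ Lc, ¬ b.IsReal) ∧
    ((Lr ++ Lc).map RealJordanBlock.size).sum = N ∧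
    ∀ i j : Fin N, F i j = RealJordanBlock.diagEntry (Lr ++ Lc) i j

/-- The first `2i` columns of a `2n × 2n` matrix. -/
def firstCols {n : ℕ} (V : Matrix (Fin (2 * n)) (Fin (2 * n)) ℝ) (i : ℕ) (hi : i ≤ n) :
    Matrix (Fin (2 * n)) (Fin (2 * i)) ℝ :=
  V.submatrix id (Fin.castLE (Nat.mul_le_mul_left 2 hi))

/-- Admissible matrices: some real invertible `V` brings `A` into real Jordan canonical form, real
blocks first, and the Gram matrices `Nᵢ = Mᵢᵀ 𝕁ₙ Mᵢ` of the first `2i` columns `Mᵢ` of `V` (the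
leading principal `2i × 2i` blocks of `Vᵀ 𝕁ₙ V`) are invertible for `i = 1, …, n - 1`. -/
def IsAdmissible {n : ℕ} (A : Matrix (Fin (2 * n)) (Fin (2 * n)) ℝ) : Prop :=
  ∃ V : Matrix (Fin (2 * n)) (Fin (2 * n)) ℝ,
    IsUnit V ∧ IsOrderedRealJordanForm (V⁻¹ * A * V) ∧
    ∀ (i : ℕ) (hi : i < n), 1 ≤ i →
      ((firstCols V i hi.le)ᵀ * JMat n * firstCols V i hi.le).det ≠ 0

/-! ### Linear quantum stochastic systems in quadrature form -/

/-- System matrices of `dx = A x dt + B dw`, `dy = C x dt + D dw`, with `n` degrees of freedom and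
`m` input and `m` output fields (two quadratures each). -/
@[ext] structure LinSys (n m : ℕ) where
  A : Matrix (Fin (2 * n)) (Fin (2 * n)) ℝ
  B : Matrix (Fin (2 * n)) (Fin (2 * m)) ℝ
  C : Matrix (Fin (2 * m)) (Fin (2 * n)) ℝ
  D : Matrix (Fin (2 * m)) (Fin (2 * m)) ℝ

namespace LinSys

/-- The quadruple `(A, B, C, D)`. -/
def toProd {n m : ℕ} (G : LinSys n m) :
    Matrix (Fin (2 * n)) (Fin (2 * n)) ℝ × Matrix (Fin (2 * n)) (Fin (2 * m)) ℝ ×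
      Matrix (Fin (2 * m)) (Fin (2 * n)) ℝ × Matrix (Fin (2 * m)) (Fin (2 * m)) ℝ :=
  (G.A, G.B, G.C, G.D)

/-- The topology of the finite dimensional space of quadruples `(A, B, C, D)`. -/
instance {n m : ℕ} : TopologicalSpace (LinSys n m) :=
  TopologicalSpace.induced toProd inferInstance

/-- Physical realizability. -/
def PhysicallyRealizable {n m : ℕ} (G : LinSys n m) : Prop :=
  G.A * JMat n + JMat n * G.Aᵀ + G.B * JMat m * G.Bᵀ = 0 ∧
  JMat n * G.Cᵀ + G.B * JMat m * G.Dᵀ = 0 ∧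
  G.D * JMat m * G.Dᵀ = JMat m

/-- The system `(T A T⁻¹, T B, C T⁻¹, D)`, i.e. the change of variables `z = T x`. -/
noncomputable def transform {n m : ℕ} (G : LinSys n m)
    (T : Matrix (Fin (2 * n)) (Fin (2 * n)) ℝ) : LinSys n m where
  A := T * G.A * T⁻¹
  B := T * G.B
  C := G.C * T⁻¹
  D := G.D

/-- The transfer function `C (s I - A)⁻¹ B + D`, meaningful when `s` is not an eigenvalue
of `A`. -/
noncomputable def transfer {n m : ℕ} (G : LinSys n m) (s : ℂ) :
    Matrix (Fin (2 * m)) (Fin (2 * m)) ℂ :=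
  G.C.map Complex.ofReal * (s • (1 : Matrix (Fin (2 * n)) (Fin (2 * n)) ℂ)
    - G.A.map Complex.ofReal)⁻¹ * G.B.map Complex.ofReal + G.D.map Complex.ofReal

/-- The concatenation of the state indices of two systems. -/
def stateEquiv (n₁ n₂ : ℕ) : Fin (2 * n₁) ⊕ Fin (2 * n₂) ≃ Fin (2 * (n₁ + n₂)) :=
  finSumFinEquiv.trans (finCongr (Nat.mul_add 2 n₁ n₂).symm)

/-- The series product `G₂ ◁ G₁`: the output of `G₁` is the input of `G₂`, the state
is `(x₁, x₂)`. -/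
def series {n₁ n₂ m : ℕ} (G₂ : LinSys n₂ m) (G₁ : LinSys n₁ m) : LinSys (n₁ + n₂) m where
  A := Matrix.reindex (stateEquiv n₁ n₂) (stateEquiv n₁ n₂)
    (Matrix.fromBlocks G₁.A 0 (G₂.B * G₁.C) G₂.A)
  B := Matrix.reindex (stateEquiv n₁ n₂) (Equiv.refl _)
    (Matrix.fromRows G₁.B (G₂.B * G₁.D))
  C := Matrix.reindex (Equiv.refl _) (stateEquiv n₁ n₂)
    (Matrix.fromCols (G₂.D * G₁.C) G₂.C)
  D := G₂.D * G₁.D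

/-- The cascade `Gₙ ◁ ⋯ ◁ G₁` of `n` one degree of freedom systems `G₁ = g 0, …, Gₙ = g (n-1)`.
The empty cascade passes its input on unchanged. -/
def cascade {m : ℕ} : (n : ℕ) → (Fin n → LinSys 1 m) → LinSys n m
  | 0, _ => ⟨0, 0, 0, 1⟩
  | n + 1, g => series (g (Fin.last n)) (cascade n fun k => g k.castSucc)

/-- The transfer function of `G` has a pure cascade realization: after a symplectic change of
variables, `G` is a cascade of `n` physically realizable systems with one degree of freedom, the
first of which has the feedthrough matrix `D` of `G` and the others the identity; and this cascade
has the transfer function of `G`. -/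
def HasPureCascadeRealization {n m : ℕ} (G : LinSys n m) : Prop :=
  ∃ (T : Matrix (Fin (2 * n)) (Fin (2 * n)) ℝ) (g : Fin n → LinSys 1 m),
    IsSymplectic T ∧
    (∀ k, (g k).PhysicallyRealizable) ∧
    (∀ k, (g k).D = if (k : ℕ) = 0 then G.D else 1) ∧
    cascade n g = G.transform T ∧
    ∀ s : ℂ, (s • (1 : Matrix (Fin (2 * n)) (Fin (2 * n)) ℂ)
        - G.A.map Complex.ofReal).det ≠ 0 →
      (cascade n g).transfer s = G.transfer s

end LinSys

/-! ### Linear quantum stochastic systems given by their parameters -/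

/-- Parameters of a linear quantum stochastic system `(S, K x, ½ xᵀ R x)` with `n` degrees of
freedom, `x = (q₁, p₁, …, qₙ, pₙ)`, and `m` fields: a unitary scattering matrix `S`, a complex
coupling matrix `K` and a real symmetric Hamiltonian matrix `R`. -/
@[ext] structure SLHSys (n m : ℕ) where
  S : Matrix (Fin m) (Fin m) ℂ
  K : Matrix (Fin m) (Fin (2 * n)) ℂ
  R : Matrix (Fin (2 * n)) (Fin (2 * n)) ℝ
  unitary_S : S ∈ Matrix.unitaryGroup (Fin m) ℂ
  symm_R : Rᵀ = R

namespace SLHSys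

/-- The triple `(S, K, R)`. -/
def toProd {n m : ℕ} (G : SLHSys n m) :
    Matrix (Fin m) (Fin m) ℂ × Matrix (Fin m) (Fin (2 * n)) ℂ ×
      Matrix (Fin (2 * n)) (Fin (2 * n)) ℝ :=
  (G.S, G.K, G.R)

/-- The topology of the space of triples `(S, K, R)`. -/
noncomputable instance {n m : ℕ} : TopologicalSpace (SLHSys n m) :=
  TopologicalSpace.induced toProd inferInstance

/-- The field to which a quadrature index belongs. -/
def fieldOf {m : ℕ} (i : Fin (2 * m)) : Fin m :=
  ⟨(i : ℕ) / 2, Nat.div_lt_of_lt_mul i.2⟩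

/-- The system matrices in quadrature form. They are obtained from
`dx = 2 𝕁ₙ (R + Im (K† K)) x dt + 4 𝕁ₙ Im (K† S d𝒜)`, `dY = K x dt + S d𝒜` with
`w = 2 (Re 𝒜₁, Im 𝒜₁, …, Re 𝒜ₘ, Im 𝒜ₘ)` and `y = 2 (Re Y₁, Im Y₁, …, Re Yₘ, Im Yₘ)`. -/
noncomputable def toLinSys {n m : ℕ} (G : SLHSys n m) : LinSys n m where
  A := (2 : ℝ) • (JMat n * (G.R + (G.Kᴴ * G.K).map Complex.im))
  B := (2 : ℝ) • (JMat n * Matrix.of fun (i : Fin (2 * n)) (j : Fin (2 * m)) =>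
    if (j : ℕ) % 2 = 0 then ((G.Kᴴ * G.S) i (fieldOf j)).im else ((G.Kᴴ * G.S) i (fieldOf j)).re)
  C := (2 : ℝ) • Matrix.of fun (i : Fin (2 * m)) (j : Fin (2 * n)) =>
    if (i : ℕ) % 2 = 0 then (G.K (fieldOf i) j).re else (G.K (fieldOf i) j).im
  D := Matrix.of fun (i j : Fin (2 * m)) =>
    if (i : ℕ) % 2 = (j : ℕ) % 2 then (G.S (fieldOf i) (fieldOf j)).re
    else if (i : ℕ) % 2 = 0 then - (G.S (fieldOf i) (fieldOf j)).im
    else (G.S (fieldOf i) (fieldOf j)).im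

/-- The parameters in the variables `z = T x`. -/
noncomputable def transform {n m : ℕ} (G : SLHSys n m)
    (T : Matrix (Fin (2 * n)) (Fin (2 * n)) ℝ) : SLHSys n m where
  S := G.S
  K := G.K * (T⁻¹).map Complex.ofReal
  R := (T⁻¹)ᵀ * G.R * T⁻¹
  unitary_S := G.unitary_S
  symm_R := by
    simp [Matrix.transpose_mul, G.symm_R, Matrix.mul_assoc]

/-- The series product `G₂ ◁ G₁ = (S₂ S₁, L₂ + S₂ L₁, H₁ + H₂ + Im (L₂† S₂ L₁))` with
`Lⱼ = Kⱼ xⱼ` and `Hⱼ = ½ xⱼᵀ Rⱼ xⱼ`, written in the variables `(x₁, x₂)`: as `x₁` and `x₂` commute,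
`Im (L₂† S₂ L₁) = x₂ᵀ Im (K₂† S₂ K₁) x₁`. -/
noncomputable def series {n₁ n₂ m : ℕ} (G₂ : SLHSys n₂ m) (G₁ : SLHSys n₁ m) : SLHSys (n₁ + n₂) m where
  S := G₂.S * G₁.S
  K := Matrix.reindex (Equiv.refl _) (LinSys.stateEquiv n₁ n₂)
    (Matrix.fromCols (G₂.S * G₁.K) G₂.K)
  R := Matrix.reindex (LinSys.stateEquiv n₁ n₂) (LinSys.stateEquiv n₁ n₂)
    (Matrix.fromBlocks G₁.R ((G₂.Kᴴ * G₂.S * G₁.K).map Complex.im)ᵀ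
      ((G₂.Kᴴ * G₂.S * G₁.K).map Complex.im) G₂.R)
  unitary_S := mul_mem G₂.unitary_S G₁.unitary_S
  symm_R := by
    rw [Matrix.transpose_reindex, Matrix.fromBlocks_transpose, Matrix.transpose_transpose,
      G₁.symm_R, G₂.symm_R]

/-- The cascade `Gₙ ◁ ⋯ ◁ G₁` of `n` one degree of freedom systems `G₁ = g 0, …, Gₙ = g (n-1)`.
The empty cascade passes its input on unchanged. -/
noncomputable def cascade {m : ℕ} : (n : ℕ) → (Fin n → SLHSys 1 m) → SLHSys n m
  | 0, _ => ⟨1, 0, 0, one_mem _, Matrix.transpose_zero⟩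
  | n + 1, g => series (g (Fin.last n)) (cascade n fun k => g k.castSucc)

/-- The transfer function of `G` has a pure cascade realization: after a symplectic change of
variables, `G` is a cascade of `n` systems with one degree of freedom, the first of which has the
scattering matrix `S` of `G` and the others the identity; and this cascade has the transfer function
of `G`. -/
def HasPureCascadeRealization {n m : ℕ} (G : SLHSys n m) : Prop :=
  ∃ (T : Matrix (Fin (2 * n)) (Fin (2 * n)) ℝ) (g : Fin n → SLHSys 1 m),
    IsSymplectic T ∧
    (∀ k, (g k).S = if (k : ℕ) = 0 then G.S else 1) ∧
    cascade n g = G.transform T ∧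
    ∀ s : ℂ, (s • (1 : Matrix (Fin (2 * n)) (Fin (2 * n)) ℂ)
        - G.toLinSys.A.map Complex.ofReal).det ≠ 0 →
      (cascade n g).toLinSys.transfer s = G.toLinSys.transfer s

end SLHSys

/-!
In all five parts the property of a system or matrix follows from a property of the matrix `A`, and
that property holds on an open set because of block diagonalizations. Call a block diagonal matrix
`D` with `2 × 2` blocks separated if only block diagonal matrices commute with it. Then the
derivative of `(V, D) ↦ V D V⁻¹`, for block diagonal `D`, is onto, so that all matrices near `V D
V⁻¹` are again block diagonalized by some `V'` near `V` (`IsSeparated.conj_mem_nhds`). If moreover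
the leading `2k × 2k` minors of `Vᵀ 𝕁 V` do not vanish, they do not vanish for `V'` either.

Such a block diagonalization gives what is wanted. The skew-symmetric matrix `Vᵀ 𝕁 V` with nonzero
leading minors factors as `Rᵀ 𝕁 R` with `R` block triangular
(`HasLeadingMinors.exists_factorization`). Hence `V R⁻¹` is symplectic and brings `A` into block
triangular form, which is a symplectic Schur decomposition after transposition
(`hasSymplecticSchur_transpose`). Bringing the blocks of `D` into real Jordan form keeps the minors
nonzero, so `A` is admissible if the blocks with real eigenvalues stand before the others
(`isAdmissible_of_isSorted`). A symplectic Schur decomposition turns a physically realizable system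
into a cascade, because realizability determines the coupling blocks of a block triangular `A`, and
they are those of the series product (`hasPureCascadeRealization_of_schur`,
`slh_hasPureCascadeRealization_of_schur`).

It remains to prove density, for all matrices and for the matrices `A` of realizable systems with
`m` fields. Both follow from a density theorem for the pairs `(A, B)` with `A Ω + Ω Aᵀ + B 𝕁 Bᵀ =
0`, where `Ω` is an invertible skew-symmetric matrix, since with `2n` fields every `A` occurs in
such a pair. The proof is an induction on `n`. The matrix `A` has a left invariant plane, and a
perturbation within the set of pairs makes `Ω` nondegenerate on it (`mem_closure_nondegenerate`).
The plane then splits off together with its orthogonal complement. Both parts are perturbed, the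
plane by adding a multiple of `𝕁` to its block, which respects the condition on pairs and makes the
block separated from the rest (`mem_closure_isSplit`). For admissible matrices the blocks have to
be sorted, which may destroy the condition on the minors; moving `V` along the segment to `1`
restores it (`mem_closure_interior_isAdmissible`).
-/

namespace GenericCascade

/-! ### Block diagonal matrices with block diagonal commutant -/

/-- Block diagonal matrices, with `2 × 2` blocks. -/
def IsBlockDiag {n : ℕ} (D : Matrix (Fin (2 * n)) (Fin (2 * n)) ℝ) : Prop :=
  ∀ i j : Fin (2 * n), (i : ℕ) / 2 ≠ (j : ℕ) / 2 → D i j = 0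

/-- A block diagonal matrix is *separated* if every matrix that commutes with it is block diagonal.
This says that no two of its diagonal blocks have an eigenvalue in common. -/
def IsSeparated {n : ℕ} (D : Matrix (Fin (2 * n)) (Fin (2 * n)) ℝ) : Prop :=
  IsBlockDiag D ∧ ∀ N, N * D = D * N → IsBlockDiag N

/-- The block diagonal part of a matrix. -/
def blockPart (n : ℕ) :
    Matrix (Fin (2 * n)) (Fin (2 * n)) ℝ →ₗ[ℝ] Matrix (Fin (2 * n)) (Fin (2 * n)) ℝ where
  toFun M := Matrix.of fun i j => if (i : ℕ) / 2 = (j : ℕ) / 2 then M i j else 0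
  map_add' M N := by ext i j; by_cases h : (i : ℕ) / 2 = (j : ℕ) / 2 <;> simp [h]
  map_smul' c M := by ext i j; by_cases h : (i : ℕ) / 2 = (j : ℕ) / 2 <;> simp [h]

lemma blockPart_apply {n : ℕ} (M : Matrix (Fin (2 * n)) (Fin (2 * n)) ℝ) (i j : Fin (2 * n)) :
    blockPart n M i j = if (i : ℕ) / 2 = (j : ℕ) / 2 then M i j else 0 := rfl

lemma isBlockDiag_blockPart {n : ℕ} (M : Matrix (Fin (2 * n)) (Fin (2 * n)) ℝ) :
    IsBlockDiag (blockPart n M) := fun i j h => by rw [blockPart_apply, if_neg h]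

lemma IsBlockDiag.blockPart_eq {n : ℕ} {D : Matrix (Fin (2 * n)) (Fin (2 * n)) ℝ}
    (h : IsBlockDiag D) : blockPart n D = D := by
  ext i j
  rw [blockPart_apply]
  split_ifs with hij
  · rfl
  · rw [h i j hij]

lemma IsBlockDiag.blockTriangular {n : ℕ} {D : Matrix (Fin (2 * n)) (Fin (2 * n)) ℝ}
    (h : IsBlockDiag D) : D.BlockTriangular fun i => (i : ℕ) / 2 :=
  fun i j hij => h i j hij.ne'

lemma blockPart_mul_right {n : ℕ} {D : Matrix (Fin (2 * n)) (Fin (2 * n)) ℝ}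
    (h : IsBlockDiag D) (M : Matrix (Fin (2 * n)) (Fin (2 * n)) ℝ) :
    blockPart n (M * D) = blockPart n M * D := by
  ext i j
  simp only [blockPart_apply, Matrix.mul_apply]
  split_ifs with hij
  · refine Finset.sum_congr rfl fun k _ => ?_
    split_ifs with hik
    · rfl
    · rw [h k j fun e => hik (hij.trans e.symm)]; simp
  · refine (Finset.sum_eq_zero fun k _ => ?_).symm
    split_ifs with hik
    · rw [h k j fun e => hij (hik.trans e)]; simp
    · simp

lemma blockPart_mul_left {n : ℕ} {D : Matrix (Fin (2 * n)) (Fin (2 * n)) ℝ}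
    (h : IsBlockDiag D) (M : Matrix (Fin (2 * n)) (Fin (2 * n)) ℝ) :
    blockPart n (D * M) = D * blockPart n M := by
  ext i j
  simp only [blockPart_apply, Matrix.mul_apply]
  split_ifs with hij
  · refine Finset.sum_congr rfl fun k _ => ?_
    split_ifs with hkj
    · rfl
    · rw [h i k fun e => hkj (e.symm.trans hij)]; simp
  · refine (Finset.sum_eq_zero fun k _ => ?_).symm
    split_ifs with hkj
    · rw [h i k fun e => hij (e.trans hkj)]; simp
    · simp

/-- For a separated `D`, every matrix is the sum of a commutator with `D` and a block diagonal
matrix: on matrices with vanishing diagonal blocks, `N ↦ N D - D N` is injective, hence onto. -/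
lemma IsSeparated.exists_commutator_add {n : ℕ} {D : Matrix (Fin (2 * n)) (Fin (2 * n)) ℝ}
    (h : IsSeparated D) (M : Matrix (Fin (2 * n)) (Fin (2 * n)) ℝ) :
    ∃ N, N * D - D * N + blockPart n M = M := by
  let O := LinearMap.ker (blockPart n)
  have hmap : ∀ N ∈ O, (LinearMap.mulRight ℝ D - LinearMap.mulLeft ℝ D) N ∈ O := by
    intro N hN
    rw [LinearMap.mem_ker] at hN ⊢
    simp [blockPart_mul_left h.1, blockPart_mul_right h.1, hN]
  let f : O →ₗ[ℝ] O := (LinearMap.mulRight ℝ D - LinearMap.mulLeft ℝ D).restrict hmap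
  have hf : Function.Injective f := by
    rw [injective_iff_map_eq_zero]
    rintro ⟨N, hN⟩ h0
    have h1 : N * D - D * N = 0 := congrArg Subtype.val h0
    have h2 := (h.2 N (sub_eq_zero.mp h1)).blockPart_eq
    rw [LinearMap.mem_ker.mp hN] at h2
    exact Subtype.ext h2.symm
  have hM : M - blockPart n M ∈ O := by
    rw [LinearMap.mem_ker, map_sub, (isBlockDiag_blockPart M).blockPart_eq, sub_self]
  obtain ⟨N, hN⟩ := LinearMap.surjective_of_injective hf ⟨_, hM⟩
  refine ⟨N.1, ?_⟩
  have : N.1 * D - D * N.1 = M - blockPart n M := congrArg Subtype.val hN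
  rw [this, sub_add_cancel]

section Openness

attribute [local instance] Matrix.linftyOpNormedRing Matrix.linftyOpNormedAlgebra

/-- Conjugates `V D V⁻¹` of block diagonal matrices near a separated one fill a neighbourhood: the
derivative of `(V, D) ↦ V D V⁻¹` there is onto. -/
theorem IsSeparated.conj_mem_nhds {n : ℕ} {V D : Matrix (Fin (2 * n)) (Fin (2 * n)) ℝ}
    (hV : IsUnit V) (hD : IsSeparated D)
    {s : Set (Matrix (Fin (2 * n)) (Fin (2 * n)) ℝ × Matrix (Fin (2 * n)) (Fin (2 * n)) ℝ)}
    (hs : s ∈ nhds (V, D)) :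
    {A | ∃ p ∈ s, IsUnit p.1 ∧ IsBlockDiag p.2 ∧ A = p.1 * p.2 * p.1⁻¹} ∈ nhds (V * D * V⁻¹) := by
  let π : Matrix (Fin (2 * n)) (Fin (2 * n)) ℝ →L[ℝ] Matrix (Fin (2 * n)) (Fin (2 * n)) ℝ :=
    LinearMap.toContinuousLinearMap (blockPart n)
  have hπ : ∀ M, π M = blockPart n M := fun _ => rfl
  obtain ⟨u, rfl⟩ := hV
  let Φ : Matrix (Fin (2 * n)) (Fin (2 * n)) ℝ × Matrix (Fin (2 * n)) (Fin (2 * n)) ℝ →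
      Matrix (Fin (2 * n)) (Fin (2 * n)) ℝ := fun p => p.1 * π p.2 * Ring.inverse p.1
  have hΦ := ((hasStrictFDerivAt_fst (𝕜 := ℝ) (p := (u.1, D))).mul'
    (π.hasStrictFDerivAt.comp (u.1, D) hasStrictFDerivAt_snd)).mul'
      ((hasStrictFDerivAt_ringInverse (𝕜 := ℝ) u).comp (u.1, D) hasStrictFDerivAt_fst)
  have hval : Φ (u.1, D) = u.1 * D * (u.1)⁻¹ := by
    simp only [Φ, hπ, hD.1.blockPart_eq, Matrix.nonsing_inv_eq_ringInverse]
  have hmap := hΦ.map_nhds_eq_of_surj (by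
    rw [LinearMap.range_eq_top]
    intro M
    obtain ⟨N, hN⟩ := hD.exists_commutator_add (u⁻¹.1 * M * u.1)
    refine ⟨(u.1 * N, u⁻¹.1 * M * u.1), ?_⟩
    have : u.1 * (N * D - D * N + blockPart n (u⁻¹.1 * M * u.1)) * u⁻¹.1 = M := by
      rw [hN]; simp [mul_assoc]
    refine Eq.trans ?_ this
    change u.1 * blockPart n D * (-(u⁻¹.1 * (u.1 * N) * u⁻¹.1)) +
      (u.1 * blockPart n (u⁻¹.1 * M * u.1) + u.1 * N * blockPart n D) * Ring.inverse u.1 = _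
    simp [hD.1.blockPart_eq, mul_add, add_mul, mul_sub, sub_mul, mul_assoc]
    abel)
  have hmap' : Filter.map Φ (nhds (u.1, D)) = nhds (u.1 * D * (u.1)⁻¹) := by
    rw [← hval]; exact hmap
  have hpre : {p : Matrix (Fin (2 * n)) (Fin (2 * n)) ℝ × Matrix (Fin (2 * n)) (Fin (2 * n)) ℝ |
      (p.1, π p.2) ∈ s ∧ IsUnit p.1} ∈ nhds (u.1, D) := by
    refine Filter.inter_mem ?_ ?_
    · have hc : Continuous fun p : Matrix (Fin (2 * n)) (Fin (2 * n)) ℝ ×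
          Matrix (Fin (2 * n)) (Fin (2 * n)) ℝ => (p.1, π p.2) := by fun_prop
      refine hc.continuousAt.preimage_mem_nhds ?_
      simpa only [hπ, hD.1.blockPart_eq] using hs
    · exact (Units.isOpen.preimage continuous_fst).mem_nhds (x := (u.1, D)) u.isUnit
  rw [← hmap']
  refine Filter.mem_of_superset (Filter.image_mem_map hpre) ?_
  rintro _ ⟨p, ⟨hp, hu⟩, rfl⟩
  exact ⟨_, hp, hu, isBlockDiag_blockPart _, by
    simp only [Φ, hπ, Matrix.nonsing_inv_eq_ringInverse]⟩

end Openness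

/-! ### Block matrices indexed by concatenated degrees of freedom -/

section Blocks

variable {p q : ℕ} {κ : Type*}

/-- The square matrix with the given blocks, for the concatenation of `p` and `q` degrees of
freedom. -/
def blk (P : Matrix (Fin (2 * p)) (Fin (2 * p)) ℝ) (Q : Matrix (Fin (2 * p)) (Fin (2 * q)) ℝ)
    (R : Matrix (Fin (2 * q)) (Fin (2 * p)) ℝ) (S : Matrix (Fin (2 * q)) (Fin (2 * q)) ℝ) :
    Matrix (Fin (2 * (p + q))) (Fin (2 * (p + q))) ℝ :=
  Matrix.reindex (LinSys.stateEquiv p q) (LinSys.stateEquiv p q) (Matrix.fromBlocks P Q R S)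

/-- Two matrices on top of each other, for the concatenation of `p` and `q` degrees of freedom. -/
def rws (X : Matrix (Fin (2 * p)) κ ℝ) (Y : Matrix (Fin (2 * q)) κ ℝ) :
    Matrix (Fin (2 * (p + q))) κ ℝ :=
  Matrix.reindex (LinSys.stateEquiv p q) (Equiv.refl κ) (Matrix.fromRows X Y)

lemma exists_blk (M : Matrix (Fin (2 * (p + q))) (Fin (2 * (p + q))) ℝ) :
    ∃ P Q R S, M = blk (p := p) (q := q) P Q R S := by
  let e := LinSys.stateEquiv p q
  refine ⟨(M.submatrix e e).toBlocks₁₁, (M.submatrix e e).toBlocks₁₂, (M.submatrix e e).toBlocks₂₁,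
    (M.submatrix e e).toBlocks₂₂, ?_⟩
  rw [blk, Matrix.fromBlocks_toBlocks]
  ext i j
  simp [e]

lemma exists_rws (M : Matrix (Fin (2 * (p + q))) κ ℝ) :
    ∃ X Y, M = rws (p := p) (q := q) X Y := by
  let e := LinSys.stateEquiv p q
  refine ⟨(M.submatrix e id).toRows₁, (M.submatrix e id).toRows₂, ?_⟩
  rw [rws, Matrix.fromRows_toRows]
  ext i j
  simp [e]

lemma blk_inj {P P' : Matrix (Fin (2 * p)) (Fin (2 * p)) ℝ}
    {Q Q' : Matrix (Fin (2 * p)) (Fin (2 * q)) ℝ} {R R' : Matrix (Fin (2 * q)) (Fin (2 * p)) ℝ}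
    {S S' : Matrix (Fin (2 * q)) (Fin (2 * q)) ℝ} :
    blk P Q R S = blk P' Q' R' S' ↔ P = P' ∧ Q = Q' ∧ R = R' ∧ S = S' := by
  rw [blk, blk, (Matrix.reindex _ _).injective.eq_iff, Matrix.fromBlocks_inj]

lemma rws_inj {X X' : Matrix (Fin (2 * p)) κ ℝ} {Y Y' : Matrix (Fin (2 * q)) κ ℝ} :
    rws X Y = rws X' Y' ↔ X = X' ∧ Y = Y' := by
  rw [rws, rws, (Matrix.reindex _ _).injective.eq_iff, Matrix.fromRows_inj.eq_iff]

lemma blk_mul (P P' : Matrix (Fin (2 * p)) (Fin (2 * p)) ℝ)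
    (Q Q' : Matrix (Fin (2 * p)) (Fin (2 * q)) ℝ) (R R' : Matrix (Fin (2 * q)) (Fin (2 * p)) ℝ)
    (S S' : Matrix (Fin (2 * q)) (Fin (2 * q)) ℝ) :
    blk P Q R S * blk P' Q' R' S' =
      blk (P * P' + Q * R') (P * Q' + Q * S') (R * P' + S * R') (R * Q' + S * S') := by
  simp only [blk, Matrix.reindex_apply, Matrix.submatrix_mul_equiv, Matrix.fromBlocks_multiply]

lemma blk_mul_rws [Fintype κ] (P : Matrix (Fin (2 * p)) (Fin (2 * p)) ℝ)
    (Q : Matrix (Fin (2 * p)) (Fin (2 * q)) ℝ) (R : Matrix (Fin (2 * q)) (Fin (2 * p)) ℝ)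
    (S : Matrix (Fin (2 * q)) (Fin (2 * q)) ℝ) (X : Matrix (Fin (2 * p)) κ ℝ)
    (Y : Matrix (Fin (2 * q)) κ ℝ) :
    blk P Q R S * rws X Y = rws (P * X + Q * Y) (R * X + S * Y) := by
  simp only [blk, rws, Matrix.reindex_apply, Matrix.submatrix_mul_equiv,
    Matrix.fromBlocks_mul_fromRows]

lemma rws_mul [Fintype κ] {κ' : Type*} (X : Matrix (Fin (2 * p)) κ ℝ)
    (Y : Matrix (Fin (2 * q)) κ ℝ) (Z : Matrix κ κ' ℝ) :
    rws X Y * Z = rws (X * Z) (Y * Z) := by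
  have h := Matrix.fromRows_mul X Y Z
  simp only [rws, Matrix.reindex_apply]
  rw [← h]
  rfl

lemma rws_mul_transpose [Fintype κ] (X X' : Matrix (Fin (2 * p)) κ ℝ)
    (Y Y' : Matrix (Fin (2 * q)) κ ℝ) :
    rws X Y * (rws X' Y')ᵀ = blk (X * X'ᵀ) (X * Y'ᵀ) (Y * X'ᵀ) (Y * Y'ᵀ) := by
  have h : (rws X' Y')ᵀ = (Matrix.fromCols X'ᵀ Y'ᵀ).submatrix id (LinSys.stateEquiv p q).symm := by
    rw [rws, Matrix.reindex_apply, Matrix.transpose_submatrix, Matrix.transpose_fromRows]; rfl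
  rw [h, rws, blk, Matrix.reindex_apply, Matrix.reindex_apply, ← Matrix.fromRows_mul_fromCols]
  rfl

lemma blk_transpose (P : Matrix (Fin (2 * p)) (Fin (2 * p)) ℝ)
    (Q : Matrix (Fin (2 * p)) (Fin (2 * q)) ℝ) (R : Matrix (Fin (2 * q)) (Fin (2 * p)) ℝ)
    (S : Matrix (Fin (2 * q)) (Fin (2 * q)) ℝ) :
    (blk P Q R S)ᵀ = blk Pᵀ Rᵀ Qᵀ Sᵀ := by
  rw [blk, blk, Matrix.transpose_reindex, Matrix.fromBlocks_transpose]

lemma blk_add (P P' : Matrix (Fin (2 * p)) (Fin (2 * p)) ℝ)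
    (Q Q' : Matrix (Fin (2 * p)) (Fin (2 * q)) ℝ) (R R' : Matrix (Fin (2 * q)) (Fin (2 * p)) ℝ)
    (S S' : Matrix (Fin (2 * q)) (Fin (2 * q)) ℝ) :
    blk P Q R S + blk P' Q' R' S' = blk (P + P') (Q + Q') (R + R') (S + S') := by
  rw [blk, blk, blk, ← Matrix.fromBlocks_add]; rfl

lemma blk_neg (P : Matrix (Fin (2 * p)) (Fin (2 * p)) ℝ)
    (Q : Matrix (Fin (2 * p)) (Fin (2 * q)) ℝ) (R : Matrix (Fin (2 * q)) (Fin (2 * p)) ℝ)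
    (S : Matrix (Fin (2 * q)) (Fin (2 * q)) ℝ) :
    -blk P Q R S = blk (-P) (-Q) (-R) (-S) := by
  rw [blk, blk, ← Matrix.fromBlocks_neg]; rfl

lemma blk_zero : blk (0 : Matrix (Fin (2 * p)) (Fin (2 * p)) ℝ) 0 0
    (0 : Matrix (Fin (2 * q)) (Fin (2 * q)) ℝ) = 0 := by
  rw [blk, Matrix.fromBlocks_zero]; rfl

lemma blk_one : blk (1 : Matrix (Fin (2 * p)) (Fin (2 * p)) ℝ) 0 0
    (1 : Matrix (Fin (2 * q)) (Fin (2 * q)) ℝ) = 1 := by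
  rw [blk, Matrix.fromBlocks_one, Matrix.reindex_apply, Matrix.submatrix_one_equiv]

lemma det_blk_zero₂₁ (P : Matrix (Fin (2 * p)) (Fin (2 * p)) ℝ)
    (Q : Matrix (Fin (2 * p)) (Fin (2 * q)) ℝ) (S : Matrix (Fin (2 * q)) (Fin (2 * q)) ℝ) :
    (blk P Q 0 S).det = P.det * S.det := by
  rw [blk, Matrix.det_reindex_self, Matrix.det_fromBlocks_zero₂₁]

lemma continuous_blk {X : Type*} [TopologicalSpace X]
    {P : X → Matrix (Fin (2 * p)) (Fin (2 * p)) ℝ} {Q : X → Matrix (Fin (2 * p)) (Fin (2 * q)) ℝ}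
    {R : X → Matrix (Fin (2 * q)) (Fin (2 * p)) ℝ} {S : X → Matrix (Fin (2 * q)) (Fin (2 * q)) ℝ}
    (hP : Continuous P) (hQ : Continuous Q) (hR : Continuous R) (hS : Continuous S) :
    Continuous fun x => blk (P x) (Q x) (R x) (S x) :=
  (hP.matrix_fromBlocks hQ hR hS).matrix_reindex _ _

lemma continuous_rws {X : Type*} [TopologicalSpace X]
    {F : X → Matrix (Fin (2 * p)) κ ℝ} {G : X → Matrix (Fin (2 * q)) κ ℝ}
    (hF : Continuous F) (hG : Continuous G) : Continuous fun x => rws (F x) (G x) := by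
  refine Continuous.matrix_reindex ?_ _ _
  refine continuous_matrix fun i j => ?_
  cases i with
  | inl i => exact hF.matrix_elem i j
  | inr i => exact hG.matrix_elem i j

lemma stateEquiv_inl_val (i : Fin (2 * p)) : (LinSys.stateEquiv p q (Sum.inl i) : ℕ) = i := by
  simp [LinSys.stateEquiv]

lemma stateEquiv_inr_val (i : Fin (2 * q)) :
    (LinSys.stateEquiv p q (Sum.inr i) : ℕ) = 2 * p + i := by
  simp [LinSys.stateEquiv]

/-- A statement about all indices is a statement about the indices of both parts. -/
lemma forall_stateEquiv {φ : Fin (2 * (p + q)) → Prop} :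
    (∀ i, φ i) ↔ (∀ i, φ (LinSys.stateEquiv p q (Sum.inl i))) ∧
      ∀ i, φ (LinSys.stateEquiv p q (Sum.inr i)) := by
  rw [← (LinSys.stateEquiv p q).forall_congr_right, Sum.forall]

section Entries

variable (P : Matrix (Fin (2 * p)) (Fin (2 * p)) ℝ) (Q : Matrix (Fin (2 * p)) (Fin (2 * q)) ℝ)
  (R : Matrix (Fin (2 * q)) (Fin (2 * p)) ℝ) (S : Matrix (Fin (2 * q)) (Fin (2 * q)) ℝ)

lemma blk_apply₁₁ (i j) : blk P Q R S (LinSys.stateEquiv p q (Sum.inl i))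
    (LinSys.stateEquiv p q (Sum.inl j)) = P i j := by simp [blk]

lemma blk_apply₁₂ (i j) : blk P Q R S (LinSys.stateEquiv p q (Sum.inl i))
    (LinSys.stateEquiv p q (Sum.inr j)) = Q i j := by simp [blk]

lemma blk_apply₂₁ (i j) : blk P Q R S (LinSys.stateEquiv p q (Sum.inr i))
    (LinSys.stateEquiv p q (Sum.inl j)) = R i j := by simp [blk]

lemma blk_apply₂₂ (i j) : blk P Q R S (LinSys.stateEquiv p q (Sum.inr i))
    (LinSys.stateEquiv p q (Sum.inr j)) = S i j := by simp [blk]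

end Entries

end Blocks

lemma isBlockDiag_blk {n : ℕ} {P : Matrix (Fin (2 * n)) (Fin (2 * n)) ℝ} (hP : IsBlockDiag P)
    (S : Matrix (Fin (2 * 1)) (Fin (2 * 1)) ℝ) : IsBlockDiag (blk P 0 0 S) := by
  unfold IsBlockDiag
  simp only [forall_stateEquiv, blk_apply₁₁, blk_apply₁₂, blk_apply₂₁, blk_apply₂₂,
    stateEquiv_inl_val, stateEquiv_inr_val]
  exact ⟨fun i => ⟨fun j => hP i j, fun j _ => rfl⟩, fun i => ⟨fun j _ => rfl,
    fun j h => absurd (by omega) h⟩⟩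

lemma blockTriangular_blk {n : ℕ} {P : Matrix (Fin (2 * n)) (Fin (2 * n)) ℝ}
    (hP : P.BlockTriangular fun i => (i : ℕ) / 2) (Q : Matrix (Fin (2 * n)) (Fin (2 * 1)) ℝ)
    (S : Matrix (Fin (2 * 1)) (Fin (2 * 1)) ℝ) :
    (blk P Q 0 S).BlockTriangular fun i => (i : ℕ) / 2 := by
  unfold Matrix.BlockTriangular
  simp only [forall_stateEquiv, blk_apply₁₁, blk_apply₁₂, blk_apply₂₁, blk_apply₂₂,
    stateEquiv_inl_val, stateEquiv_inr_val]
  exact ⟨fun i => ⟨fun j => @hP i j, fun j h => absurd h (by omega)⟩, fun i => ⟨fun j _ => rfl,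
    fun j h => absurd h (by omega)⟩⟩

lemma blk_lower_of_isLowerBlockTriangular {n : ℕ} {P : Matrix (Fin (2 * n)) (Fin (2 * n)) ℝ}
    {Q : Matrix (Fin (2 * n)) (Fin (2 * 1)) ℝ} {R : Matrix (Fin (2 * 1)) (Fin (2 * n)) ℝ}
    {S : Matrix (Fin (2 * 1)) (Fin (2 * 1)) ℝ}
    (h : IsLowerBlockTriangular (n := n + 1) (blk P Q R S)) :
    IsLowerBlockTriangular P ∧ Q = 0 := by
  unfold IsLowerBlockTriangular at h
  simp only [forall_stateEquiv, blk_apply₁₁, blk_apply₁₂, blk_apply₂₁, blk_apply₂₂,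
    stateEquiv_inl_val, stateEquiv_inr_val] at h
  refine ⟨fun i j => (h.1 i).1 j, ?_⟩
  ext i j
  exact (h.1 i).2 j (by omega)

/-! ### The symplectic form -/

lemma JMat_succ (n : ℕ) : JMat (n + 1) = blk (JMat n) 0 0 (JMat 1) := by
  refine Matrix.ext_iff.mp ?_
  simp only [forall_stateEquiv, blk_apply₁₁, blk_apply₁₂, blk_apply₂₁, blk_apply₂₂, JMat,
    Matrix.of_apply, stateEquiv_inl_val, stateEquiv_inr_val]
  refine ⟨fun i => ⟨fun j => trivial, fun j => ?_⟩, fun i => ⟨fun j => ?_, fun j => ?_⟩⟩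
  · rw [if_neg (by omega)]; rfl
  · rw [if_neg (by omega)]; rfl
  · rw [if_pos (by omega), if_pos (by omega)]
    simp only [Nat.mul_add_mod]

lemma JMat_one_eq : JMat 1 = (!![0, 1; -1, 0] : Matrix (Fin 2) (Fin 2) ℝ) := by
  ext i j
  fin_cases i <;> fin_cases j <;> simp [JMat]

lemma JMat_transpose (n : ℕ) : (JMat n)ᵀ = -JMat n := by
  induction n with
  | zero => ext i; exact i.elim0
  | succ n ih =>
    have h : (JMat 1)ᵀ = -JMat 1 := by
      rw [JMat_one_eq]; ext i j; fin_cases i <;> fin_cases j <;> simp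
    rw [JMat_succ, blk_transpose, blk_neg, ih, h]
    simp

lemma JMat_mul_self (n : ℕ) : JMat n * JMat n = -1 := by
  induction n with
  | zero => ext i; exact i.elim0
  | succ n ih =>
    have h : JMat 1 * JMat 1 = -1 := by
      rw [JMat_one_eq]
      ext i j
      fin_cases i <;> fin_cases j <;> simp [Matrix.mul_apply, Fin.sum_univ_two]
    rw [JMat_succ, blk_mul, ih, h, ← blk_one, blk_neg]
    simp

lemma JMat_mul_self_mul {n : ℕ} {κ : Type*} (M : Matrix (Fin (2 * n)) κ ℝ) :
    JMat n * (JMat n * M) = -M := by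
  rw [← Matrix.mul_assoc, JMat_mul_self, Matrix.neg_mul, Matrix.one_mul]

lemma isUnit_JMat (n : ℕ) : IsUnit (JMat n) :=
  IsUnit.of_mul_eq_one (-JMat n) (by rw [Matrix.mul_neg, JMat_mul_self, neg_neg])

lemma inv_JMat (n : ℕ) : (JMat n)⁻¹ = -JMat n :=
  Matrix.inv_eq_right_inv (by rw [Matrix.mul_neg, JMat_mul_self, neg_neg])

/-- A skew-symmetric `2 × 2` matrix is a multiple of `𝕁`. -/
lemma eq_smul_JMat_one {Z : Matrix (Fin (2 * 1)) (Fin (2 * 1)) ℝ} (h : Zᵀ = -Z) :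
    Z = Z 0 1 • JMat 1 := by
  have h' : ∀ i j, Z j i = -Z i j := fun i j => congrFun (congrFun h i) j
  have h00 := h' 0 0
  have h11 := h' 1 1
  have h01 := h' 0 1
  rw [JMat_one_eq]
  ext i j
  fin_cases i <;> fin_cases j
  · change Z 0 0 = Z 0 1 * 0; linarith
  · change Z 0 1 = Z 0 1 * 1; linarith
  · change Z 1 0 = Z 0 1 * (-1); linarith
  · change Z 1 1 = Z 0 1 * 0; linarith

lemma _root_.IsSymplectic.mul_transpose {n : ℕ} {T : Matrix (Fin (2 * n)) (Fin (2 * n)) ℝ}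
    (h : IsSymplectic T) : T * JMat n * Tᵀ = JMat n := by
  have h1 : (-JMat n * Tᵀ * JMat n) * T = 1 := by
    rw [Matrix.mul_assoc, Matrix.mul_assoc, ← Matrix.mul_assoc Tᵀ, h, Matrix.neg_mul, JMat_mul_self,
      neg_neg]
  have h2 := mul_eq_one_comm.mp h1
  have h3 : T * JMat n * Tᵀ * JMat n = -1 := by
    rw [← h2]; simp only [Matrix.neg_mul, Matrix.mul_neg, neg_neg, Matrix.mul_assoc]
  calc T * JMat n * Tᵀ = -(T * JMat n * Tᵀ * JMat n * JMat n) := by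
        rw [Matrix.mul_assoc _ (JMat n) (JMat n), JMat_mul_self, Matrix.mul_neg, neg_neg,
          Matrix.mul_one]
    _ = JMat n := by rw [h3, Matrix.neg_mul, neg_neg, Matrix.one_mul]

lemma _root_.IsSymplectic.transpose {n : ℕ} {T : Matrix (Fin (2 * n)) (Fin (2 * n)) ℝ}
    (h : IsSymplectic T) : IsSymplectic Tᵀ := by
  rw [IsSymplectic, Matrix.transpose_transpose]; exact h.mul_transpose

lemma _root_.IsSymplectic.isUnit {n : ℕ} {T : Matrix (Fin (2 * n)) (Fin (2 * n)) ℝ}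
    (h : IsSymplectic T) : IsUnit T := by
  refine IsUnit.of_mul_eq_one (-(JMat n * Tᵀ * JMat n)) ?_
  rw [Matrix.mul_neg, ← Matrix.mul_assoc, ← Matrix.mul_assoc, h.mul_transpose, JMat_mul_self,
    neg_neg]

/-! ### Leading block minors and the block triangular factorization -/

/-- All leading principal `2k × 2k` minors are nonzero. -/
def HasLeadingMinors {n : ℕ} (M : Matrix (Fin (2 * n)) (Fin (2 * n)) ℝ) : Prop :=
  ∀ (k : ℕ) (hk : k ≤ n), (M.submatrix (Fin.castLE (Nat.mul_le_mul_left 2 hk))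
    (Fin.castLE (Nat.mul_le_mul_left 2 hk))).det ≠ 0

lemma HasLeadingMinors.det_ne_zero {n : ℕ} {M : Matrix (Fin (2 * n)) (Fin (2 * n)) ℝ}
    (h : HasLeadingMinors M) : M.det ≠ 0 := h n le_rfl

lemma hasLeadingMinors_blk_iff {n : ℕ} {P : Matrix (Fin (2 * n)) (Fin (2 * n)) ℝ}
    {Q : Matrix (Fin (2 * n)) (Fin (2 * 1)) ℝ} {R : Matrix (Fin (2 * 1)) (Fin (2 * n)) ℝ}
    {S : Matrix (Fin (2 * 1)) (Fin (2 * 1)) ℝ} :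
    HasLeadingMinors (n := n + 1) (blk P Q R S) ↔
      HasLeadingMinors P ∧ (blk P Q R S).det ≠ 0 := by
  have key : ∀ (k : ℕ) (hk : k ≤ n), (blk P Q R S).submatrix
      (Fin.castLE (Nat.mul_le_mul_left 2 (Nat.le_succ_of_le hk)))
      (Fin.castLE (Nat.mul_le_mul_left 2 (Nat.le_succ_of_le hk))) =
      P.submatrix (Fin.castLE (Nat.mul_le_mul_left 2 hk))
        (Fin.castLE (Nat.mul_le_mul_left 2 hk)) := by
    intro k hk
    have h : ∀ i : Fin (2 * k), Fin.castLE (Nat.mul_le_mul_left 2 (Nat.le_succ_of_le hk)) i =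
        LinSys.stateEquiv n 1 (Sum.inl (Fin.castLE (Nat.mul_le_mul_left 2 hk) i)) := fun i =>
      Fin.ext (by rw [stateEquiv_inl_val]; rfl)
    ext i j
    rw [Matrix.submatrix_apply, Matrix.submatrix_apply, h, h, blk_apply₁₁]
  constructor
  · intro h
    refine ⟨fun k hk => ?_, h.det_ne_zero⟩
    rw [← key k hk]
    exact h k (Nat.le_succ_of_le hk)
  · rintro ⟨h1, h2⟩ k hk
    rcases Nat.le_or_eq_of_le_succ hk with hk' | rfl
    · have := h1 k hk'
      rwa [← key k hk'] at this
    · exact h2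

lemma hasLeadingMinors_zero (M : Matrix (Fin (2 * 0)) (Fin (2 * 0)) ℝ) : HasLeadingMinors M := by
  intro k hk
  obtain rfl : k = 0 := by omega
  have : IsEmpty (Fin (2 * 0)) := Fin.isEmpty'
  rw [Matrix.det_isEmpty]
  exact one_ne_zero

lemma HasLeadingMinors.neg {n : ℕ} {M : Matrix (Fin (2 * n)) (Fin (2 * n)) ℝ}
    (h : HasLeadingMinors M) : HasLeadingMinors (-M) := by
  intro k hk
  rw [Matrix.submatrix_neg, Pi.neg_apply, Pi.neg_apply, Matrix.det_neg]
  exact mul_ne_zero (pow_ne_zero _ (by norm_num)) (h k hk)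

lemma hasLeadingMinors_JMat (n : ℕ) : HasLeadingMinors (JMat n) := by
  induction n with
  | zero => exact hasLeadingMinors_zero _
  | succ n ih =>
    have h := (Matrix.isUnit_iff_isUnit_det _).mp (isUnit_JMat (n + 1))
    rw [JMat_succ] at h ⊢
    exact hasLeadingMinors_blk_iff.mpr ⟨ih, h.ne_zero⟩

/-- Skew-symmetric elimination: a skew-symmetric matrix with nonzero leading `2k × 2k` minors is
`Rᵀ 𝕁 R` with an upper block triangular `R`. -/
theorem HasLeadingMinors.exists_factorization {n : ℕ} {M : Matrix (Fin (2 * n)) (Fin (2 * n)) ℝ}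
    (h : HasLeadingMinors M) (hM : Mᵀ = -M) :
    ∃ R : Matrix (Fin (2 * n)) (Fin (2 * n)) ℝ,
      R.BlockTriangular (fun i => (i : ℕ) / 2) ∧ Rᵀ * JMat n * R = M := by
  induction n with
  | zero => exact ⟨1, fun i => i.elim0, by ext i; exact i.elim0⟩
  | succ n ih =>
    obtain ⟨P, Q, R, S, rfl⟩ := exists_blk (p := n) (q := 1) M
    rw [blk_transpose, blk_neg, blk_inj] at hM
    obtain ⟨hP, hR, hQ, hS⟩ := hM
    obtain ⟨hlead, -⟩ := hasLeadingMinors_blk_iff.mp h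
    obtain ⟨U, hU, hUP⟩ := ih hlead hP
    have hu : IsUnit (Uᵀ * JMat n) := by
      have hdet := hlead.det_ne_zero
      rw [← hUP, Matrix.det_mul] at hdet
      exact (Matrix.isUnit_iff_isUnit_det _).mpr (left_ne_zero_of_mul hdet).isUnit
    have hu' : Uᵀ * JMat n * (Uᵀ * JMat n)⁻¹ = 1 :=
      Matrix.mul_nonsing_inv _ ((Matrix.isUnit_iff_isUnit_det _).mp hu)
    set X := (Uᵀ * JMat n)⁻¹ * Q with hX
    have hUX : Uᵀ * JMat n * X = Q := by rw [hX, ← Matrix.mul_assoc, hu', Matrix.one_mul]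
    have hXU : Xᵀ * JMat n * U = R := by
      have : R = -Qᵀ := by rw [hQ, neg_neg]
      rw [this, ← hUX]
      simp [Matrix.transpose_mul, JMat_transpose, Matrix.mul_assoc]
    have hZ : (S - Xᵀ * JMat n * X)ᵀ = -(S - Xᵀ * JMat n * X) := by
      rw [Matrix.transpose_sub, hS]
      simp [Matrix.transpose_mul, JMat_transpose, Matrix.mul_assoc, neg_add_eq_sub]
    set z := (S - Xᵀ * JMat n * X) 0 1
    let q : Matrix (Fin (2 * 1)) (Fin (2 * 1)) ℝ := Matrix.diagonal (![z, 1] : Fin 2 → ℝ)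
    have hq : qᵀ * JMat 1 * q = z • JMat 1 := by
      rw [JMat_one_eq]
      ext i j
      fin_cases i <;> fin_cases j <;>
        simp [q, Matrix.mul_apply, Matrix.diagonal_apply]
    refine ⟨blk U X 0 q, blockTriangular_blk hU X q, ?_⟩
    rw [JMat_succ, blk_transpose, blk_mul, blk_mul, blk_inj]
    simp only [Matrix.mul_zero, Matrix.zero_mul, add_zero, zero_add, Matrix.transpose_zero]
    refine ⟨hUP, hUX, hXU, ?_⟩
    rw [hq, ← eq_smul_JMat_one hZ, add_sub_cancel]

/-! ### Symplectic Schur decompositions from block diagonalizations -/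

lemma isOpen_hasLeadingMinors (n : ℕ) :
    IsOpen {M : Matrix (Fin (2 * n)) (Fin (2 * n)) ℝ | HasLeadingMinors M} := by
  have : {M : Matrix (Fin (2 * n)) (Fin (2 * n)) ℝ | HasLeadingMinors M} =
      ⋂ k : Fin (n + 1), {M | (M.submatrix
        (Fin.castLE (Nat.mul_le_mul_left 2 (Nat.lt_succ_iff.mp k.2)))
        (Fin.castLE (Nat.mul_le_mul_left 2 (Nat.lt_succ_iff.mp k.2)))).det ≠ 0} := by
    ext M
    simp only [Set.mem_iInter, Set.mem_ofPred_eq]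
    exact ⟨fun h k => h k (Nat.lt_succ_iff.mp k.2), fun h k hk => h ⟨k, Nat.lt_succ_of_le hk⟩⟩
  rw [this]
  exact isOpen_iInter_of_finite fun k =>
    (continuous_id.matrix_submatrix _ _).matrix_det.isOpen_preimage _ isOpen_ne

lemma isUnit_of_det_ne_zero {ι : Type*} [Fintype ι] [DecidableEq ι] {M : Matrix ι ι ℝ}
    (h : M.det ≠ 0) : IsUnit M :=
  (Matrix.isUnit_iff_isUnit_det M).mpr h.isUnit

lemma isUnit_of_hasLeadingMinors {n : ℕ} {Ω V : Matrix (Fin (2 * n)) (Fin (2 * n)) ℝ}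
    (h : HasLeadingMinors (Vᵀ * Ω * V)) : IsUnit V := by
  have hd := h.det_ne_zero
  rw [Matrix.det_mul] at hd
  exact isUnit_of_det_ne_zero (right_ne_zero_of_mul hd)

lemma mul_inv_cancel_of_isUnit {ι : Type*} [Fintype ι] [DecidableEq ι] {M : Matrix ι ι ℝ}
    (h : IsUnit M) : M * M⁻¹ = 1 :=
  Matrix.mul_nonsing_inv M ((Matrix.isUnit_iff_isUnit_det M).mp h)

lemma inv_mul_cancel_of_isUnit {ι : Type*} [Fintype ι] [DecidableEq ι] {M : Matrix ι ι ℝ}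
    (h : IsUnit M) : M⁻¹ * M = 1 :=
  Matrix.nonsing_inv_mul M ((Matrix.isUnit_iff_isUnit_det M).mp h)

/-- If `V` block diagonalizes `A` and `Vᵀ 𝕁 V` has nonzero leading minors, then `Vᵀ 𝕁 V = Rᵀ 𝕁 R`
with `R` upper block triangular. So `V R⁻¹` is symplectic and brings `A` into upper block triangular
form; transposition gives the lower block triangular form of `Aᵀ`. -/
theorem hasSymplecticSchur_transpose {n : ℕ} {V D : Matrix (Fin (2 * n)) (Fin (2 * n)) ℝ}
    (hD : IsBlockDiag D) (hV : HasLeadingMinors (Vᵀ * JMat n * V)) :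
    HasSymplecticSchur (V * D * V⁻¹)ᵀ := by
  have hVu := isUnit_of_hasLeadingMinors hV
  obtain ⟨R, hR, hRJ⟩ := hV.exists_factorization (by
    simp [Matrix.transpose_mul, JMat_transpose, Matrix.mul_assoc])
  have hRu : IsUnit R := isUnit_of_hasLeadingMinors (Ω := JMat n) (by rwa [hRJ])
  have hRinv := mul_inv_cancel_of_isUnit hRu
  have hVR : V * R⁻¹ * R = V := by
    rw [Matrix.mul_assoc, inv_mul_cancel_of_isUnit hRu, Matrix.mul_one]
  have hP : IsSymplectic (V * R⁻¹) := by
    have : (V * R⁻¹)ᵀ * JMat n * (V * R⁻¹) = (R⁻¹)ᵀ * (Vᵀ * JMat n * V) * R⁻¹ := by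
      simp only [Matrix.transpose_mul, Matrix.mul_assoc]
    rw [IsSymplectic, this, ← hRJ]
    calc (R⁻¹)ᵀ * (Rᵀ * JMat n * R) * R⁻¹ = (R * R⁻¹)ᵀ * JMat n * (R * R⁻¹) := by
          simp only [Matrix.transpose_mul, Matrix.mul_assoc]
      _ = JMat n := by rw [hRinv, Matrix.transpose_one, Matrix.one_mul, Matrix.mul_one]
  refine ⟨(V * R⁻¹)ᵀ, (R * D * R⁻¹)ᵀ, hP.transpose, ?_, ?_⟩
  · have hRi : (R⁻¹).BlockTriangular fun i : Fin (2 * n) => (i : ℕ) / 2 := by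
      let _ := hRu.invertible
      exact Matrix.blockTriangular_inv_of_blockTriangular hR
    exact fun i j hij => ((hR.mul hD.blockTriangular).mul hRi) hij
  · rw [← Matrix.transpose_nonsing_inv, ← Matrix.transpose_mul, ← Matrix.transpose_mul]
    congr 1
    have h1 : (V * R⁻¹)⁻¹ = R * V⁻¹ := by
      refine Matrix.inv_eq_right_inv ?_
      rw [← Matrix.mul_assoc, hVR, mul_inv_cancel_of_isUnit hVu]
    calc V * D * V⁻¹ = V * R⁻¹ * R * D * (R⁻¹ * R) * V⁻¹ := by
          rw [hVR, inv_mul_cancel_of_isUnit hRu, Matrix.mul_one]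
      _ = V * R⁻¹ * (R * D * R⁻¹ * (V * R⁻¹)⁻¹) := by
          rw [h1]; simp only [Matrix.mul_assoc]

/-! ### Cascades of systems in quadrature form -/

lemma rws_transpose {p q : ℕ} {κ : Type*} (X : Matrix (Fin (2 * p)) κ ℝ)
    (Y : Matrix (Fin (2 * q)) κ ℝ) :
    (rws X Y)ᵀ = Matrix.reindex (Equiv.refl κ) (LinSys.stateEquiv p q)
      (Matrix.fromCols Xᵀ Yᵀ) := by
  rw [rws, Matrix.transpose_reindex, Matrix.transpose_fromRows]

/-- A physically realizable system with a lower block triangular `A` is the series product of a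
system with one degree of freedom and one with the others, whatever the factorization `D = D₂ D₁`
of the feedthrough matrix: physical realizability forces the coupling block `A₂₁` to be the one of
the series product. -/
lemma exists_series_of_lower {n m : ℕ} {G : LinSys (n + 1) m} (hG : G.PhysicallyRealizable)
    (hA : IsLowerBlockTriangular G.A) {D₁ D₂ : Matrix (Fin (2 * m)) (Fin (2 * m)) ℝ}
    (hD : D₂ * D₁ = G.D) (h₁ : D₁ * JMat m * D₁ᵀ = JMat m) (h₂ : D₂ * JMat m * D₂ᵀ = JMat m) :
    ∃ (G₁ : LinSys n m) (G₂ : LinSys 1 m), G₁.PhysicallyRealizable ∧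
      IsLowerBlockTriangular G₁.A ∧ G₁.D = D₁ ∧ G₂.PhysicallyRealizable ∧ G₂.D = D₂ ∧
      LinSys.series G₂ G₁ = G := by
  obtain ⟨A, B, C, D⟩ := G
  dsimp only at hD hA
  subst hD
  obtain ⟨hAB, hBC, -⟩ := hG
  dsimp only at hAB hBC
  obtain ⟨A₁, Z, Y, A₂, rfl⟩ := exists_blk (p := n) (q := 1) A
  obtain ⟨B₁, B₂, rfl⟩ := exists_rws (p := n) (q := 1) B
  obtain ⟨c₁, c₂, hC⟩ := exists_rws (p := n) (q := 1) Cᵀ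
  obtain ⟨hA₁, rfl⟩ := blk_lower_of_isLowerBlockTriangular hA
  obtain rfl : C = (rws c₁ c₂)ᵀ := by rw [← hC, Matrix.transpose_transpose]
  rw [JMat_succ, blk_mul, blk_transpose, blk_mul, rws_mul, rws_mul_transpose, blk_add, blk_add,
    ← blk_zero, blk_inj] at hAB
  have hz : (0 : Matrix (Fin (2 * (n + 1))) (Fin (2 * m)) ℝ) = rws 0 0 := by
    simpa using (rws_mul (0 : Matrix (Fin (2 * n)) (Fin 1) ℝ) (0 : Matrix (Fin (2 * 1)) (Fin 1) ℝ)
      (0 : Matrix (Fin 1) (Fin (2 * m)) ℝ))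
  have hadd : ∀ (X X' : Matrix (Fin (2 * n)) (Fin (2 * m)) ℝ)
      (Y Y' : Matrix (Fin (2 * 1)) (Fin (2 * m)) ℝ),
      rws X Y + rws X' Y' = rws (X + X') (Y + Y') := by
    intro X X' Y Y'
    ext i j
    obtain ⟨i, rfl⟩ := (LinSys.stateEquiv n 1).surjective i
    cases i <;> simp [rws]
  rw [Matrix.transpose_transpose, JMat_succ, blk_mul_rws, rws_mul, rws_mul, hadd, hz,
    rws_inj] at hBC
  simp only [Matrix.mul_zero, Matrix.zero_mul, add_zero, zero_add, Matrix.transpose_zero]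
    at hAB hBC
  obtain ⟨hA11, -, hA21, hA22⟩ := hAB
  obtain ⟨hC1, hC2⟩ := hBC
  -- the inverses of the feedthrough matrices
  have hF : ∀ {D : Matrix (Fin (2 * m)) (Fin (2 * m)) ℝ}, D * JMat m * Dᵀ = JMat m →
      ∃ F, D * F = 1 ∧ F * D = 1 ∧ F * JMat m = JMat m * Dᵀ := by
    intro D h
    have h1 : D * -(JMat m * Dᵀ * JMat m) = 1 := by
      rw [Matrix.mul_neg, ← Matrix.mul_assoc, ← Matrix.mul_assoc, h, JMat_mul_self, neg_neg]
    refine ⟨_, h1, mul_eq_one_comm.mp h1, ?_⟩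
    rw [Matrix.neg_mul, Matrix.mul_assoc, JMat_mul_self, Matrix.mul_neg, neg_neg, Matrix.mul_one]
  obtain ⟨F₁, hF1, hF1', hF1J⟩ := hF h₁
  obtain ⟨F₂, hF2, hF2', hF2J⟩ := hF h₂
  have hF2T : D₂ᵀ * F₂ᵀ = 1 := by rw [← Matrix.transpose_mul, hF2', Matrix.transpose_one]
  have hF1T : D₁ᵀ * F₁ᵀ = 1 := by rw [← Matrix.transpose_mul, hF1', Matrix.transpose_one]
  have hFJF : F₁ * JMat m * F₁ᵀ = JMat m := by
    rw [hF1J, Matrix.mul_assoc, hF1T, Matrix.mul_one]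
  have hc1 : c₁ = JMat n * (B₁ * (JMat m * (D₂ * D₁)ᵀ)) := by
    have := congrArg (fun M => JMat n * M) (eq_neg_of_add_eq_zero_left hC1)
    simp only [JMat_mul_self_mul, Matrix.mul_neg, neg_inj] at this
    rw [this, Matrix.mul_assoc]
  have hYJ : Y * JMat n = -(B₂ * JMat m * B₁ᵀ) := eq_neg_of_add_eq_zero_left hA21
  have hY : Y = B₂ * JMat m * B₁ᵀ * JMat n := by
    have := congrArg (fun M => M * JMat n) hYJ
    simp only [Matrix.mul_assoc, JMat_mul_self, Matrix.neg_mul, Matrix.mul_neg,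
      Matrix.mul_one, neg_inj] at this
    rw [this]; simp only [Matrix.mul_assoc]
  refine ⟨⟨A₁, B₁, F₂ * c₁ᵀ, D₁⟩, ⟨A₂, B₂ * F₁, c₂ᵀ, D₂⟩, ⟨hA11, ?_, h₁⟩, hA₁, rfl,
    ⟨?_, ?_, h₂⟩, rfl, ?_⟩
  · have := congrArg (fun M => M * F₂ᵀ) hC1
    simp only [Matrix.add_mul, Matrix.transpose_mul, Matrix.mul_assoc, hF2T, Matrix.mul_one,
      Matrix.zero_mul] at this
    simpa only [Matrix.transpose_mul, Matrix.transpose_transpose, Matrix.mul_assoc] using this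
  · have : B₂ * F₁ * JMat m * (B₂ * F₁)ᵀ = B₂ * (F₁ * JMat m * F₁ᵀ) * B₂ᵀ := by
      simp only [Matrix.transpose_mul, Matrix.mul_assoc]
    dsimp only
    rw [this, hFJF]
    exact hA22
  · dsimp only
    rw [Matrix.transpose_transpose, Matrix.mul_assoc B₂, hF1J]
    simpa only [Matrix.transpose_mul, Matrix.mul_assoc] using hC2
  · have e1 : B₂ * F₁ * (F₂ * c₁ᵀ) = Y := by
      have hFF : F₁ * F₂ * (D₂ * D₁) = 1 := by
        rw [Matrix.mul_assoc, ← Matrix.mul_assoc F₂, hF2', Matrix.one_mul, hF1']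
      calc B₂ * F₁ * (F₂ * c₁ᵀ) = B₂ * (F₁ * F₂ * (D₂ * D₁)) * JMat m * B₁ᵀ * JMat n := by
            rw [hc1]
            simp [Matrix.transpose_mul, JMat_transpose, Matrix.mul_assoc]
        _ = Y := by rw [hFF, Matrix.mul_one, hY]
    have e2 : B₂ * F₁ * D₁ = B₂ := by rw [Matrix.mul_assoc, hF1', Matrix.mul_one]
    have e3 : D₂ * (F₂ * c₁ᵀ) = c₁ᵀ := by rw [← Matrix.mul_assoc, hF2, Matrix.one_mul]
    simp only [LinSys.series, LinSys.mk.injEq, e1, e2, e3, rws_transpose]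
    exact ⟨rfl, rfl, trivial, trivial⟩

/-- A physically realizable system with a lower block triangular `A` is a cascade. -/
lemma exists_cascade_of_lower {m : ℕ} (n : ℕ) (G : LinSys (n + 1) m)
    (hG : G.PhysicallyRealizable) (hA : IsLowerBlockTriangular G.A) :
    ∃ g : Fin (n + 1) → LinSys 1 m, (∀ k, (g k).PhysicallyRealizable) ∧
      (∀ k, (g k).D = if (k : ℕ) = 0 then G.D else 1) ∧ LinSys.cascade (n + 1) g = G := by
  have hone : (1 : Matrix (Fin (2 * m)) (Fin (2 * m)) ℝ) * JMat m * 1ᵀ = JMat m := by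
    rw [Matrix.one_mul, Matrix.transpose_one, Matrix.mul_one]
  induction n with
  | zero =>
    obtain ⟨G₁, G₂, -, -, hD₁, h₂, hD₂, hs⟩ :=
      exists_series_of_lower hG hA (Matrix.mul_one G.D) hone hG.2.2
    refine ⟨fun _ => G₂, fun _ => h₂, fun k => by simp [hD₂], ?_⟩
    rw [← hs]
    refine congrArg (LinSys.series G₂) ?_
    refine LinSys.ext ?_ ?_ ?_ hD₁.symm
    · ext i; exact i.elim0
    · ext i; exact i.elim0
    · ext i j; exact j.elim0
  | succ n ih =>
    obtain ⟨G₁, G₂, h₁, hA₁, hD₁, h₂, hD₂, hs⟩ :=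
      exists_series_of_lower hG hA (Matrix.one_mul G.D) hG.2.2 hone
    obtain ⟨g, hg, hgD, hgc⟩ := ih G₁ h₁ hA₁
    refine ⟨Fin.snoc (α := fun _ => LinSys 1 m) g G₂, fun k => ?_, fun k => ?_, ?_⟩
    · refine Fin.lastCases ?_ (fun k => ?_) k
      · rwa [Fin.snoc_last]
      · rw [Fin.snoc_castSucc]; exact hg k
    · refine Fin.lastCases ?_ (fun k => ?_) k
      · rw [Fin.snoc_last, hD₂, if_neg (by simp)]
      · rw [Fin.snoc_castSucc, hgD k, hD₁]; rfl
    · rw [LinSys.cascade]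
      simp only [Fin.snoc_last, Fin.snoc_castSucc, hgc, hs]

lemma transfer_transform {n m : ℕ} (G : LinSys n m)
    {T : Matrix (Fin (2 * n)) (Fin (2 * n)) ℝ} (hT : IsUnit T) (s : ℂ) :
    (G.transform T).transfer s = G.transfer s := by
  let t := T.map Complex.ofReal
  let t' := (T⁻¹).map Complex.ofReal
  have h1 : t * t' = 1 := by
    have := congrArg (Complex.ofRealHom.mapMatrix) (mul_inv_cancel_of_isUnit hT)
    rwa [map_mul, map_one] at this
  have h2 : t' * t = 1 := mul_eq_one_comm.mp h1
  have hmap : ∀ {κ κ' κ'' : Type} [Fintype κ'] (X : Matrix κ κ' ℝ) (Y : Matrix κ' κ'' ℝ),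
      (X * Y).map Complex.ofReal = X.map Complex.ofReal * Y.map Complex.ofReal :=
    fun X Y => Matrix.map_mul (f := Complex.ofRealHom)
  have hinv : (s • (1 : Matrix (Fin (2 * n)) (Fin (2 * n)) ℂ) - t * G.A.map Complex.ofReal * t')⁻¹ =
      t * (s • (1 : Matrix (Fin (2 * n)) (Fin (2 * n)) ℂ) - G.A.map Complex.ofReal)⁻¹ * t' := by
    have e1 : t⁻¹ = t' := Matrix.inv_eq_right_inv h1
    have e2 : t'⁻¹ = t := Matrix.inv_eq_right_inv h2
    have : s • (1 : Matrix (Fin (2 * n)) (Fin (2 * n)) ℂ) - t * G.A.map Complex.ofReal * t' =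
        t * (s • (1 : Matrix (Fin (2 * n)) (Fin (2 * n)) ℂ) - G.A.map Complex.ofReal) * t' := by
      rw [Matrix.mul_sub, Matrix.sub_mul, Matrix.mul_smul, Matrix.mul_one, Matrix.smul_mul, h1]
    rw [this, Matrix.mul_inv_rev, Matrix.mul_inv_rev, e1, e2, Matrix.mul_assoc]
  simp only [LinSys.transfer, LinSys.transform, hmap]
  change G.C.map Complex.ofReal * t' * (s • (1 : Matrix (Fin (2 * n)) (Fin (2 * n)) ℂ) -
    t * G.A.map Complex.ofReal * t')⁻¹ * (t * G.B.map Complex.ofReal) + _ = _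
  rw [hinv]
  congr 1
  calc _ = G.C.map Complex.ofReal * (t' * t) *
        (s • (1 : Matrix (Fin (2 * n)) (Fin (2 * n)) ℂ) - G.A.map Complex.ofReal)⁻¹ * (t' * t) *
        G.B.map Complex.ofReal := by simp only [Matrix.mul_assoc]
    _ = _ := by rw [h2, Matrix.mul_one, Matrix.mul_one]

lemma _root_.LinSys.PhysicallyRealizable.transform {n m : ℕ} {G : LinSys n m}
    (hG : G.PhysicallyRealizable) {T : Matrix (Fin (2 * n)) (Fin (2 * n)) ℝ}
    (hT : IsSymplectic T) : (G.transform T).PhysicallyRealizable := by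
  obtain ⟨h1, h2, h3⟩ := hG
  have hTi := inv_mul_cancel_of_isUnit hT.isUnit
  have hTiT : Tᵀ * (T⁻¹)ᵀ = 1 := by rw [← Matrix.transpose_mul, hTi, Matrix.transpose_one]
  have hJ1 : T⁻¹ * JMat n = JMat n * Tᵀ := by
    rw [← hT.mul_transpose, ← Matrix.mul_assoc, ← Matrix.mul_assoc, hTi, Matrix.one_mul,
      hT.mul_transpose]
  have hJ2 : JMat n * (T⁻¹)ᵀ = T * JMat n := by
    rw [← hT.mul_transpose, Matrix.mul_assoc, hTiT, Matrix.mul_one, hT.mul_transpose]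
  refine ⟨?_, ?_, h3⟩
  · have : T * (G.A * JMat n + JMat n * G.Aᵀ + G.B * JMat m * G.Bᵀ) * Tᵀ = 0 := by
      rw [h1, Matrix.mul_zero, Matrix.zero_mul]
    rw [← this]
    simp only [LinSys.transform, Matrix.transpose_mul, Matrix.mul_add, Matrix.add_mul,
      Matrix.mul_assoc, hJ1]
    rw [← Matrix.mul_assoc (JMat n) (T⁻¹)ᵀ, hJ2]
    simp only [Matrix.mul_assoc]
  · have : T * (JMat n * G.Cᵀ + G.B * JMat m * G.Dᵀ) = 0 := by
      rw [h2, Matrix.mul_zero]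
    rw [← this]
    simp only [LinSys.transform, Matrix.transpose_mul, Matrix.mul_add, Matrix.mul_assoc]
    rw [← Matrix.mul_assoc (JMat n) (T⁻¹)ᵀ, hJ2, Matrix.mul_assoc]

/-- A symplectic Schur decomposition of `A` turns a physically realizable system into a cascade. -/
theorem hasPureCascadeRealization_of_schur {n m : ℕ} (hn : 1 ≤ n) {G : LinSys n m}
    (hG : G.PhysicallyRealizable) (hA : HasSymplecticSchur G.A) :
    G.HasPureCascadeRealization := by
  obtain ⟨S, U, hS, hU, hAS⟩ := hA
  have hGA : (G.transform S).A = U := by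
    change S * G.A * S⁻¹ = U
    have h := mul_inv_cancel_of_isUnit hS.isUnit
    rw [hAS]
    calc S * (S⁻¹ * U * S) * S⁻¹ = (S * S⁻¹) * U * (S * S⁻¹) := by
          simp only [Matrix.mul_assoc]
      _ = U := by rw [h, Matrix.one_mul, Matrix.mul_one]
  obtain ⟨n, rfl⟩ : ∃ k, n = k + 1 := ⟨n - 1, by omega⟩
  obtain ⟨g, hg, hgD, hgc⟩ := exists_cascade_of_lower n (G.transform S) (hG.transform hS)
    (by rwa [hGA])
  exact ⟨S, g, hS, hg, hgD, hgc, fun s _ => by rw [hgc, transfer_transform G hS.isUnit]⟩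

/-! ### Cascades of systems given by their parameters -/

lemma map_im_conjTranspose {κ κ' : Type*} (M : Matrix κ κ' ℂ) :
    Mᴴ.map Complex.im = -(M.map Complex.im)ᵀ := by
  ext i j; simp

/-- A system whose matrix `A` is lower block triangular is the series product of a system with one
degree of freedom and one with the others, for every factorization of its scattering matrix: the
vanishing of `A₁₂` gives the required coupling Hamiltonian. -/
lemma exists_slh_series_of_lower {n m : ℕ} {G : SLHSys (n + 1) m}
    (hA : IsLowerBlockTriangular G.toLinSys.A) {S₁ S₂ : Matrix (Fin m) (Fin m) ℂ}
    (hS : S₂ * S₁ = G.S) (h₁ : S₁ ∈ Matrix.unitaryGroup (Fin m) ℂ)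
    (h₂ : S₂ ∈ Matrix.unitaryGroup (Fin m) ℂ) :
    ∃ (G₁ : SLHSys n m) (G₂ : SLHSys 1 m), IsLowerBlockTriangular G₁.toLinSys.A ∧
      G₁.S = S₁ ∧ G₂.S = S₂ ∧ SLHSys.series G₂ G₁ = G := by
  obtain ⟨S, K, R, hSu, hR⟩ := G
  dsimp only at hS
  subst hS
  obtain ⟨R₁, Z, Y, R₂, rfl⟩ := exists_blk (p := n) (q := 1) R
  let e := LinSys.stateEquiv n 1
  let K₁ : Matrix (Fin m) (Fin (2 * n)) ℂ := (K.submatrix id e).toCols₁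
  let K₂ : Matrix (Fin m) (Fin (2 * 1)) ℂ := (K.submatrix id e).toCols₂
  have hK : K = Matrix.reindex (Equiv.refl _) e (Matrix.fromCols K₁ K₂) := by
    ext i j
    obtain ⟨j, rfl⟩ := e.surjective j
    cases j <;> simp [K₁, K₂, Matrix.toCols₁, Matrix.toCols₂]
  rw [blk_transpose, blk_inj] at hR
  obtain ⟨hR₁, hYZ, -, hR₂⟩ := hR
  have hKK : (Kᴴ * K).map Complex.im = blk ((K₁ᴴ * K₁).map Complex.im)
      ((K₁ᴴ * K₂).map Complex.im) ((K₂ᴴ * K₁).map Complex.im) ((K₂ᴴ * K₂).map Complex.im) := by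
    refine Matrix.ext_iff.mp ?_
    rw [hK]
    simp only [forall_stateEquiv, blk_apply₁₁, blk_apply₁₂, blk_apply₂₁, blk_apply₂₂]
    refine ⟨fun i => ⟨fun j => ?_, fun j => ?_⟩, fun i => ⟨fun j => ?_, fun j => ?_⟩⟩ <;>
      simp [Matrix.mul_apply, e]
  have hAeq : (SLHSys.toLinSys ⟨S₂ * S₁, K, blk R₁ Z Y R₂, hSu, by
      rw [blk_transpose, blk_inj]; exact ⟨hR₁, hYZ, by rw [← hYZ, transpose_transpose], hR₂⟩⟩).A =
      blk ((2 : ℝ) • (JMat n * (R₁ + (K₁ᴴ * K₁).map Complex.im)))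
        ((2 : ℝ) • (JMat n * (Z + (K₁ᴴ * K₂).map Complex.im)))
        ((2 : ℝ) • (JMat 1 * (Y + (K₂ᴴ * K₁).map Complex.im)))
        ((2 : ℝ) • (JMat 1 * (R₂ + (K₂ᴴ * K₂).map Complex.im))) := by
    change (2 : ℝ) • (JMat (n + 1) * (blk R₁ Z Y R₂ + (Kᴴ * K).map Complex.im)) = _
    rw [hKK, blk_add, JMat_succ, blk_mul, two_smul, blk_add, blk_inj]
    simp [two_smul]
  have hA' := hAeq ▸ hA
  obtain ⟨hA₁, hA12⟩ := blk_lower_of_isLowerBlockTriangular hA'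
  have hZ : Z = -(K₁ᴴ * K₂).map Complex.im := by
    have h0 : JMat n * (Z + (K₁ᴴ * K₂).map Complex.im) = 0 :=
      (smul_eq_zero.mp hA12).resolve_left two_ne_zero
    have h1 := congrArg (fun M => JMat n * M) h0
    simp only [JMat_mul_self_mul, Matrix.mul_zero, neg_eq_zero] at h1
    exact eq_neg_of_add_eq_zero_left h1
  have hZ' : Z = ((K₂ᴴ * K₁).map Complex.im)ᵀ := by
    rw [hZ, ← Matrix.transpose_transpose ((K₁ᴴ * K₂).map Complex.im), ← Matrix.transpose_neg,
      ← map_im_conjTranspose, Matrix.conjTranspose_mul, Matrix.conjTranspose_conjTranspose]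
  have hY : Y = (K₂ᴴ * K₁).map Complex.im := by
    rw [← Matrix.transpose_transpose Y, hYZ, hZ', Matrix.transpose_transpose]
  have hS2 : S₂ * S₂ᴴ = 1 := Matrix.mem_unitaryGroup_iff.mp h₂
  have hKu : (S₂ᴴ * K₁)ᴴ * (S₂ᴴ * K₁) = K₁ᴴ * K₁ := by
    rw [Matrix.conjTranspose_mul, Matrix.conjTranspose_conjTranspose, Matrix.mul_assoc,
      ← Matrix.mul_assoc S₂, hS2, Matrix.one_mul]
  refine ⟨⟨S₁, S₂ᴴ * K₁, R₁, h₁, hR₁⟩, ⟨S₂, K₂, R₂, h₂, hR₂⟩, ?_, rfl, rfl, ?_⟩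
  · change IsLowerBlockTriangular
      ((2 : ℝ) • (JMat n * (R₁ + ((S₂ᴴ * K₁)ᴴ * (S₂ᴴ * K₁)).map Complex.im)))
    rwa [hKu]
  · refine SLHSys.ext rfl ?_ ?_
    · change Matrix.reindex (Equiv.refl _) e (Matrix.fromCols (S₂ * (S₂ᴴ * K₁)) K₂) = K
      rw [← Matrix.mul_assoc, hS2, Matrix.one_mul, ← hK]
    · change blk R₁ ((K₂ᴴ * S₂ * (S₂ᴴ * K₁)).map Complex.im)ᵀ
        ((K₂ᴴ * S₂ * (S₂ᴴ * K₁)).map Complex.im) R₂ = blk R₁ Z Y R₂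
      rw [Matrix.mul_assoc, ← Matrix.mul_assoc S₂, hS2, Matrix.one_mul, ← hZ', ← hY]

/-- A system whose matrix `A` is lower block triangular is a cascade. -/
lemma exists_slh_cascade_of_lower {m : ℕ} (n : ℕ) (G : SLHSys (n + 1) m)
    (hA : IsLowerBlockTriangular G.toLinSys.A) :
    ∃ g : Fin (n + 1) → SLHSys 1 m,
      (∀ k, (g k).S = if (k : ℕ) = 0 then G.S else 1) ∧ SLHSys.cascade (n + 1) g = G := by
  induction n with
  | zero =>
    obtain ⟨G₁, G₂, -, hS₁, hS₂, hs⟩ :=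
      exists_slh_series_of_lower hA (Matrix.mul_one G.S) (one_mem _) G.unitary_S
    refine ⟨fun _ => G₂, fun k => by simp [hS₂], ?_⟩
    rw [← hs]
    refine congrArg (SLHSys.series G₂) ?_
    refine SLHSys.ext hS₁.symm ?_ ?_
    · ext i j; exact j.elim0
    · ext i; exact i.elim0
  | succ n ih =>
    obtain ⟨G₁, G₂, hA₁, hS₁, hS₂, hs⟩ :=
      exists_slh_series_of_lower hA (Matrix.one_mul G.S) G.unitary_S (one_mem _)
    obtain ⟨g, hgS, hgc⟩ := ih G₁ hA₁
    refine ⟨Fin.snoc (α := fun _ => SLHSys 1 m) g G₂, fun k => ?_, ?_⟩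
    · refine Fin.lastCases ?_ (fun k => ?_) k
      · rw [Fin.snoc_last, hS₂, if_neg (by simp)]
      · rw [Fin.snoc_castSucc, hgS k, hS₁]; rfl
    · rw [SLHSys.cascade]
      simp only [Fin.snoc_last, Fin.snoc_castSucc, hgc, hs]

lemma map_im_mul_map_ofReal {κ κ' κ'' : Type*} [Fintype κ'] (M : Matrix κ κ' ℂ)
    (N : Matrix κ' κ'' ℝ) : (M * N.map Complex.ofReal).map Complex.im = M.map Complex.im * N := by
  ext i j; simp [Matrix.mul_apply]

lemma map_im_map_ofReal_mul {κ κ' κ'' : Type*} [Fintype κ'] (N : Matrix κ κ' ℝ)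
    (M : Matrix κ' κ'' ℂ) : (N.map Complex.ofReal * M).map Complex.im = N * M.map Complex.im := by
  ext i j; simp [Matrix.mul_apply]

lemma conjTranspose_map_ofReal {κ κ' : Type*} (N : Matrix κ κ' ℝ) :
    (N.map Complex.ofReal)ᴴ = Nᵀ.map Complex.ofReal := by
  ext i j; simp

/-- Symplectic changes of variables of the parameters and of the quadrature form agree. -/
lemma toLinSys_transform {n m : ℕ} (G : SLHSys n m)
    {T : Matrix (Fin (2 * n)) (Fin (2 * n)) ℝ} (hT : IsSymplectic T) :
    (G.transform T).toLinSys = G.toLinSys.transform T := by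
  have hTi := inv_mul_cancel_of_isUnit hT.isUnit
  have hTiT : Tᵀ * (T⁻¹)ᵀ = 1 := by rw [← Matrix.transpose_mul, hTi, Matrix.transpose_one]
  have hJ : JMat n * (T⁻¹)ᵀ = T * JMat n := by
    rw [← hT.mul_transpose, Matrix.mul_assoc, hTiT, Matrix.mul_one, hT.mul_transpose]
  refine LinSys.ext ?_ ?_ ?_ rfl
  · change (2 : ℝ) • (JMat n * ((T⁻¹)ᵀ * G.R * T⁻¹ + ((G.K * (T⁻¹).map Complex.ofReal)ᴴ *
      (G.K * (T⁻¹).map Complex.ofReal)).map Complex.im)) = T * ((2 : ℝ) • (JMat n * (G.R +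
      (G.Kᴴ * G.K).map Complex.im))) * T⁻¹
    rw [Matrix.conjTranspose_mul, conjTranspose_map_ofReal,
      Matrix.mul_assoc ((T⁻¹)ᵀ.map Complex.ofReal), map_im_map_ofReal_mul,
      ← Matrix.mul_assoc G.Kᴴ, map_im_mul_map_ofReal, Matrix.mul_smul,
      Matrix.smul_mul, ← Matrix.mul_assoc T, ← hJ]
    simp only [Matrix.mul_assoc, Matrix.mul_add, Matrix.add_mul]
  · change (2 : ℝ) • (JMat n * _) = T * ((2 : ℝ) • (JMat n * _))
    rw [Matrix.mul_smul, ← Matrix.mul_assoc T, ← hJ, Matrix.mul_assoc]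
    congr 2
    ext i j
    simp only [SLHSys.transform, Matrix.conjTranspose_mul, conjTranspose_map_ofReal,
      Matrix.of_apply, Matrix.mul_apply (M := (T⁻¹)ᵀ), Matrix.mul_assoc]
    rw [Matrix.mul_apply]
    split_ifs with h <;> simp
  · change (2 : ℝ) • (Matrix.of _) = ((2 : ℝ) • Matrix.of _) * T⁻¹
    rw [Matrix.smul_mul]
    congr 1
    ext i j
    simp only [SLHSys.transform, Matrix.of_apply, Matrix.mul_apply]
    split_ifs with h <;> simp

/-- A symplectic Schur decomposition of the matrix `A` of a system given by its parameters turns it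
into a cascade. -/
theorem slh_hasPureCascadeRealization_of_schur {n m : ℕ} (hn : 1 ≤ n) {G : SLHSys n m}
    (hA : HasSymplecticSchur G.toLinSys.A) : G.HasPureCascadeRealization := by
  obtain ⟨S, U, hS, hU, hAS⟩ := hA
  have hGA : (G.transform S).toLinSys.A = U := by
    rw [toLinSys_transform G hS]
    change S * G.toLinSys.A * S⁻¹ = U
    have h := mul_inv_cancel_of_isUnit hS.isUnit
    rw [hAS]
    calc S * (S⁻¹ * U * S) * S⁻¹ = (S * S⁻¹) * U * (S * S⁻¹) := by
          simp only [Matrix.mul_assoc]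
      _ = U := by rw [h, Matrix.one_mul, Matrix.mul_one]
  obtain ⟨n, rfl⟩ : ∃ k, n = k + 1 := ⟨n - 1, by omega⟩
  obtain ⟨g, hgS, hgc⟩ := exists_slh_cascade_of_lower n (G.transform S) (by rwa [hGA])
  exact ⟨S, g, hS, hgS, hgc, fun s _ => by
    rw [hgc, toLinSys_transform G hS, transfer_transform _ hS.isUnit]⟩

/-! ### Two-dimensional invariant subspaces -/

section InvariantPair

open Polynomial

/-- A real polynomial of degree at least two has a divisor of degree two, as its irreducible factors
have degree at most two. -/
lemma exists_monic_natDegree_two_dvd {p : ℝ[X]} (hp : p.Monic) (h : 2 ≤ p.natDegree) :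
    ∃ q : ℝ[X], q.Monic ∧ q.natDegree = 2 ∧ q ∣ p := by
  have key : ∀ r : ℝ[X], r.Monic → r.natDegree ≠ 0 →
      ∃ g : ℝ[X], g.Monic ∧ (g.natDegree = 1 ∨ g.natDegree = 2) ∧ g ∣ r := by
    intro r hr hr0
    obtain ⟨g, hg, hgr⟩ := Polynomial.exists_irreducible_of_natDegree_ne_zero hr0
    have hlc : g.leadingCoeff ≠ 0 := leadingCoeff_ne_zero.mpr hg.ne_zero
    refine ⟨g * C g.leadingCoeff⁻¹, monic_mul_leadingCoeff_inv hg.ne_zero, ?_, ?_⟩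
    · rw [natDegree_mul_C (inv_ne_zero hlc)]
      have := hg.natDegree_le_two
      have := hg.natDegree_pos
      omega
    · exact (associated_mul_unit_left g _ (isUnit_C.mpr (inv_ne_zero hlc).isUnit)).dvd.trans hgr
  obtain ⟨g, hg, hdeg, r, rfl⟩ := key p hp (by omega)
  rcases hdeg with hdeg | hdeg
  · have hr : r.Monic := hg.of_mul_monic_left hp
    rw [hg.natDegree_mul hr] at h
    obtain ⟨g', hg', hdeg', hd⟩ := key r hr (by omega)
    rcases hdeg' with hdeg' | hdeg'
    · exact ⟨g * g', hg.mul hg', by rw [hg.natDegree_mul hg']; omega, mul_dvd_mul_left g hd⟩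
    · exact ⟨g', hg', hdeg', hd.mul_left g⟩
  · exact ⟨g, hg, hdeg, dvd_mul_right g r⟩

/-- A real endomorphism in dimension at least two has a two-dimensional invariant subspace. Unless
the endomorphism is a homothety, its minimal polynomial is `q h` with `q` of degree two, and some
vector in the range of `h` spans one together with its image. -/
theorem exists_invariant_pair {V : Type*} [AddCommGroup V] [Module ℝ V] [FiniteDimensional ℝ V]
    (hV : 2 ≤ Module.finrank ℝ V) (f : Module.End ℝ V) :
    ∃ u w : V, LinearIndependent ℝ ![u, w] ∧ ∃ a b c d : ℝ,
      f u = a • u + b • w ∧ f w = c • u + d • w := by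
  by_cases hall : ∀ v, ¬ LinearIndependent ℝ ![v, f v]
  · obtain ⟨a, ha⟩ := LinearMap.exists_eq_smul_id_of_forall_notLinearIndependent hall
    obtain ⟨v, hv⟩ := exists_linearIndependent_of_le_finrank hV
    refine ⟨v 0, v 1, ?_, a, 0, 0, a, by simp [ha], by simp [ha]⟩
    convert hv using 1
    ext i
    fin_cases i <;> rfl
  · have hint : IsIntegral ℝ f := Algebra.IsIntegral.isIntegral f
    have hmonic := minpoly.monic hint
    have hdeg : 2 ≤ (minpoly ℝ f).natDegree := by
      by_contra hlt
      have h1 : (minpoly ℝ f).natDegree = 1 := by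
        have h0 : (minpoly ℝ f).natDegree ≠ 0 := by
          intro h0
          have h1 := hmonic.natDegree_eq_zero.mp h0
          have h2 := minpoly.aeval ℝ f
          rw [h1, map_one] at h2
          have : Nontrivial V := Module.nontrivial_of_finrank_pos (R := ℝ) (by omega)
          exact one_ne_zero h2
        omega
      apply hall
      intro v hv
      have h2 := minpoly.aeval ℝ f
      rw [hmonic.eq_X_add_C h1] at h2
      have h3 : f v + (minpoly ℝ f).coeff 0 • v = 0 := by
        have := congrArg (fun g : Module.End ℝ V => g v) h2
        simpa using this
      have := LinearIndependent.pair_iff.mp hv ((minpoly ℝ f).coeff 0) 1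
        (by rw [one_smul, add_comm]; exact h3)
      exact one_ne_zero this.2
    obtain ⟨q, hq, hq2, h, hqh⟩ := exists_monic_natDegree_two_dvd hmonic hdeg
    have hh : h.Monic := hq.of_mul_monic_left (hqh ▸ hmonic)
    have hex : ∃ x, LinearIndependent ℝ ![aeval f h x, f (aeval f h x)] := by
      by_contra hno
      have hno' : ∀ x, ¬ LinearIndependent ℝ ![aeval f h x, f (aeval f h x)] := fun x hx =>
        hno ⟨x, hx⟩
      have hmaps : ∀ y ∈ LinearMap.range (aeval f h), f y ∈ LinearMap.range (aeval f h) := by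
        rintro _ ⟨x, rfl⟩
        refine ⟨f x, ?_⟩
        have : aeval f (h * X) = aeval f (X * h) := by rw [mul_comm]
        rw [map_mul, map_mul, aeval_X] at this
        exact congrArg (fun g : Module.End ℝ V => g x) this
      obtain ⟨a, ha⟩ := LinearMap.exists_eq_smul_id_of_forall_notLinearIndependent
        (f := f.restrict hmaps) (by
          rintro ⟨_, x, rfl⟩ hx
          refine hno' x ?_
          rw [LinearIndependent.pair_iff] at hx ⊢
          exact fun s t hst => hx s t (Subtype.ext hst))
      have h0 : aeval f ((X - C a) * h) = 0 := by
        rw [map_mul, map_sub, aeval_X, aeval_C]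
        ext x
        have := congrArg Subtype.val
          (congrArg (fun g : Module.End ℝ (LinearMap.range (aeval f h)) => g ⟨_, x, rfl⟩) ha)
        have h2 : f (aeval f h x) = a • aeval f h x := this
        simp [h2]
      have hd := natDegree_le_of_dvd (minpoly.dvd ℝ f h0)
        ((monic_X_sub_C a).mul hh).ne_zero
      rw [(monic_X_sub_C a).natDegree_mul hh, natDegree_X_sub_C, hqh, hq.natDegree_mul hh] at hd
      omega
    obtain ⟨x, hx⟩ := hex
    refine ⟨_, _, hx, 0, 1, -q.coeff 0, -q.coeff 1, by simp, ?_⟩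
    have h0 := minpoly.aeval ℝ f
    rw [hqh, map_mul] at h0
    have h1 : aeval f q (aeval f h x) = 0 := congrArg (fun g : Module.End ℝ V => g x) h0
    rw [hq.as_sum, hq2] at h1
    simp only [Finset.sum_range_succ, Finset.sum_range_zero, map_add, map_mul, aeval_C, aeval_X,
      map_pow, LinearMap.add_apply] at h1
    simp [pow_succ, Module.algebraMap_end_apply] at h1
    rw [neg_smul, neg_smul, ← sub_eq_zero, ← h1]
    abel

end InvariantPair

/-- Every real matrix of size at least two has a left invariant subspace of dimension two, the row
space of some `W` with a right inverse. -/
lemma exists_left_invariant {N : ℕ} (hN : 2 ≤ N) (A : Matrix (Fin N) (Fin N) ℝ) :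
    ∃ (W : Matrix (Fin (2 * 1)) (Fin N) ℝ) (E : Matrix (Fin (2 * 1)) (Fin (2 * 1)) ℝ)
      (R : Matrix (Fin N) (Fin (2 * 1)) ℝ), W * A = E * W ∧ W * R = 1 := by
  obtain ⟨u, w, hli, a, b, c, d, hu, hw⟩ := exists_invariant_pair
    (V := Fin N → ℝ) (by simpa using hN) A.vecMulLinear
  let W : Matrix (Fin (2 * 1)) (Fin N) ℝ := ![u, w]
  let E : Matrix (Fin (2 * 1)) (Fin (2 * 1)) ℝ := ![![a, b], ![c, d]]
  have hsurj : Function.Surjective W.mulVec := by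
    have h1 : W.rank = Fintype.card (Fin (2 * 1)) := LinearIndependent.rank_matrix hli
    have h2 : LinearMap.range W.mulVecLin = ⊤ := by
      apply Submodule.eq_top_of_finrank_eq
      rw [Module.finrank_fintype_fun_eq_card]
      exact h1
    exact LinearMap.range_eq_top.mp h2
  obtain ⟨R, hR⟩ := Matrix.mulVec_surjective_iff_exists_right_inverse.mp hsurj
  refine ⟨W, E, R, ?_, hR⟩
  ext i j
  have hu' := congrFun hu j
  have hw' := congrFun hw j
  simp only [Matrix.vecMulLinear_apply, Matrix.vecMul, dotProduct, Pi.add_apply, Pi.smul_apply,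
    smul_eq_mul] at hu' hw'
  fin_cases i
  · exact hu'.trans (Fin.sum_univ_two fun k : Fin 2 => E 0 k * W k j).symm
  · exact hw'.trans (Fin.sum_univ_two fun k : Fin 2 => E 1 k * W k j).symm

/-! ### Perturbing an invariant subspace into a nondegenerate one -/

/-- The pairs `(A, B)` that occur in physically realizable systems, for the commutation matrix `Ω`
in place of `𝕁`. -/
def realizablePairs {n : ℕ} (m : ℕ) (Ω : Matrix (Fin (2 * n)) (Fin (2 * n)) ℝ) :
    Set (Matrix (Fin (2 * n)) (Fin (2 * n)) ℝ × Matrix (Fin (2 * n)) (Fin (2 * m)) ℝ) :=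
  {p | p.1 * Ω + Ω * p.1ᵀ + p.2 * JMat m * p.2ᵀ = 0}

lemma mem_realizablePairs {n m : ℕ} {Ω A : Matrix (Fin (2 * n)) (Fin (2 * n)) ℝ}
    {B : Matrix (Fin (2 * n)) (Fin (2 * m)) ℝ} :
    (A, B) ∈ realizablePairs m Ω ↔ A * Ω + Ω * Aᵀ + B * JMat m * Bᵀ = 0 := Iff.rfl

/-- A matrix `M` with prescribed skew part `K / 2` and prescribed rows `W M = G`, where `R` is a
right inverse of `W`: the skew part is corrected by a symmetric matrix with rows `G - W K / 2`. -/
noncomputable def skewLift {ι κ : Type*} [Fintype ι] [Fintype κ] (K : Matrix ι ι ℝ)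
    (W : Matrix κ ι ℝ) (R : Matrix ι κ ℝ) (G : Matrix κ ι ℝ) : Matrix ι ι ℝ :=
  let H := G - (1 / 2 : ℝ) • (W * K)
  (1 / 2 : ℝ) • K + R * H + Hᵀ * Rᵀ - R * (H * Wᵀ) * Rᵀ

lemma skewLift_spec {ι κ : Type*} [Fintype ι] [Fintype κ] [DecidableEq κ] {K : Matrix ι ι ℝ}
    {W : Matrix κ ι ℝ} {R : Matrix ι κ ℝ} {G : Matrix κ ι ℝ} (hK : Kᵀ = -K) (hR : W * R = 1)
    (hG : G * Wᵀ - W * Gᵀ = W * K * Wᵀ) :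
    skewLift K W R G - (skewLift K W R G)ᵀ = K ∧ W * skewLift K W R G = G := by
  set H := G - (1 / 2 : ℝ) • (W * K) with hH
  have hdef : skewLift K W R G = (1 / 2 : ℝ) • K + R * H + Hᵀ * Rᵀ - R * (H * Wᵀ) * Rᵀ := rfl
  have hsymm : W * Hᵀ = H * Wᵀ := by
    have h1 : G * Wᵀ = W * Gᵀ + W * K * Wᵀ := by rw [← hG]; abel
    rw [hH]
    simp only [Matrix.transpose_sub, Matrix.transpose_smul, Matrix.transpose_mul, hK,
      Matrix.mul_sub, Matrix.sub_mul, Matrix.mul_smul, Matrix.smul_mul, h1, Matrix.neg_mul,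
      Matrix.mul_neg, Matrix.mul_assoc]
    module
  constructor
  · rw [hdef]
    simp only [Matrix.transpose_sub, Matrix.transpose_add, Matrix.transpose_smul,
      Matrix.transpose_mul, Matrix.transpose_transpose, hK, hsymm, Matrix.mul_assoc]
    module
  · rw [hdef, Matrix.mul_sub, Matrix.mul_add, Matrix.mul_add, ← Matrix.mul_assoc W R, hR,
      ← Matrix.mul_assoc W Hᵀ, hsymm, ← Matrix.mul_assoc W, ← Matrix.mul_assoc W R, hR,
      Matrix.one_mul, Matrix.one_mul, Matrix.mul_smul, hH]
    abel

lemma continuous_skewLift {X ι κ : Type*} [TopologicalSpace X] [Fintype ι] [Fintype κ]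
    {K : X → Matrix ι ι ℝ} {W : X → Matrix κ ι ℝ} {R : Matrix ι κ ℝ} {G : X → Matrix κ ι ℝ}
    (hK : Continuous K) (hW : Continuous W) (hG : Continuous G) :
    Continuous fun x => skewLift (K x) (W x) R (G x) := by
  unfold skewLift
  fun_prop

/-- With at least one field there is a path of pairs of rows along which the symplectic area is
`-t κ τ` for a parameter `t` that starts at zero and is nonzero soon after. If `τ = 0`, the rows
need not move; otherwise the area of a line through `β` is a quadratic polynomial, which
defines `t`. -/
lemma exists_area_path {m : ℕ} (hm : 1 ≤ m) (β : Matrix (Fin (2 * 1)) (Fin (2 * m)) ℝ)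
    (hβ : (β * JMat m * βᵀ) 0 1 = 0) {κ : ℝ} (hκ : κ ≠ 0) (τ : ℝ) :
    ∃ (t : ℝ → ℝ) (γ : ℝ → Matrix (Fin (2 * 1)) (Fin (2 * m)) ℝ), Continuous t ∧ Continuous γ ∧
      t 0 = 0 ∧ γ 0 = β ∧ (∀ s, (γ s * JMat m * (γ s)ᵀ) 0 1 = -(t s * κ * τ)) ∧
      ∃ a, ∀ s, s ≠ 0 → s ≠ a → t s ≠ 0 := by
  by_cases hτ : τ = 0
  · exact ⟨id, fun _ => β, continuous_id, continuous_const, rfl, rfl,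
      fun s => by rw [hβ, hτ]; simp, 0, fun s hs _ => hs⟩
  · let i₀ : Fin (2 * m) := ⟨0, by omega⟩
    let i₁ : Fin (2 * m) := ⟨1, by omega⟩
    let η : Matrix (Fin (2 * 1)) (Fin (2 * m)) ℝ := ![Pi.single i₀ 1, Pi.single i₁ 1]
    have hη : (η * JMat m * ηᵀ) 0 1 = 1 := by
      have h1 : (η * JMat m * ηᵀ) 0 1 = JMat m i₀ i₁ := by
        rw [Matrix.mul_apply]
        simp only [Matrix.mul_apply, Matrix.transpose_apply]
        change ∑ j, (∑ k, (Pi.single i₀ 1 : Fin (2 * m) → ℝ) k * JMat m k j) *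
          (Pi.single i₁ 1 : Fin (2 * m) → ℝ) j = _
        simp [Pi.single_apply]
      rw [h1]
      simp [JMat, i₀, i₁]
    set b := (β * JMat m * ηᵀ) 0 1 + (η * JMat m * βᵀ) 0 1 with hb
    have harea : ∀ s : ℝ, ((β + s • η) * JMat m * (β + s • η)ᵀ) 0 1 = s * b + s ^ 2 := by
      intro s
      have : (β + s • η) * JMat m * (β + s • η)ᵀ = β * JMat m * βᵀ +
          s • (β * JMat m * ηᵀ + η * JMat m * βᵀ) + s ^ 2 • (η * JMat m * ηᵀ) := by
        simp only [Matrix.transpose_add, Matrix.transpose_smul, Matrix.add_mul, Matrix.mul_add,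
          Matrix.smul_mul, Matrix.mul_smul]
        module
      rw [this]
      simp only [Matrix.add_apply, Matrix.smul_apply, smul_eq_mul, hβ, hη, hb]
      ring
    refine ⟨fun s => -(s * b + s ^ 2) / (κ * τ), fun s => β + s • η, by fun_prop, by fun_prop,
      by simp, by simp, fun s => ?_, -b, fun s hs hsb => ?_⟩
    · rw [harea]
      field_simp
    · refine div_ne_zero (neg_ne_zero.mpr ?_) (mul_ne_zero hκ hτ)
      have : s * b + s ^ 2 = s * (s - -b) := by ring
      rw [this]
      exact mul_ne_zero hs (sub_ne_zero.mpr hsb)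

lemma ext_two {X Y : Matrix (Fin (2 * 1)) (Fin (2 * 1)) ℝ} (h00 : X 0 0 = Y 0 0)
    (h01 : X 0 1 = Y 0 1) (h10 : X 1 0 = Y 1 0) (h11 : X 1 1 = Y 1 1) : X = Y := by
  ext i j
  fin_cases i <;> fin_cases j
  exacts [h00, h01, h10, h11]

lemma mul_apply_two {κ κ' : Type*} (X : Matrix κ (Fin (2 * 1)) ℝ) (Y : Matrix (Fin (2 * 1)) κ' ℝ)
    (i : κ) (j : κ') : (X * Y) i j = X i 0 * Y 0 j + X i 1 * Y 1 j :=
  Fin.sum_univ_two fun k : Fin 2 => X i k * Y k j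

lemma mul_JMat_one_add (E : Matrix (Fin (2 * 1)) (Fin (2 * 1)) ℝ) :
    E * JMat 1 + JMat 1 * Eᵀ = E.trace • JMat 1 := by
  have htr : E.trace = E 0 0 + E 1 1 := Matrix.trace_fin_two (A := (E : Matrix (Fin 2) (Fin 2) ℝ))
  have h00 : JMat 1 0 0 = 0 := by simp [JMat]
  have h01 : JMat 1 0 1 = 1 := by simp [JMat]
  have h10 : JMat 1 1 0 = -1 := by simp [JMat]
  have h11 : JMat 1 1 1 = 0 := by simp [JMat]
  refine ext_two ?_ ?_ ?_ ?_ <;>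
    simp only [Matrix.add_apply, Matrix.smul_apply, mul_apply_two, Matrix.transpose_apply, h00,
      h01, h10, h11, htr, smul_eq_mul] <;> ring

/-- Every realizable pair is a limit of realizable pairs `(A, B)` such that `A` has a left invariant
plane on which `Ω` is nondegenerate. If `Ω` vanishes on an invariant plane `W` of `A`, one row of
`W` is moved by `t`; for the moved plane to be invariant for a realizable pair, the area of `W B`
must become `-t κ tr E`, and then a small correction of `A` suffices. -/
theorem mem_closure_nondegenerate {n m : ℕ} (hn : 1 ≤ n) (hm : 1 ≤ m)
    {Ω : Matrix (Fin (2 * n)) (Fin (2 * n)) ℝ} (hΩ : IsUnit Ω) (hskew : Ωᵀ = -Ω)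
    {p : Matrix (Fin (2 * n)) (Fin (2 * n)) ℝ × Matrix (Fin (2 * n)) (Fin (2 * m)) ℝ}
    (hp : p ∈ realizablePairs m Ω) :
    p ∈ closure {p | p ∈ realizablePairs m Ω ∧
      ∃ (W : Matrix (Fin (2 * 1)) (Fin (2 * n)) ℝ) (E : Matrix (Fin (2 * 1)) (Fin (2 * 1)) ℝ),
        W * p.1 = E * W ∧ (W * Ω * Wᵀ) 0 1 ≠ 0} := by
  obtain ⟨A, B⟩ := p
  rw [mem_realizablePairs] at hp
  obtain ⟨W, E, R, hW, hR⟩ := exists_left_invariant (by omega) A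
  by_cases hc : (W * Ω * Wᵀ) 0 1 = 0
  swap
  · exact subset_closure ⟨hp, W, E, hW, hc⟩
  have hsk : ∀ X : Matrix (Fin (2 * 1)) (Fin (2 * n)) ℝ, (X * Ω * Xᵀ)ᵀ = -(X * Ω * Xᵀ) := by
    intro X; simp [Matrix.transpose_mul, hskew, Matrix.mul_assoc]
  have hsk' : ∀ X : Matrix (Fin (2 * 1)) (Fin (2 * m)) ℝ,
      (X * JMat m * Xᵀ)ᵀ = -(X * JMat m * Xᵀ) := by
    intro X; simp [Matrix.transpose_mul, JMat_transpose, Matrix.mul_assoc]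
  have hWW : W * Ω * Wᵀ = 0 := by rw [eq_smul_JMat_one (hsk W), hc, zero_smul]
  -- the direction `Z` in which the second row of `W` is moved; its first row vanishes
  let P : Matrix (Fin (2 * 1)) (Fin (2 * 1)) ℝ := (!![0, 0; 1, 0] : Matrix (Fin 2) (Fin 2) ℝ)
  let Q := W * Ω
  let Z := P * (Q - Q * R * W)
  have hP0 : ∀ {k : ℕ} (X : Matrix (Fin (2 * 1)) (Fin k) ℝ) (j), (P * X) 0 j = 0 := by
    intro k X j
    rw [mul_apply_two]
    simp [P]
  have hP1 : ∀ X : Matrix (Fin (2 * 1)) (Fin (2 * 1)) ℝ, (X * Pᵀ) 0 1 = X 0 0 := by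
    intro X
    rw [mul_apply_two]
    simp [P]
  have hZR : Z * R = 0 := by
    simp only [Z]
    rw [Matrix.mul_assoc, Matrix.sub_mul, Matrix.mul_assoc _ W R, hR, Matrix.mul_one, sub_self,
      Matrix.mul_zero]
  set κ := (Q * Qᵀ) 0 0 with hκdef
  have hκ : κ ≠ 0 := by
    intro h0
    have h1 : Q 0 = 0 := by
      have : Q 0 ⬝ᵥ Q 0 = 0 := h0
      exact dotProduct_self_eq_zero.mp this
    have h2 : W 0 = 0 := by
      have h3 : W 0 ᵥ* Ω = 0 := h1
      exact Matrix.vecMul_injective_of_isUnit hΩ (h3.trans (Matrix.zero_vecMul Ω).symm)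
    have h4 : (W * R) 0 0 = 0 := by
      rw [Matrix.mul_apply]
      exact Finset.sum_eq_zero fun k _ => by rw [h2]; simp
    rw [hR] at h4
    exact one_ne_zero h4
  have hWZ : (W * Ω * Zᵀ) 0 1 = κ := by
    have h1 : W * Ω * Zᵀ = (Q * Qᵀ - W * Ω * Wᵀ * (Q * R)ᵀ) * Pᵀ := by
      simp only [Z, Q, Matrix.transpose_mul, Matrix.transpose_sub, Matrix.mul_sub, Matrix.sub_mul,
        Matrix.mul_assoc]
    rw [h1, hWW, Matrix.zero_mul, sub_zero, hP1]
  have hform : ∀ t : ℝ, (W + t • Z) * Ω * (W + t • Z)ᵀ = (t * κ) • JMat 1 := by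
    intro t
    rw [eq_smul_JMat_one (hsk (W + t • Z))]
    congr 1
    have : (W + t • Z) * Ω * (W + t • Z)ᵀ = W * Ω * Wᵀ + t • (W * Ω * Zᵀ) +
        t • (Z * (Ω * Wᵀ)) + t ^ 2 • (Z * (Ω * Zᵀ)) := by
      simp only [Matrix.transpose_add, Matrix.transpose_smul, Matrix.add_mul, Matrix.mul_add,
        Matrix.smul_mul, Matrix.mul_smul, Matrix.mul_assoc]
      module
    rw [this]
    simp only [Matrix.add_apply, Matrix.smul_apply, smul_eq_mul, hWW, hWZ]
    simp only [Z, Matrix.mul_assoc P, hP0]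
    simp
  have hβ : ((W * B) * JMat m * (W * B)ᵀ) 0 1 = 0 := by
    have h1 : W * (A * Ω + Ω * Aᵀ + B * JMat m * Bᵀ) * Wᵀ = 0 := by simp [hp]
    have h2 : W * (A * Ω + Ω * Aᵀ + B * JMat m * Bᵀ) * Wᵀ = W * A * Ω * Wᵀ +
        W * Ω * (W * A)ᵀ + (W * B) * JMat m * (W * B)ᵀ := by
      simp only [Matrix.transpose_mul, Matrix.add_mul, Matrix.mul_add, Matrix.mul_assoc]
    rw [h2, hW, Matrix.transpose_mul, Matrix.mul_assoc E, Matrix.mul_assoc E, hWW,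
      ← Matrix.mul_assoc (W * Ω), hWW] at h1
    simpa using congrFun (congrFun h1 0) 1
  obtain ⟨t, γ, ht, hγ, ht0, hγ0, harea, a, hta⟩ := exists_area_path hm (W * B) hβ hκ E.trace
  let Ws : ℝ → Matrix (Fin (2 * 1)) (Fin (2 * n)) ℝ := fun s => W + t s • Z
  let Bs : ℝ → Matrix (Fin (2 * n)) (Fin (2 * m)) ℝ := fun s => B + R * (γ s - Ws s * B)
  let Ks : ℝ → Matrix (Fin (2 * n)) (Fin (2 * n)) ℝ := fun s =>
    B * JMat m * Bᵀ - Bs s * JMat m * (Bs s)ᵀ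
  let Gs : ℝ → Matrix (Fin (2 * 1)) (Fin (2 * n)) ℝ := fun s => (E * Ws s - Ws s * A) * Ω
  let Ms : ℝ → Matrix (Fin (2 * n)) (Fin (2 * n)) ℝ := fun s => skewLift (Ks s) (Ws s) R (Gs s)
  have hWsR : ∀ s, Ws s * R = 1 := by
    intro s
    simp only [Ws]
    rw [Matrix.add_mul, Matrix.smul_mul, hZR, smul_zero, add_zero, hR]
  have hWsB : ∀ s, Ws s * Bs s = γ s := by
    intro s
    simp only [Bs]
    rw [Matrix.mul_add, ← Matrix.mul_assoc, hWsR, Matrix.one_mul, add_sub_cancel]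
  have hM : ∀ s, Ms s - (Ms s)ᵀ = Ks s ∧ Ws s * Ms s = Gs s := by
    intro s
    refine skewLift_spec ?_ (hWsR s) ?_
    · simp [Ks, Matrix.transpose_mul, JMat_transpose, Matrix.mul_assoc, neg_add_eq_sub]
    · have h1 : Gs s * (Ws s)ᵀ - Ws s * (Gs s)ᵀ =
          E * (Ws s * Ω * (Ws s)ᵀ) + (Ws s * Ω * (Ws s)ᵀ) * Eᵀ -
            Ws s * (A * Ω + Ω * Aᵀ) * (Ws s)ᵀ := by
        simp only [Gs, Matrix.transpose_mul, Matrix.transpose_sub, hskew, Matrix.mul_sub,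
          Matrix.sub_mul, Matrix.mul_add, Matrix.add_mul, Matrix.mul_assoc, Matrix.neg_mul,
          Matrix.mul_neg]
        abel
      have h2 : Ws s * Ks s * (Ws s)ᵀ = Ws s * (B * JMat m * Bᵀ) * (Ws s)ᵀ -
          γ s * JMat m * (γ s)ᵀ := by
        rw [← hWsB s]
        simp only [Ks, Matrix.transpose_mul, Matrix.mul_sub, Matrix.sub_mul, Matrix.mul_assoc]
      have h3 : γ s * JMat m * (γ s)ᵀ = (-(t s * κ * E.trace)) • JMat 1 := by
        rw [eq_smul_JMat_one (hsk' (γ s)), harea]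
      rw [h1, h2, h3, hform, eq_neg_of_add_eq_zero_left hp, Matrix.mul_smul, Matrix.smul_mul,
        ← smul_add, mul_JMat_one_add, Matrix.mul_neg, Matrix.neg_mul]
      module
  have hΩ' := inv_mul_cancel_of_isUnit hΩ
  have hΩ'' := mul_inv_cancel_of_isUnit hΩ
  have hcont : Continuous fun s => (A + Ms s * Ω⁻¹, Bs s) := by
    have h1 : Continuous Ws := by fun_prop
    have h2 : Continuous Bs := by fun_prop
    have h3 : Continuous Ms := continuous_skewLift (by fun_prop) h1 (by fun_prop)
    fun_prop
  have h0 : (A + Ms 0 * Ω⁻¹, Bs 0) = (A, B) := by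
    have e1 : Ws 0 = W := by simp [Ws, ht0]
    have e2 : Bs 0 = B := by simp [Bs, e1, hγ0]
    have e3 : Gs 0 = 0 := by simp [Gs, e1, hW]
    have e4 : Ks 0 = 0 := by simp [Ks, e2]
    have e5 : Ms 0 = 0 := by simp [Ms, e3, e4, skewLift]
    rw [e5, e2, Matrix.zero_mul, add_zero]
  have hd : (0 : ℝ) ∈ closure ({0, a}ᶜ : Set ℝ) :=
    (Set.toFinite ({0, a} : Set ℝ)).countable.dense_compl ℝ 0
  rw [← h0]
  refine map_mem_closure (f := fun s => (A + Ms s * Ω⁻¹, Bs s)) hcont hd ?_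
  intro s hs
  rw [Set.mem_compl_iff, Set.mem_insert_iff, Set.mem_singleton_iff, not_or] at hs
  refine ⟨?_, Ws s, E, ?_, ?_⟩
  · have h1 : (A + Ms s * Ω⁻¹) * Ω = A * Ω + Ms s := by
      rw [Matrix.add_mul, Matrix.mul_assoc, hΩ', Matrix.mul_one]
    have h2 : Ω * (A + Ms s * Ω⁻¹)ᵀ = -((A + Ms s * Ω⁻¹) * Ω)ᵀ := by
      rw [Matrix.transpose_mul, hskew, Matrix.neg_mul, neg_neg]
    rw [mem_realizablePairs, h2, h1]
    have h3 : Ms s = Ks s + (Ms s)ᵀ := by rw [← (hM s).1]; abel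
    have h4 : (A * Ω)ᵀ = -(Ω * Aᵀ) := by rw [Matrix.transpose_mul, hskew, Matrix.neg_mul]
    rw [Matrix.transpose_add, h4]
    nth_rewrite 1 [h3]
    rw [← hp]
    simp only [Ks]
    abel
  · rw [Matrix.mul_add, ← Matrix.mul_assoc, (hM s).2]
    simp only [Gs]
    rw [Matrix.mul_assoc, hΩ'', Matrix.mul_one, add_sub_cancel]
  · simp only [Ws]
    rw [hform, Matrix.smul_apply, smul_eq_mul]
    refine mul_ne_zero (mul_ne_zero (hta s hs.1 hs.2) hκ) ?_
    simp [JMat]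

/-! ### Density of the matrices with a nondegenerate block diagonalization -/

/-- The first index of the `k`-th `2 × 2` block. -/
def lo {n : ℕ} (k : Fin n) : Fin (2 * n) := ⟨2 * k, by omega⟩

/-- The second index of the `k`-th `2 × 2` block. -/
def hi {n : ℕ} (k : Fin n) : Fin (2 * n) := ⟨2 * k + 1, by omega⟩

/-- The discriminant of the characteristic polynomial of the `k`-th diagonal block. -/
def blockDisc {n : ℕ} (D : Matrix (Fin (2 * n)) (Fin (2 * n)) ℝ) (k : Fin n) : ℝ :=
  (D (lo k) (lo k) - D (hi k) (hi k)) ^ 2 + 4 * D (lo k) (hi k) * D (hi k) (lo k)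

/-- `A` has a block diagonalization `A V = V D` in which all blocks have two distinct eigenvalues,
different blocks have different ones, and the leading minors of `Vᵀ Ω⁻¹ V` do not vanish. The
inverse matches the way `Ω` occurs in realizable pairs: under `A ↦ T A T⁻¹`, `V ↦ T V` and
`Ω ↦ T Ω Tᵀ`, the matrix `Vᵀ Ω⁻¹ V` is unchanged. -/
def IsSplit {n : ℕ} (Ω A : Matrix (Fin (2 * n)) (Fin (2 * n)) ℝ) : Prop :=
  ∃ V D : Matrix (Fin (2 * n)) (Fin (2 * n)) ℝ, A * V = V * D ∧ IsSeparated D ∧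
    (∀ k, blockDisc D k ≠ 0) ∧ HasLeadingMinors (Vᵀ * Ω⁻¹ * V)

lemma blockDisc_blk_castSucc {n : ℕ} (P : Matrix (Fin (2 * n)) (Fin (2 * n)) ℝ)
    (Q : Matrix (Fin (2 * n)) (Fin (2 * 1)) ℝ) (R : Matrix (Fin (2 * 1)) (Fin (2 * n)) ℝ)
    (S : Matrix (Fin (2 * 1)) (Fin (2 * 1)) ℝ) (k : Fin n) :
    blockDisc (n := n + 1) (blk P Q R S) k.castSucc = blockDisc P k := by
  have h1 : lo k.castSucc = LinSys.stateEquiv n 1 (Sum.inl (lo k)) :=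
    Fin.ext (by rw [stateEquiv_inl_val]; rfl)
  have h2 : hi k.castSucc = LinSys.stateEquiv n 1 (Sum.inl (hi k)) :=
    Fin.ext (by rw [stateEquiv_inl_val]; rfl)
  simp only [blockDisc, h1, h2, blk_apply₁₁]

lemma blockDisc_blk_last {n : ℕ} (P : Matrix (Fin (2 * n)) (Fin (2 * n)) ℝ)
    (Q : Matrix (Fin (2 * n)) (Fin (2 * 1)) ℝ) (R : Matrix (Fin (2 * 1)) (Fin (2 * n)) ℝ)
    (S : Matrix (Fin (2 * 1)) (Fin (2 * 1)) ℝ) :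
    blockDisc (n := n + 1) (blk P Q R S) (Fin.last n) =
      (S 0 0 - S 1 1) ^ 2 + 4 * S 0 1 * S 1 0 := by
  have h1 : lo (Fin.last n) = LinSys.stateEquiv n 1 (Sum.inr 0) :=
    Fin.ext (by rw [stateEquiv_inr_val]; rfl)
  have h2 : hi (Fin.last n) = LinSys.stateEquiv n 1 (Sum.inr 1) :=
    Fin.ext (by rw [stateEquiv_inr_val]; rfl)
  simp only [blockDisc, h1, h2, blk_apply₂₂]

lemma realizablePairs_conj {n m : ℕ} {Ω A T : Matrix (Fin (2 * n)) (Fin (2 * n)) ℝ}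
    {B : Matrix (Fin (2 * n)) (Fin (2 * m)) ℝ} (hT : IsUnit T)
    (h : (A, B) ∈ realizablePairs m Ω) :
    (T * A * T⁻¹, T * B) ∈ realizablePairs m (T * Ω * Tᵀ) := by
  rw [mem_realizablePairs] at h ⊢
  have h1 := inv_mul_cancel_of_isUnit hT
  have h2 : Tᵀ * (T⁻¹)ᵀ = 1 := by rw [← Matrix.transpose_mul, h1, Matrix.transpose_one]
  calc _ = T * A * (T⁻¹ * T) * Ω * Tᵀ + T * Ω * (Tᵀ * (T⁻¹)ᵀ) * Aᵀ * Tᵀ +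
        T * (B * JMat m * Bᵀ) * Tᵀ := by
        simp only [Matrix.transpose_mul, Matrix.mul_assoc]
    _ = T * (A * Ω + Ω * Aᵀ + B * JMat m * Bᵀ) * Tᵀ := by
        rw [h1, h2]
        simp only [Matrix.mul_one, Matrix.mul_add, Matrix.add_mul, Matrix.mul_assoc]
    _ = 0 := by rw [h, Matrix.mul_zero, Matrix.zero_mul]

lemma realizablePairs_blk_iff {n m : ℕ} {Ω A : Matrix (Fin (2 * n)) (Fin (2 * n)) ℝ}
    {B : Matrix (Fin (2 * n)) (Fin (2 * m)) ℝ} {Y : Matrix (Fin (2 * n)) (Fin (2 * 1)) ℝ}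
    {Ω₂ E : Matrix (Fin (2 * 1)) (Fin (2 * 1)) ℝ} {B₂ : Matrix (Fin (2 * 1)) (Fin (2 * m)) ℝ}
    (hΩ₂ : Ω₂ᵀ = -Ω₂) :
    (blk A Y 0 E, rws B B₂) ∈ realizablePairs (n := n + 1) m (blk Ω 0 0 Ω₂) ↔
      (A, B) ∈ realizablePairs m Ω ∧ Y * Ω₂ = -(B * JMat m * B₂ᵀ) ∧
        (E, B₂) ∈ realizablePairs m Ω₂ := by
  rw [mem_realizablePairs, mem_realizablePairs, mem_realizablePairs, blk_mul, blk_transpose,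
    blk_mul, rws_mul, rws_mul_transpose, blk_add, blk_add, ← blk_zero, blk_inj]
  simp only [Matrix.mul_zero, Matrix.zero_mul, add_zero, zero_add, Matrix.transpose_zero]
  constructor
  · rintro ⟨h1, h2, -, h4⟩
    exact ⟨h1, eq_neg_of_add_eq_zero_left h2, h4⟩
  · rintro ⟨h1, h2, h4⟩
    refine ⟨h1, by rw [h2, neg_add_cancel], ?_, h4⟩
    have h3 : (Y * Ω₂)ᵀ = Ω₂ᵀ * Yᵀ := Matrix.transpose_mul _ _
    rw [h2, hΩ₂, Matrix.neg_mul] at h3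
    rw [← neg_inj, neg_add, ← h3]
    simp [Matrix.transpose_mul, JMat_transpose, Matrix.mul_assoc]

/-- A plane on which `Ω` is nondegenerate has a complement that is orthogonal to it. -/
lemma exists_orthogonal_complement {n : ℕ} {Ω : Matrix (Fin (2 * (n + 1))) (Fin (2 * (n + 1))) ℝ}
    {W : Matrix (Fin (2 * 1)) (Fin (2 * (n + 1))) ℝ} (hW : IsUnit (W * Ω * Wᵀ)) :
    ∃ N : Matrix (Fin (2 * n)) (Fin (2 * (n + 1))) ℝ, N * Ω * Wᵀ = 0 ∧
      IsUnit (rws (p := n) (q := 1) N W) := by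
  let f := (Ω * Wᵀ).vecMulLinear
  have hdim : 2 * n ≤ Module.finrank ℝ (LinearMap.ker f) := by
    have h1 := f.finrank_range_add_finrank_ker
    have h2 : Module.finrank ℝ (LinearMap.range f) ≤ 2 * 1 := by
      simpa using Submodule.finrank_le (LinearMap.range f)
    rw [Module.finrank_fintype_fun_eq_card, Fintype.card_fin] at h1
    omega
  obtain ⟨v, hv⟩ := exists_linearIndependent_of_le_finrank hdim
  let N : Matrix (Fin (2 * n)) (Fin (2 * (n + 1))) ℝ := fun i => (v i : Fin (2 * (n + 1)) → ℝ)
  have hN : N * Ω * Wᵀ = 0 := by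
    rw [Matrix.mul_assoc]
    ext i j
    exact congrFun (LinearMap.mem_ker.mp (v i).2) j
  have hNli : LinearIndependent ℝ N.row := hv.map' (Submodule.subtype _) (Submodule.ker_subtype _)
  refine ⟨N, hN, ?_⟩
  rw [← Matrix.linearIndependent_rows_iff_isUnit, ← Matrix.vecMul_injective_iff]
  let e := LinSys.stateEquiv n 1
  intro x y hxy
  have key : ∀ z, z ᵥ* rws (p := n) (q := 1) N W =
      (fun i => z (e (Sum.inl i))) ᵥ* N + (fun i => z (e (Sum.inr i))) ᵥ* W := by
    intro z
    ext j
    simp only [Matrix.vecMul, dotProduct, Pi.add_apply]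
    rw [← e.sum_comp, Fintype.sum_sum_type]
    simp [rws, e]
  have hz : (x - y) ᵥ* rws (p := n) (q := 1) N W = 0 := by
    rw [Matrix.sub_vecMul]; exact sub_eq_zero.mpr hxy
  rw [key] at hz
  have h2 : (fun i => (x - y) (e (Sum.inr i))) = 0 := by
    have := congrArg (fun z => z ᵥ* (Ω * Wᵀ)) hz
    simp only [Matrix.add_vecMul, Matrix.vecMul_vecMul, Matrix.zero_vecMul,
      ← Matrix.mul_assoc, hN, Matrix.vecMul_zero, zero_add] at this
    exact Matrix.vecMul_injective_of_isUnit hW (this.trans (Matrix.zero_vecMul _).symm)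
  rw [h2, Matrix.zero_vecMul, add_zero] at hz
  have h1 : (fun i => (x - y) (e (Sum.inl i))) = 0 :=
    Matrix.vecMul_injective_iff.mpr hNli (hz.trans (Matrix.zero_vecMul _).symm)
  rw [← sub_eq_zero]
  ext i
  obtain ⟨i, rfl⟩ := e.surjective i
  cases i with
  | inl i => exact congrFun h1 i
  | inr i => exact congrFun h2 i

section Sylvester

variable {n : ℕ} {D : Matrix (Fin (2 * n)) (Fin (2 * n)) ℝ}
  {E : Matrix (Fin (2 * 1)) (Fin (2 * 1)) ℝ} {τ δ : ℝ}

/-- If the polynomial `x² - τ x + δ` annihilates `E` and is invertible at `D`, then `D` and `E` have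
no eigenvalue in common, and the Sylvester equation `D X = X E` has only the zero solution. -/
lemma sylvester_left (hE : E * E - τ • E + δ • 1 = 0) (hS : IsUnit (D * D - τ • D + δ • 1))
    {X : Matrix (Fin (2 * n)) (Fin (2 * 1)) ℝ} (h : D * X = X * E) : X = 0 := by
  have h1 : (D * D - τ • D + δ • 1) * X = X * (E * E - τ • E + δ • 1) := by
    simp only [Matrix.add_mul, Matrix.sub_mul, Matrix.mul_add, Matrix.mul_sub, Matrix.smul_mul,
      Matrix.mul_smul, Matrix.one_mul, Matrix.mul_one, Matrix.mul_assoc, h]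
    rw [← Matrix.mul_assoc D X E, h, Matrix.mul_assoc]
  rw [hE, Matrix.mul_zero] at h1
  have := congrArg (fun M => (D * D - τ • D + δ • 1)⁻¹ * M) h1
  simpa [← Matrix.mul_assoc, inv_mul_cancel_of_isUnit hS] using this

lemma sylvester_right (hE : E * E - τ • E + δ • 1 = 0) (hS : IsUnit (D * D - τ • D + δ • 1))
    {X : Matrix (Fin (2 * 1)) (Fin (2 * n)) ℝ} (h : X * D = E * X) : X = 0 := by
  have h1 : X * (D * D - τ • D + δ • 1) = (E * E - τ • E + δ • 1) * X := by
    simp only [Matrix.add_mul, Matrix.sub_mul, Matrix.mul_add, Matrix.mul_sub, Matrix.smul_mul,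
      Matrix.mul_smul, Matrix.one_mul, Matrix.mul_one, ← Matrix.mul_assoc, h]
    rw [Matrix.mul_assoc E X D, h, ← Matrix.mul_assoc]
  rw [hE, Matrix.zero_mul] at h1
  have := congrArg (fun M => M * (D * D - τ • D + δ • 1)⁻¹) h1
  simpa [Matrix.mul_assoc, mul_inv_cancel_of_isUnit hS] using this

lemma exists_sylvester (hE : E * E - τ • E + δ • 1 = 0) (hS : IsUnit (D * D - τ • D + δ • 1))
    (Y : Matrix (Fin (2 * n)) (Fin (2 * 1)) ℝ) :
    ∃ X : Matrix (Fin (2 * n)) (Fin (2 * 1)) ℝ, D * X - X * E = Y := by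
  let f : Matrix (Fin (2 * n)) (Fin (2 * 1)) ℝ →ₗ[ℝ] Matrix (Fin (2 * n)) (Fin (2 * 1)) ℝ :=
    { toFun := fun X => D * X - X * E
      map_add' := fun X X' => by rw [Matrix.mul_add, Matrix.add_mul]; abel
      map_smul' := fun c X => by
        rw [Matrix.mul_smul, Matrix.smul_mul, RingHom.id_apply, smul_sub] }
  have hf : Function.Injective f := by
    rw [injective_iff_map_eq_zero]
    exact fun X hX => sylvester_left hE hS (sub_eq_zero.mp hX)
  exact LinearMap.surjective_of_injective hf Y

lemma IsSeparated.blk_diag (hD : IsSeparated D) (hE : E * E - τ • E + δ • 1 = 0)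
    (hS : IsUnit (D * D - τ • D + δ • 1)) :
    IsSeparated (n := n + 1) (blk D 0 0 E) := by
  refine ⟨isBlockDiag_blk hD.1 E, fun N hN => ?_⟩
  obtain ⟨P, Q, R, S, rfl⟩ := exists_blk (p := n) (q := 1) N
  rw [blk_mul, blk_mul, blk_inj] at hN
  simp only [Matrix.mul_zero, Matrix.zero_mul, add_zero, zero_add] at hN
  obtain ⟨h1, h2, h3, -⟩ := hN
  rw [sylvester_left hE hS h2.symm, sylvester_right hE hS h3]
  exact isBlockDiag_blk (hD.2 P h1) S

end Sylvester

lemma cayley_hamilton_two (E : Matrix (Fin (2 * 1)) (Fin (2 * 1)) ℝ) :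
    E * E - (E 0 0 + E 1 1) • E + (E 0 0 * E 1 1 - E 0 1 * E 1 0) • 1 = 0 := by
  have h01 : (1 : Matrix (Fin (2 * 1)) (Fin (2 * 1)) ℝ) 0 1 = 0 := rfl
  have h10 : (1 : Matrix (Fin (2 * 1)) (Fin (2 * 1)) ℝ) 1 0 = 0 := rfl
  refine ext_two ?_ ?_ ?_ ?_ <;>
    simp only [Matrix.add_apply, Matrix.sub_apply, Matrix.smul_apply, mul_apply_two, h01, h10,
      Matrix.one_apply_eq, smul_eq_mul, Matrix.zero_apply] <;> ring

/-- Adding a multiple of `𝕁` to a `2 × 2` block keeps its trace and moves its determinant; for all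
but finitely many multiples the block has two distinct eigenvalues and shares none with `D`. -/
lemma finite_bad_shift {n : ℕ} (D : Matrix (Fin (2 * n)) (Fin (2 * n)) ℝ) (τ b d : ℝ) :
    {t : ℝ | ¬ (IsUnit (D * D - τ • D + (t ^ 2 + b * t + d) • 1) ∧
      τ ^ 2 - 4 * (t ^ 2 + b * t + d) ≠ 0)}.Finite := by
  let q : Polynomial ℝ := Polynomial.X ^ 2 + (Polynomial.C b * Polynomial.X + Polynomial.C d)
  have hqdeg : (Polynomial.C b * Polynomial.X + Polynomial.C d).degree < ((2 : ℕ) : WithBot ℕ) :=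
    lt_of_le_of_lt Polynomial.degree_linear_le (by norm_num)
  have hq : q.Monic := Polynomial.monic_X_pow_add hqdeg
  have hq0 : q.natDegree ≠ 0 := by
    have : q.natDegree = 2 := by
      refine Polynomial.natDegree_eq_of_degree_eq_some ?_
      rw [Polynomial.degree_add_eq_left_of_degree_lt (by rwa [Polynomial.degree_X_pow]),
        Polynomial.degree_X_pow]
    omega
  let P := ((τ • D - D * D).charpoly * (Polynomial.X - Polynomial.C (τ ^ 2 / 4))).comp q
  have hP : P ≠ 0 :=
    (((Matrix.charpoly_monic _).mul (Polynomial.monic_X_sub_C _)).comp hq hq0).ne_zero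
  refine (P.rootSet_finite ℝ).subset fun t ht => ?_
  rw [Polynomial.mem_rootSet_of_ne hP]
  have hqt : q.eval t = t ^ 2 + b * t + d := by simp [q, add_assoc]
  have hchar : (τ • D - D * D).charpoly.eval (t ^ 2 + b * t + d) =
      (D * D - τ • D + (t ^ 2 + b * t + d) • 1).det := by
    rw [Matrix.eval_charpoly, Matrix.scalar_apply, ← Matrix.smul_one_eq_diagonal]
    congr 1
    abel
  rw [Polynomial.coe_aeval_eq_eval, Polynomial.eval_comp, hqt, Polynomial.eval_mul, hchar,
    Polynomial.eval_sub, Polynomial.eval_X, Polynomial.eval_C, mul_eq_zero]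
  by_contra hcon
  rw [not_or] at hcon
  refine ht ⟨isUnit_of_det_ne_zero hcon.1, fun h => hcon.2 ?_⟩
  linarith

lemma inv_blk {n : ℕ} {Ω : Matrix (Fin (2 * n)) (Fin (2 * n)) ℝ}
    {Ω₂ : Matrix (Fin (2 * 1)) (Fin (2 * 1)) ℝ} (h : IsUnit Ω) (h₂ : IsUnit Ω₂) :
    (blk Ω 0 0 Ω₂)⁻¹ = blk Ω⁻¹ 0 0 Ω₂⁻¹ := by
  refine Matrix.inv_eq_right_inv ?_
  rw [blk_mul, mul_inv_cancel_of_isUnit h, mul_inv_cancel_of_isUnit h₂]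
  simp [blk_one]

/-- For all but finitely many `t`, a block triangular matrix with a split first block and last block
`E + t 𝕁` is split, whatever the block above the diagonal is: a Sylvester equation removes it. -/
lemma IsSplit.blk_shift {n : ℕ} {Ω A : Matrix (Fin (2 * n)) (Fin (2 * n)) ℝ} (hA : IsSplit Ω A)
    (hΩ : IsUnit Ω) {Ω₂ E : Matrix (Fin (2 * 1)) (Fin (2 * 1)) ℝ} (hΩ₂ : IsUnit Ω₂) :
    {t : ℝ | ¬ ∀ Y, IsSplit (n := n + 1) (blk Ω 0 0 Ω₂) (blk A Y 0 (E + t • JMat 1))}.Finite := by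
  obtain ⟨V, D, hAV, hD, hdisc, hV⟩ := hA
  refine (finite_bad_shift D (E 0 0 + E 1 1) (E 0 1 - E 1 0)
    (E 0 0 * E 1 1 - E 0 1 * E 1 0)).subset fun t ht hgood => ht fun Y => ?_
  obtain ⟨hS, hdisc₂⟩ := hgood
  set F := E + t • JMat 1 with hF
  have hF00 : F 0 0 = E 0 0 := by simp [hF, JMat]
  have hF01 : F 0 1 = E 0 1 + t := by simp [hF, JMat]
  have hF10 : F 1 0 = E 1 0 - t := by simp [hF, JMat, sub_eq_add_neg]
  have hF11 : F 1 1 = E 1 1 := by simp [hF, JMat]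
  have hdet : F 0 0 * F 1 1 - F 0 1 * F 1 0 =
      t ^ 2 + (E 0 1 - E 1 0) * t + (E 0 0 * E 1 1 - E 0 1 * E 1 0) := by
    rw [hF00, hF01, hF10, hF11]; ring
  have hCH := cayley_hamilton_two F
  rw [hdet, hF00, hF11] at hCH
  have hVu := isUnit_of_hasLeadingMinors hV
  obtain ⟨X, hX⟩ := exists_sylvester hCH hS (-(V⁻¹ * Y))
  have hVX : A * (V * X) + Y = V * X * F := by
    have h1 : V * (D * X - X * F) = -Y := by
      rw [hX, Matrix.mul_neg, ← Matrix.mul_assoc, mul_inv_cancel_of_isUnit hVu, Matrix.one_mul]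
    rw [← Matrix.mul_assoc, hAV, Matrix.mul_assoc, Matrix.mul_assoc]
    rw [Matrix.mul_sub] at h1
    rw [← sub_eq_zero, ← sub_eq_zero.mpr h1]
    abel
  refine ⟨blk V (V * X) 0 1, blk D 0 0 F, ?_, hD.blk_diag hCH hS, fun k => ?_, ?_⟩
  · rw [blk_mul, blk_mul, blk_inj]
    simp [hAV, hVX]
  · refine Fin.lastCases ?_ (fun k => ?_) k
    · rw [blockDisc_blk_last, hF00, hF01, hF10, hF11]
      intro h0
      exact hdisc₂ (by rw [← h0]; ring)
    · rw [blockDisc_blk_castSucc]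
      exact hdisc k
  · have hdetV : (blk V (V * X) 0 1).det ≠ 0 := by
      rw [det_blk_zero₂₁, Matrix.det_one, mul_one]
      exact ((Matrix.isUnit_iff_isUnit_det V).mp hVu).ne_zero
    have hdetΩ : ((blk Ω 0 0 Ω₂)⁻¹).det ≠ 0 := by
      rw [inv_blk hΩ hΩ₂, det_blk_zero₂₁]
      exact mul_ne_zero
        ((Matrix.isUnit_iff_isUnit_det _).mp ((Matrix.isUnit_nonsing_inv_iff).mpr hΩ)).ne_zero
        ((Matrix.isUnit_iff_isUnit_det _).mp ((Matrix.isUnit_nonsing_inv_iff).mpr hΩ₂)).ne_zero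
    have hdet : ((blk V (V * X) 0 1)ᵀ * (blk Ω 0 0 Ω₂)⁻¹ * blk V (V * X) 0 1).det ≠ 0 := by
      rw [Matrix.det_mul, Matrix.det_mul, Matrix.det_transpose]
      exact mul_ne_zero (mul_ne_zero hdetV hdetΩ) hdetV
    rw [inv_blk hΩ hΩ₂, blk_transpose, blk_mul, blk_mul] at hdet ⊢
    refine hasLeadingMinors_blk_iff.mpr ⟨?_, hdet⟩
    simpa using hV

lemma IsSplit.conj {n : ℕ} {Ω A T : Matrix (Fin (2 * n)) (Fin (2 * n)) ℝ} (hT : IsUnit T)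
    (hA : IsSplit (T * Ω * Tᵀ) A) : IsSplit Ω (T⁻¹ * A * T) := by
  obtain ⟨V, D, hAV, hD, hdisc, hV⟩ := hA
  refine ⟨T⁻¹ * V, D, ?_, hD, hdisc, ?_⟩
  · calc T⁻¹ * A * T * (T⁻¹ * V) = T⁻¹ * (A * (T * T⁻¹) * V) := by
          simp only [Matrix.mul_assoc]
      _ = T⁻¹ * V * D := by
          rw [mul_inv_cancel_of_isUnit hT, Matrix.mul_one, hAV, Matrix.mul_assoc]
  · have h : (T⁻¹ * V)ᵀ * Ω⁻¹ * (T⁻¹ * V) = Vᵀ * (T * Ω * Tᵀ)⁻¹ * V := by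
      rw [Matrix.mul_inv_rev, Matrix.mul_inv_rev, Matrix.transpose_mul,
        Matrix.transpose_nonsing_inv]
      simp only [Matrix.mul_assoc]
    rwa [h]

/-- Among the realizable pairs `(A, B)`, those with `A` split are dense. The induction on the number
of degrees of freedom splits off an invariant plane and perturbs the two diagonal blocks; the
coupling block follows from the realizability condition. -/
theorem mem_closure_isSplit {m : ℕ} (hm : 1 ≤ m) (n : ℕ)
    {Ω : Matrix (Fin (2 * n)) (Fin (2 * n)) ℝ} (hΩ : IsUnit Ω) (hskew : Ωᵀ = -Ω)
    {p : Matrix (Fin (2 * n)) (Fin (2 * n)) ℝ × Matrix (Fin (2 * n)) (Fin (2 * m)) ℝ}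
    (hp : p ∈ realizablePairs m Ω) :
    p ∈ closure {p | p ∈ realizablePairs m Ω ∧ IsSplit Ω p.1} := by
  induction n with
  | zero =>
    refine subset_closure ⟨hp, 1, 0, ?_, ⟨fun i => i.elim0, fun N _ i => i.elim0⟩,
      fun k => k.elim0, hasLeadingMinors_zero _⟩
    ext i
    exact i.elim0
  | succ n ih =>
    refine closure_minimal ?_ isClosed_closure
      (mem_closure_nondegenerate (Nat.succ_pos n) hm hΩ hskew hp)
    rintro ⟨A, B⟩ ⟨hp, W, E, hWA, hc⟩
    dsimp only at hWA
    have hΩ₂skew : (W * Ω * Wᵀ)ᵀ = -(W * Ω * Wᵀ) := by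
      simp [Matrix.transpose_mul, hskew, Matrix.mul_assoc]
    have hΩ₂ : W * Ω * Wᵀ = ((W * Ω * Wᵀ) 0 1) • JMat 1 := eq_smul_JMat_one hΩ₂skew
    set c := (W * Ω * Wᵀ) 0 1
    have hΩ₂u : IsUnit (W * Ω * Wᵀ) := by
      refine isUnit_of_det_ne_zero ?_
      rw [hΩ₂, Matrix.det_smul]
      exact mul_ne_zero (pow_ne_zero _ hc)
        ((Matrix.isUnit_iff_isUnit_det _).mp (isUnit_JMat 1)).ne_zero
    obtain ⟨N, hN, hT⟩ := exists_orthogonal_complement hΩ₂u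
    set T := rws (p := n) (q := 1) N W with hTdef
    set Ω₂ := W * Ω * Wᵀ with hΩ₂def
    have hN' : W * Ω * Nᵀ = 0 := by
      have : (N * Ω * Wᵀ)ᵀ = 0 := by rw [hN, Matrix.transpose_zero]
      simpa [Matrix.transpose_mul, hskew, Matrix.mul_assoc] using this
    set Ω₁ := N * Ω * Nᵀ with hΩ₁def
    have hTΩ : T * Ω * Tᵀ = blk Ω₁ 0 0 Ω₂ := by
      rw [hTdef, rws_mul, rws_mul_transpose, hN, hN']
    have hΩ₁skew : Ω₁ᵀ = -Ω₁ := by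
      simp [hΩ₁def, Matrix.transpose_mul, hskew, Matrix.mul_assoc]
    have hΩ₁u : IsUnit Ω₁ := by
      refine isUnit_of_det_ne_zero (left_ne_zero_of_mul (b := Ω₂.det) ?_)
      rw [← det_blk_zero₂₁ Ω₁ 0 Ω₂, ← hTΩ]
      have hTt : IsUnit Tᵀ := by rwa [Matrix.isUnit_transpose]
      exact ((Matrix.isUnit_iff_isUnit_det _).mp ((hT.mul hΩ).mul hTt)).ne_zero
    have hTi := inv_mul_cancel_of_isUnit hT
    have hTi' := mul_inv_cancel_of_isUnit hT
    obtain ⟨A₁, Y, Z, E', hA⟩ := exists_blk (p := n) (q := 1) (T * A * T⁻¹)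
    obtain ⟨B₁, B₂, hB⟩ := exists_rws (p := n) (q := 1) (T * B)
    have hZE : Z = 0 ∧ E' = E := by
      have h1 : T * A = blk A₁ Y Z E' * T := by
        rw [← hA, Matrix.mul_assoc _ T⁻¹ T, hTi, Matrix.mul_one]
      have h2 : blk 0 0 Z (E' - E) * T = 0 := by
        rw [hTdef, rws_mul, blk_mul_rws, rws_inj, hWA] at h1
        rw [hTdef, blk_mul_rws, Matrix.sub_mul, ← add_sub_assoc, ← h1.2, sub_self]
        ext i j
        obtain ⟨i, rfl⟩ := (LinSys.stateEquiv n 1).surjective i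
        cases i <;> simp [rws]
      have h3 : blk 0 0 Z (E' - E) = blk 0 0 0 0 := by
        rw [blk_zero, ← Matrix.mul_one (blk 0 0 Z (E' - E)), ← hTi', ← Matrix.mul_assoc, h2,
          Matrix.zero_mul]
      obtain ⟨-, -, h4, h5⟩ := blk_inj.mp h3
      exact ⟨h4, sub_eq_zero.mp h5⟩
    obtain ⟨rfl, rfl⟩ := hZE
    have hpair := realizablePairs_conj hT hp
    rw [hTΩ, hA, hB, realizablePairs_blk_iff hΩ₂skew] at hpair
    obtain ⟨hp₁, hY, hp₂⟩ := hpair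
    -- the coupling block is a function of the rest
    let y : Matrix (Fin (2 * n)) (Fin (2 * m)) ℝ → Matrix (Fin (2 * n)) (Fin (2 * 1)) ℝ :=
      fun B₁ => -(B₁ * JMat m * B₂ᵀ) * Ω₂⁻¹
    have hyΩ : ∀ B₁, y B₁ * Ω₂ = -(B₁ * JMat m * B₂ᵀ) := by
      intro B₁
      simp only [y]
      rw [Matrix.mul_assoc, inv_mul_cancel_of_isUnit hΩ₂u, Matrix.mul_one]
    have hyY : y B₁ = Y := by
      simp only [y]
      rw [← hY, Matrix.mul_assoc, mul_inv_cancel_of_isUnit hΩ₂u, Matrix.mul_one]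
    let Φ : Matrix (Fin (2 * n)) (Fin (2 * n)) ℝ × Matrix (Fin (2 * n)) (Fin (2 * m)) ℝ → ℝ →
        Matrix (Fin (2 * (n + 1))) (Fin (2 * (n + 1))) ℝ ×
          Matrix (Fin (2 * (n + 1))) (Fin (2 * m)) ℝ := fun q t =>
      (T⁻¹ * blk q.1 (y q.2) 0 (E' + t • JMat 1) * T, T⁻¹ * rws q.2 B₂)
    have hΦ₀ : Φ (A₁, B₁) 0 = (A, B) := by
      simp only [Φ, zero_smul, add_zero, hyY, ← hA, ← hB, Prod.mk.injEq]
      constructor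
      · calc T⁻¹ * (T * A * T⁻¹) * T = (T⁻¹ * T) * A * (T⁻¹ * T) := by
              simp only [Matrix.mul_assoc]
          _ = A := by rw [hTi, Matrix.one_mul, Matrix.mul_one]
      · rw [← Matrix.mul_assoc, hTi, Matrix.one_mul]
    have hΦmem : ∀ q ∈ realizablePairs m Ω₁, ∀ t, Φ q t ∈ realizablePairs m Ω := by
      rintro ⟨A₁', B₁'⟩ hq t
      have h1 : (E' + t • JMat 1, B₂) ∈ realizablePairs m Ω₂ := by
        rw [mem_realizablePairs] at hp₂ ⊢
        rw [← hp₂, hΩ₂, Matrix.mul_smul, Matrix.mul_smul, Matrix.smul_mul, Matrix.smul_mul,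
          ← smul_add, ← smul_add, mul_JMat_one_add, mul_JMat_one_add]
        have htr : (E' + t • JMat 1).trace = E'.trace := by
          have : (JMat 1).trace = 0 :=
            (Matrix.trace_fin_two (A := (JMat 1 : Matrix (Fin 2) (Fin 2) ℝ))).trans
              (by simp [JMat])
          rw [Matrix.trace_add, Matrix.trace_smul, this, smul_zero, add_zero]
        rw [htr]
      have h2 := (realizablePairs_blk_iff hΩ₂skew).mpr ⟨hq, hyΩ B₁', h1⟩
      have h3 := realizablePairs_conj (T := T⁻¹) ((Matrix.isUnit_nonsing_inv_iff).mpr hT) h2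
      have h4 : T⁻¹ * blk Ω₁ 0 0 Ω₂ * (T⁻¹)ᵀ = Ω := by
        have h5 : Tᵀ * (T⁻¹)ᵀ = 1 := by rw [← Matrix.transpose_mul, hTi, Matrix.transpose_one]
        rw [← hTΩ]
        calc T⁻¹ * (T * Ω * Tᵀ) * (T⁻¹)ᵀ = (T⁻¹ * T) * Ω * (Tᵀ * (T⁻¹)ᵀ) := by
              simp only [Matrix.mul_assoc]
          _ = Ω := by rw [hTi, h5, Matrix.one_mul, Matrix.mul_one]
      rw [h4, Matrix.nonsing_inv_nonsing_inv T ((Matrix.isUnit_iff_isUnit_det T).mp hT)] at h3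
      exact h3
    have hy : Continuous y := by fun_prop
    have hcont₁ : Continuous fun q => Φ q 0 := by
      refine Continuous.prodMk ?_ ?_
      · exact (continuous_const.matrix_mul (continuous_blk continuous_fst (hy.comp continuous_snd)
          continuous_const continuous_const)).matrix_mul continuous_const
      · exact continuous_const.matrix_mul (continuous_rws continuous_snd continuous_const)
    rw [← hΦ₀]
    refine closure_minimal subset_rfl isClosed_closure
      (map_mem_closure (f := fun q => Φ q 0) hcont₁ (ih hΩ₁u hΩ₁skew hp₁) ?_)
    rintro ⟨A₁', B₁'⟩ ⟨hq, hsplit⟩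
    have hcont₂ : Continuous fun t => Φ (A₁', B₁') t := by
      refine Continuous.prodMk ?_ continuous_const
      exact (continuous_const.matrix_mul (continuous_blk continuous_const continuous_const
        continuous_const (by fun_prop))).matrix_mul continuous_const
    refine map_mem_closure hcont₂
      ((hsplit.blk_shift hΩ₁u (E := E') hΩ₂u).countable.dense_compl ℝ 0) ?_
    intro t ht
    rw [Set.mem_compl_iff, Set.mem_ofPred_eq, not_not] at ht
    refine ⟨hΦmem _ hq t, IsSplit.conj hT ?_⟩
    rw [hTΩ]
    exact ht _

/-! ### Indices as pairs of a block and a position in the block -/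

/-- The index of a given position (in `Fin 2`) of a given block. -/
def blockEquiv (n : ℕ) : Fin 2 × Fin n ≃ Fin (2 * n) where
  toFun p := ⟨2 * p.2 + p.1, by omega⟩
  invFun i := (⟨(i : ℕ) % 2, Nat.mod_lt _ two_pos⟩, ⟨(i : ℕ) / 2, by omega⟩)
  left_inv p := by
    refine Prod.ext (Fin.ext ?_) (Fin.ext ?_) <;> simp <;> omega
  right_inv i := by
    refine Fin.ext ?_
    simp; omega

lemma blockEquiv_zero {n : ℕ} (k : Fin n) : blockEquiv n (0, k) = lo k := rfl

lemma blockEquiv_one {n : ℕ} (k : Fin n) : blockEquiv n (1, k) = hi k := rfl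

lemma blockEquiv_div {n : ℕ} (p : Fin 2 × Fin n) : (blockEquiv n p : ℕ) / 2 = p.2 := by
  simp [blockEquiv]; omega

lemma blockEquiv_mod {n : ℕ} (p : Fin 2 × Fin n) : (blockEquiv n p : ℕ) % 2 = p.1 := by
  simp [blockEquiv]; omega

lemma sum_lo_add_hi {n : ℕ} {M : Type*} [AddCommMonoid M] (f : Fin (2 * n) → M) :
    ∑ j, f j = ∑ k : Fin n, (f (lo k) + f (hi k)) := by
  rw [← (blockEquiv n).sum_comp, Fintype.sum_prod_type, Fin.sum_univ_two, Finset.sum_add_distrib]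
  rfl

lemma JMat_blockEquiv {n : ℕ} (p q : Fin 2 × Fin n) :
    JMat n (blockEquiv n p) (blockEquiv n q) =
      if p.2 = q.2 then (!![0, 1; -1, 0] : Matrix (Fin 2) (Fin 2) ℝ) p.1 q.1 else 0 := by
  simp only [JMat, Matrix.of_apply, blockEquiv_div, blockEquiv_mod, Fin.val_inj, Fin.eta]

lemma mul_JMat_mul_transpose_apply {κ κ' : Type*} {n : ℕ} (M : Matrix κ (Fin (2 * n)) ℝ)
    (N : Matrix κ' (Fin (2 * n)) ℝ) (i : κ) (j : κ') :
    (M * JMat n * Nᵀ) i j = ∑ k, (M i (lo k) * N j (hi k) - M i (hi k) * N j (lo k)) := by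
  simp only [Matrix.mul_apply, sum_lo_add_hi, ← blockEquiv_zero, ← blockEquiv_one,
    JMat_blockEquiv, Matrix.transpose_apply]
  refine Finset.sum_congr rfl fun k _ => ?_
  simp
  ring

/-- The block diagonal matrix with given `2 × 2` blocks. -/
def ofBlocks {n : ℕ} (B : Fin n → Matrix (Fin 2) (Fin 2) ℝ) :
    Matrix (Fin (2 * n)) (Fin (2 * n)) ℝ :=
  Matrix.reindex (blockEquiv n) (blockEquiv n) (Matrix.blockDiagonal B)

lemma ofBlocks_blockEquiv {n : ℕ} (B : Fin n → Matrix (Fin 2) (Fin 2) ℝ) (p q : Fin 2 × Fin n) :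
    ofBlocks B (blockEquiv n p) (blockEquiv n q) = if p.2 = q.2 then B p.2 p.1 q.1 else 0 := by
  simp [ofBlocks, Matrix.blockDiagonal_apply]

lemma ofBlocks_mul {n : ℕ} (B C : Fin n → Matrix (Fin 2) (Fin 2) ℝ) :
    ofBlocks B * ofBlocks C = ofBlocks fun k => B k * C k := by
  simp only [ofBlocks, Matrix.reindex_apply, Matrix.submatrix_mul_equiv,
    Matrix.blockDiagonal_mul]

lemma ofBlocks_one {n : ℕ} : ofBlocks (fun _ : Fin n => 1) = 1 := by
  have : (fun _ : Fin n => (1 : Matrix (Fin 2) (Fin 2) ℝ)) = 1 := rfl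
  rw [ofBlocks, this, Matrix.blockDiagonal_one, Matrix.reindex_apply, Matrix.submatrix_one_equiv]

lemma isBlockDiag_ofBlocks {n : ℕ} (B : Fin n → Matrix (Fin 2) (Fin 2) ℝ) :
    IsBlockDiag (ofBlocks B) := by
  intro i j hij
  obtain ⟨p, rfl⟩ := (blockEquiv n).surjective i
  obtain ⟨q, rfl⟩ := (blockEquiv n).surjective j
  rw [blockEquiv_div, blockEquiv_div] at hij
  rw [ofBlocks_blockEquiv, if_neg fun h => hij (congrArg Fin.val h)]

lemma IsBlockDiag.eq_ofBlocks {n : ℕ} {D : Matrix (Fin (2 * n)) (Fin (2 * n)) ℝ}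
    (hD : IsBlockDiag D) :
    D = ofBlocks fun k =>
      !![D (lo k) (lo k), D (lo k) (hi k); D (hi k) (lo k), D (hi k) (hi k)] := by
  ext i j
  obtain ⟨⟨x, k⟩, rfl⟩ := (blockEquiv n).surjective i
  obtain ⟨⟨y, l⟩, rfl⟩ := (blockEquiv n).surjective j
  rw [ofBlocks_blockEquiv]
  split_ifs with h
  · obtain rfl : k = l := h
    fin_cases x <;> fin_cases y <;> rfl
  · refine hD _ _ ?_
    rw [blockEquiv_div, blockEquiv_div]
    exact fun h' => h (Fin.ext h')

/-! ### Real Jordan forms with distinct eigenvalues -/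

lemma exists_diagonalization_of_disc_pos {p q r s : ℝ} (h : 0 < (p - s) ^ 2 + 4 * q * r) :
    ∃ Q F : Matrix (Fin 2) (Fin 2) ℝ, Q.det ≠ 0 ∧ !![p, q; r, s] * Q = Q * F ∧
      F 0 1 = 0 ∧ F 1 0 = 0 := by
  by_cases hq : q = 0
  · subst hq
    have hps : p - s ≠ 0 := fun h0 => by rw [h0] at h; simp at h
    refine ⟨!![p - s, 0; r, 1], !![p, 0; 0, s], by simpa using hps, ?_, rfl, rfl⟩
    ext i j
    fin_cases i <;> fin_cases j <;> simp <;> ring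
  · set d := Real.sqrt ((p - s) ^ 2 + 4 * q * r)
    have hd : d ^ 2 = (p - s) ^ 2 + 4 * q * r := Real.sq_sqrt h.le
    have hd0 : 0 < d := Real.sqrt_pos.mpr h
    refine ⟨!![q, q; (p + s + d) / 2 - p, (p + s - d) / 2 - p],
      !![(p + s + d) / 2, 0; 0, (p + s - d) / 2], ?_, ?_, rfl, rfl⟩
    · rw [Matrix.det_fin_two_of]
      have : q * ((p + s - d) / 2 - p) - q * ((p + s + d) / 2 - p) = -(q * d) := by ring
      rw [this]
      exact neg_ne_zero.mpr (mul_ne_zero hq hd0.ne')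
    · ext i j
      fin_cases i <;> fin_cases j <;> simp <;> linarith

lemma exists_realForm_of_disc_neg {p q r s : ℝ} (h : (p - s) ^ 2 + 4 * q * r < 0) :
    ∃ Q F : Matrix (Fin 2) (Fin 2) ℝ, Q.det ≠ 0 ∧ !![p, q; r, s] * Q = Q * F ∧
      F 1 1 = F 0 0 ∧ F 1 0 = -F 0 1 ∧ F 0 1 ≠ 0 := by
  set b := Real.sqrt (-((p - s) ^ 2 + 4 * q * r)) / 2 with hb
  have hb2 : 4 * b ^ 2 = -((p - s) ^ 2 + 4 * q * r) := by
    rw [hb, div_pow, Real.sq_sqrt (by linarith)]; ring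
  have hb0 : b ≠ 0 := by
    intro h0; rw [h0] at hb2; linarith
  have hr : r ≠ 0 := by
    intro h0
    rw [h0] at h
    nlinarith [sq_nonneg (p - s)]
  refine ⟨!![b, (p + s) / 2 - p; 0, -r], !![(p + s) / 2, b; -b, (p + s) / 2], ?_, ?_, rfl, rfl, hb0⟩
  · rw [Matrix.det_fin_two_of]
    simpa using ⟨hb0, hr⟩
  · ext i j
    fin_cases i <;> fin_cases j <;> simp <;> linarith

lemma sum_size_real (lam : ℕ → ℝ) (N : ℕ) :
    (((List.range N).map fun i => RealJordanBlock.real 0 (lam i)).map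
      RealJordanBlock.size).sum = N := by
  simp [Function.comp_def, RealJordanBlock.size]

lemma sum_size_cplx (a b : ℕ → ℝ) (hb : ∀ i, b i ≠ 0) (N : ℕ) :
    (((List.range N).map fun i => RealJordanBlock.cplx 0 (a i) (b i) (hb i)).map
      RealJordanBlock.size).sum = 2 * N := by
  simp [Function.comp_def, RealJordanBlock.size, mul_comm]

lemma diagEntry_real (lam : ℕ → ℝ) (N : ℕ) (L : List RealJordanBlock) (i j : ℕ) :
    RealJordanBlock.diagEntry ((List.range N).map (fun i => RealJordanBlock.real 0 (lam i)) ++ L)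
      i j = if i < N ∧ j < N then (if i = j then lam i else 0)
        else if N ≤ i ∧ N ≤ j then RealJordanBlock.diagEntry L (i - N) (j - N) else 0 := by
  induction N generalizing lam i j with
  | zero => simp
  | succ N ih =>
    rw [List.range_succ_eq_map, List.map_cons, List.map_map, List.cons_append,
      RealJordanBlock.diagEntry]
    have ih' := ih (fun i => lam (i + 1)) (i - 1) (j - 1)
    simp only [Function.comp_def, RealJordanBlock.size, RealJordanBlock.entry, zero_add]
    simp only [Nat.succ_eq_add_one]
    rw [ih']
    rcases i with _ | i <;> rcases j with _ | j <;> simp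

lemma diagEntry_cplx (a b : ℕ → ℝ) (hb : ∀ i, b i ≠ 0) (N : ℕ) {i j : ℕ} (hi : i < 2 * N)
    (hj : j < 2 * N) :
    RealJordanBlock.diagEntry
      ((List.range N).map fun i => RealJordanBlock.cplx 0 (a i) (b i) (hb i)) i j =
      if i / 2 = j / 2 then
        (!![a (i / 2), b (i / 2); -b (i / 2), a (i / 2)] : Matrix (Fin 2) (Fin 2) ℝ)
          ⟨i % 2, Nat.mod_lt _ two_pos⟩ ⟨j % 2, Nat.mod_lt _ two_pos⟩ else 0 := by
  induction N generalizing a b i j with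
  | zero => omega
  | succ N ih =>
    rw [List.range_succ_eq_map, List.map_cons, List.map_map, RealJordanBlock.diagEntry]
    simp only [Function.comp_def, RealJordanBlock.size, RealJordanBlock.entry, zero_add, mul_one]
    simp only [Nat.succ_eq_add_one]
    by_cases h : i < 2 ∧ j < 2
    · rw [if_pos h]
      have h1 : i / 2 = 0 := by omega
      have h2 : j / 2 = 0 := by omega
      rw [h1, h2, if_pos rfl, if_pos rfl]
    · rw [if_neg h]
      by_cases h' : 2 ≤ i ∧ 2 ≤ j
      · rw [if_pos h', ih (fun i => a (i + 1)) (fun i => b (i + 1)) (fun i => hb (i + 1))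
          (by omega) (by omega)]
        have h1 : (i - 2) / 2 + 1 = i / 2 := by omega
        have h2 : (i - 2) % 2 = i % 2 := by omega
        have h3 : (j - 2) % 2 = j % 2 := by omega
        have h4 : (i - 2) / 2 = (j - 2) / 2 ↔ i / 2 = j / 2 := by omega
        simp only [h1, h2, h3, h4]
      · rw [if_neg h', if_neg (by omega)]

/-- A block diagonal matrix with diagonal blocks first and blocks `!![a, b; -b, a]` after them is an
ordered real Jordan form. -/
lemma isOrderedRealJordanForm_ofBlocks {n r : ℕ} (hr : r ≤ n)
    {F : Fin n → Matrix (Fin 2) (Fin 2) ℝ}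
    (hreal : ∀ k : Fin n, (k : ℕ) < r → F k 0 1 = 0 ∧ F k 1 0 = 0)
    (hcplx : ∀ k : Fin n, ¬ (k : ℕ) < r →
      F k 1 1 = F k 0 0 ∧ F k 1 0 = -F k 0 1 ∧ F k 0 1 ≠ 0) :
    IsOrderedRealJordanForm (ofBlocks F) := by
  let lam : ℕ → ℝ := fun i => if h : i / 2 < n then
    F ⟨i / 2, h⟩ ⟨i % 2, Nat.mod_lt _ two_pos⟩ ⟨i % 2, Nat.mod_lt _ two_pos⟩ else 0
  let a : ℕ → ℝ := fun i => if h : r + i < n then F ⟨r + i, h⟩ 0 0 else 0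
  let b : ℕ → ℝ := fun i => if h : r + i < n then F ⟨r + i, h⟩ 0 1 else 1
  have hb : ∀ i, b i ≠ 0 := by
    intro i
    by_cases h : r + i < n
    · simp only [b, dif_pos h]
      exact (hcplx ⟨r + i, h⟩ (by simp)).2.2
    · simp only [b, dif_neg h]
      exact one_ne_zero
  refine ⟨(List.range (2 * r)).map fun i => RealJordanBlock.real 0 (lam i),
    (List.range (n - r)).map fun i => RealJordanBlock.cplx 0 (a i) (b i) (hb i), ?_, ?_, ?_, ?_⟩
  · intro B hB
    obtain ⟨i, -, rfl⟩ := List.mem_map.mp hB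
    trivial
  · intro B hB
    obtain ⟨i, -, rfl⟩ := List.mem_map.mp hB
    exact id
  · rw [List.map_append, List.sum_append, sum_size_real, sum_size_cplx]
    omega
  · intro i j
    rw [diagEntry_real]
    obtain ⟨⟨x, k⟩, rfl⟩ := (blockEquiv n).surjective i
    obtain ⟨⟨y, l⟩, rfl⟩ := (blockEquiv n).surjective j
    rw [ofBlocks_blockEquiv]
    have hk : (blockEquiv n (x, k) : ℕ) = 2 * k + x := rfl
    have hl : (blockEquiv n (y, l) : ℕ) = 2 * l + y := rfl
    have hx := x.2
    have hy := y.2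
    by_cases hkl : k = l
    · subst hkl
      rw [if_pos rfl]
      by_cases hkr : (k : ℕ) < r
      · rw [if_pos (by rw [hk, hl]; omega)]
        obtain ⟨h01, h10⟩ := hreal k hkr
        have hlam : lam (blockEquiv n (x, k)) = F k x x := by
          have h1 : (blockEquiv n (x, k) : ℕ) / 2 = k := blockEquiv_div _
          have h2 : (blockEquiv n (x, k) : ℕ) % 2 = x := blockEquiv_mod _
          simp only [lam, h1, h2]
          rw [dif_pos k.2]
        rw [hlam, hk, hl]
        fin_cases x <;> fin_cases y <;> simp [h01, h10]
      · rw [if_neg (by rw [hk]; omega), if_pos (by rw [hk, hl]; omega), diagEntry_cplx a b hb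
          (n - r) (by omega) (by omega)]
        obtain ⟨h11, h10, -⟩ := hcplx k hkr
        have h1 : ((blockEquiv n (x, k) : ℕ) - 2 * r) / 2 = k - r := by omega
        have h2 : ((blockEquiv n (y, k) : ℕ) - 2 * r) / 2 = k - r := by omega
        have h3 : ((blockEquiv n (x, k) : ℕ) - 2 * r) % 2 = x := by omega
        have h4 : ((blockEquiv n (y, k) : ℕ) - 2 * r) % 2 = y := by omega
        have hkn := k.2
        have ha : a (k - r) = F k 0 0 := by
          have e : r + (k - r) = k := by omega
          simp only [a, e]
          rw [dif_pos k.2]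
        have hb' : b (k - r) = F k 0 1 := by
          have e : r + (k - r) = k := by omega
          simp only [b, e]
          rw [dif_pos k.2]
        simp only [h1, h2, h3, h4, if_true, ha, hb']
        fin_cases x <;> fin_cases y <;> simp [h11, h10]
    · rw [if_neg hkl]
      have hkl' : (k : ℕ) ≠ l := fun h => hkl (Fin.ext h)
      have hne : (blockEquiv n (x, k) : ℕ) ≠ blockEquiv n (y, l) := by omega
      rw [if_neg hne]
      split_ifs with h1 h2
      · rfl
      · rw [diagEntry_cplx a b hb (n - r) (by omega) (by omega), if_neg (by omega)]
      · rfl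

/-! ### Admissible matrices -/

lemma submatrix_castLE_mul {n i : ℕ} (hi : i ≤ n) {κ κ' : Type*}
    (M : Matrix κ (Fin (2 * n)) ℝ) {Q : Matrix (Fin (2 * n)) (Fin (2 * n)) ℝ} (hQ : IsBlockDiag Q)
    (f : κ' → κ) :
    (M * Q).submatrix f (Fin.castLE (Nat.mul_le_mul_left 2 hi)) =
      M.submatrix f (Fin.castLE (Nat.mul_le_mul_left 2 hi)) *
        Q.submatrix (Fin.castLE (Nat.mul_le_mul_left 2 hi))
          (Fin.castLE (Nat.mul_le_mul_left 2 hi)) := by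
  ext a j
  rw [Matrix.submatrix_apply, Matrix.mul_apply, Matrix.mul_apply]
  refine (Fintype.sum_of_injective (Fin.castLE (Nat.mul_le_mul_left 2 hi))
    (Fin.castLE_injective _) _ _ (fun k hk => ?_) fun k => rfl).symm
  have hk' : ¬ (k : ℕ) < 2 * i := fun h => hk ⟨⟨k, h⟩, rfl⟩
  have hj := j.2
  rw [hQ k _ (by rw [Fin.val_castLE]; omega), mul_zero]

/-- Block diagonal congruences, with `Q'` the inverse of `Q`, preserve the condition on leading
minors. -/
lemma HasLeadingMinors.congr {n : ℕ} {M Q Q' : Matrix (Fin (2 * n)) (Fin (2 * n)) ℝ}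
    (hM : HasLeadingMinors M) (hQ : IsBlockDiag Q) (hQ' : IsBlockDiag Q') (h : Q * Q' = 1) :
    HasLeadingMinors (Qᵀ * M * Q) := by
  intro k hk
  set g : Fin (2 * k) → Fin (2 * n) := Fin.castLE (Nat.mul_le_mul_left 2 hk)
  have h1 : (Qᵀ * M * Q).submatrix g g =
      (Q.submatrix g g)ᵀ * M.submatrix g g * Q.submatrix g g := by
    rw [submatrix_castLE_mul hk _ hQ]
    congr 1
    have := congrArg Matrix.transpose (submatrix_castLE_mul hk Mᵀ hQ g)
    rw [Matrix.transpose_submatrix, Matrix.transpose_mul, Matrix.transpose_mul,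
      Matrix.transpose_transpose] at this
    exact this
  have h2 : (Q.submatrix g g).det ≠ 0 := by
    have h3 := submatrix_castLE_mul hk Q hQ' g
    rw [h, Matrix.submatrix_one _ (Fin.castLE_injective _)] at h3
    have h4 := congrArg Matrix.det h3
    rw [Matrix.det_one, Matrix.det_mul] at h4
    exact left_ne_zero_of_mul (h4 ▸ one_ne_zero)
  rw [h1, Matrix.det_mul, Matrix.det_mul, Matrix.det_transpose]
  exact mul_ne_zero (mul_ne_zero h2 (hM k hk)) h2

/-- The blocks with real eigenvalues stand before those with non-real eigenvalues. -/
def IsSorted {n : ℕ} (D : Matrix (Fin (2 * n)) (Fin (2 * n)) ℝ) : Prop :=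
  (∀ k, blockDisc D k ≠ 0) ∧ ∃ r ≤ n, ∀ k : Fin n, 0 < blockDisc D k ↔ (k : ℕ) < r

lemma isAdmissible_of_isSorted {n : ℕ} {V D : Matrix (Fin (2 * n)) (Fin (2 * n)) ℝ}
    (hD : IsBlockDiag D) (hs : IsSorted D) (hV : HasLeadingMinors (Vᵀ * JMat n * V)) :
    IsAdmissible (V * D * V⁻¹) := by
  obtain ⟨hdisc, r, hr, hrk⟩ := hs
  have hex : ∀ k : Fin n, ∃ Q F : Matrix (Fin 2) (Fin 2) ℝ, Q.det ≠ 0 ∧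
      !![D (lo k) (lo k), D (lo k) (hi k); D (hi k) (lo k), D (hi k) (hi k)] * Q = Q * F ∧
      ((k : ℕ) < r → F 0 1 = 0 ∧ F 1 0 = 0) ∧
      (¬ (k : ℕ) < r → F 1 1 = F 0 0 ∧ F 1 0 = -F 0 1 ∧ F 0 1 ≠ 0) := by
    intro k
    by_cases hk : (k : ℕ) < r
    · obtain ⟨Q, F, hQ, hF, h⟩ := exists_diagonalization_of_disc_pos ((hrk k).mpr hk)
      exact ⟨Q, F, hQ, hF, fun _ => h, fun h' => absurd hk h'⟩
    · have hneg : blockDisc D k < 0 :=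
        lt_of_le_of_ne (not_lt.mp fun h => hk ((hrk k).mp h)) (hdisc k)
      obtain ⟨Q, F, hQ, hF, h⟩ := exists_realForm_of_disc_neg hneg
      exact ⟨Q, F, hQ, hF, fun h' => absurd h' hk, fun _ => h⟩
  choose Q F hQ hDQ hreal hcplx using hex
  have hQinv : ofBlocks Q * ofBlocks (fun k => (Q k)⁻¹) = 1 := by
    rw [ofBlocks_mul, ← ofBlocks_one]
    congr 1
    ext1 k
    exact mul_inv_cancel_of_isUnit (isUnit_of_det_ne_zero (hQ k))
  have hVu := isUnit_of_hasLeadingMinors hV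
  have hQu : IsUnit (ofBlocks Q) := IsUnit.of_mul_eq_one _ hQinv
  have hDF : D * ofBlocks Q = ofBlocks Q * ofBlocks F := by
    rw [ofBlocks_mul]
    nth_rewrite 1 [hD.eq_ofBlocks]
    rw [ofBlocks_mul]
    exact congrArg ofBlocks (funext hDQ)
  refine ⟨V * ofBlocks Q, hVu.mul hQu, ?_, fun i hin hi => ?_⟩
  · have h1 : (V * ofBlocks Q)⁻¹ * (V * D * V⁻¹) * (V * ofBlocks Q) = ofBlocks F := by
      rw [Matrix.mul_inv_rev]
      calc (ofBlocks Q)⁻¹ * V⁻¹ * (V * D * V⁻¹) * (V * ofBlocks Q) =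
            (ofBlocks Q)⁻¹ * (V⁻¹ * V) * D * (V⁻¹ * V) * ofBlocks Q := by
            simp only [Matrix.mul_assoc]
        _ = (ofBlocks Q)⁻¹ * (D * ofBlocks Q) := by
            rw [inv_mul_cancel_of_isUnit hVu]; simp only [Matrix.mul_one, Matrix.mul_assoc]
        _ = ofBlocks F := by
            rw [hDF, ← Matrix.mul_assoc, inv_mul_cancel_of_isUnit hQu, Matrix.one_mul]
    rw [h1]
    exact isOrderedRealJordanForm_ofBlocks hr hreal hcplx
  · have h1 := hV.congr (isBlockDiag_ofBlocks Q) (isBlockDiag_ofBlocks fun k => (Q k)⁻¹) hQinv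
    have h2 := h1 i hin.le
    have h3 : (ofBlocks Q)ᵀ * (Vᵀ * JMat n * V) * ofBlocks Q =
        (V * ofBlocks Q)ᵀ * (JMat n * (V * ofBlocks Q)) := by
      simp only [Matrix.transpose_mul, Matrix.mul_assoc]
    rw [h3] at h2
    rw [Matrix.mul_assoc]
    exact h2

lemma continuous_blockDisc {n : ℕ} (k : Fin n) :
    Continuous fun D : Matrix (Fin (2 * n)) (Fin (2 * n)) ℝ => blockDisc D k := by
  unfold blockDisc
  fun_prop

lemma isAdmissible_mem_nhds {n : ℕ} {V D : Matrix (Fin (2 * n)) (Fin (2 * n)) ℝ}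
    (hD : IsSeparated D) (hs : IsSorted D) (hV : HasLeadingMinors (Vᵀ * JMat n * V)) :
    {A | IsAdmissible A} ∈ nhds (V * D * V⁻¹) := by
  obtain ⟨hdisc, r, hr, hrk⟩ := hs
  have hnhds : {p : Matrix (Fin (2 * n)) (Fin (2 * n)) ℝ × Matrix (Fin (2 * n)) (Fin (2 * n)) ℝ |
      HasLeadingMinors (p.1ᵀ * JMat n * p.1) ∧ ∀ k, 0 < blockDisc D k * blockDisc p.2 k} ∈
      nhds (V, D) := by
    refine IsOpen.mem_nhds ?_ ⟨hV, fun k => mul_self_pos.mpr (hdisc k)⟩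
    have h1 := (isOpen_hasLeadingMinors n).preimage (f := fun p :
      Matrix (Fin (2 * n)) (Fin (2 * n)) ℝ × Matrix (Fin (2 * n)) (Fin (2 * n)) ℝ =>
        p.1ᵀ * JMat n * p.1) (by fun_prop)
    have h2 : IsOpen (⋂ k, {p : Matrix (Fin (2 * n)) (Fin (2 * n)) ℝ ×
        Matrix (Fin (2 * n)) (Fin (2 * n)) ℝ | 0 < blockDisc D k * blockDisc p.2 k}) :=
      isOpen_iInter_of_finite fun k => isOpen_lt continuous_const
        (continuous_const.mul ((continuous_blockDisc k).comp continuous_snd))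
    convert h1.inter h2 using 1
    ext p
    simp [Set.mem_iInter]
  refine Filter.mem_of_superset (hD.conj_mem_nhds (isUnit_of_hasLeadingMinors hV) hnhds) ?_
  rintro _ ⟨⟨V', D'⟩, ⟨hV', hk⟩, -, hD', rfl⟩
  refine isAdmissible_of_isSorted hD' ⟨fun k => right_ne_zero_of_mul (hk k).ne', r, hr,
    fun k => ?_⟩ hV'
  rw [← hrk k]
  exact (pos_iff_pos_of_mul_pos (hk k)).symm

lemma hasSymplecticSchur_mem_nhds {n : ℕ} {A : Matrix (Fin (2 * n)) (Fin (2 * n)) ℝ}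
    (hA : IsSplit (JMat n) Aᵀ) : {A | HasSymplecticSchur A} ∈ nhds A := by
  obtain ⟨V, D, hAV, hD, -, hV⟩ := hA
  rw [inv_JMat, Matrix.mul_neg, Matrix.neg_mul] at hV
  replace hV := hV.neg
  rw [neg_neg] at hV
  have hVu := isUnit_of_hasLeadingMinors hV
  have hnhds : {p : Matrix (Fin (2 * n)) (Fin (2 * n)) ℝ × Matrix (Fin (2 * n)) (Fin (2 * n)) ℝ |
      HasLeadingMinors (p.1ᵀ * JMat n * p.1)} ∈ nhds (V, D) :=
    ((isOpen_hasLeadingMinors n).preimage (f := fun p :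
      Matrix (Fin (2 * n)) (Fin (2 * n)) ℝ × Matrix (Fin (2 * n)) (Fin (2 * n)) ℝ =>
        p.1ᵀ * JMat n * p.1) (by fun_prop)).mem_nhds hV
  have hmem := hD.conj_mem_nhds hVu hnhds
  have hAt : V * D * V⁻¹ = Aᵀ := by
    rw [← hAV, Matrix.mul_assoc, mul_inv_cancel_of_isUnit hVu, Matrix.mul_one]
  rw [hAt] at hmem
  have hc : Continuous fun A : Matrix (Fin (2 * n)) (Fin (2 * n)) ℝ => Aᵀ := by fun_prop
  refine Filter.mem_of_superset (hc.continuousAt.preimage_mem_nhds hmem) ?_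
  rintro A' ⟨⟨V', D'⟩, hV', -, hD', hA'⟩
  have := hasSymplecticSchur_transpose hD' hV'
  change A'ᵀ = V' * D' * V'⁻¹ at hA'
  rwa [← hA', Matrix.transpose_transpose] at this

/-- Realizability imposes no condition on `A` if there are enough fields: every skew-symmetric
matrix is of the form `B 𝕁 Bᵀ`. -/
lemma exists_mem_realizablePairs {n : ℕ} (A : Matrix (Fin (2 * n)) (Fin (2 * n)) ℝ) :
    ∃ B, (A, B) ∈ realizablePairs (2 * n) (JMat n) := by
  set K := A * JMat n + JMat n * Aᵀ with hK
  have hKskew : ∀ i j, K j i = -K i j := by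
    have : Kᵀ = -K := by
      simp [hK, Matrix.transpose_mul, JMat_transpose]
    exact fun i j => congrFun (congrFun this i) j
  let B : Matrix (Fin (2 * n)) (Fin (2 * (2 * n))) ℝ := Matrix.of fun i j =>
    if ((blockEquiv (2 * n)).symm j).1 = 0 then
      (if i = ((blockEquiv (2 * n)).symm j).2 then 1 else 0)
    else K i ((blockEquiv (2 * n)).symm j).2 / 2
  refine ⟨B, ?_⟩
  have hlo : ∀ i k, B i (lo k) = if i = k then 1 else 0 := by
    intro i k
    simp [B, ← blockEquiv_zero]
  have hhi : ∀ i k, B i (hi k) = K i k / 2 := by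
    intro i k
    simp [B, ← blockEquiv_one]
  rw [mem_realizablePairs, ← hK]
  ext i j
  rw [Matrix.add_apply, mul_JMat_mul_transpose_apply]
  simp only [hlo, hhi, Finset.sum_sub_distrib, ite_mul, mul_ite, one_mul, zero_mul, mul_one,
    mul_zero, Finset.sum_ite_eq, Finset.mem_univ, if_true, Matrix.zero_apply]
  rw [hKskew i j]
  ring

lemma mem_closure_isSplit_JMat {n : ℕ} (hn : 1 ≤ n) (A : Matrix (Fin (2 * n)) (Fin (2 * n)) ℝ) :
    A ∈ closure {A | IsSplit (JMat n) A} := by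
  obtain ⟨B, hB⟩ := exists_mem_realizablePairs A
  exact map_mem_closure continuous_fst
    (mem_closure_isSplit (by omega) n (isUnit_JMat n) (JMat_transpose n) hB) fun p hp => hp.2

/-- A polynomial path of matrices that ends in one with nonzero leading minors meets the others only
finitely often; here the path is the segment from `V` to `1`. -/
lemma finite_not_hasLeadingMinors {n : ℕ} (V : Matrix (Fin (2 * n)) (Fin (2 * n)) ℝ) :
    {t : ℝ | ¬ HasLeadingMinors
      ((V + t • (1 - V))ᵀ * JMat n * (V + t • (1 - V)))}.Finite := by
  open Polynomial in
  let P : Matrix (Fin (2 * n)) (Fin (2 * n)) ℝ[X] :=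
    C.mapMatrix V + (X : ℝ[X]) • C.mapMatrix (1 - V)
  let p : Fin (n + 1) → Polynomial ℝ := fun k =>
    ((Pᵀ * Polynomial.C.mapMatrix (JMat n) * P).submatrix
    (Fin.castLE (Nat.mul_le_mul_left 2 (Nat.lt_succ_iff.mp k.2)))
    (Fin.castLE (Nat.mul_le_mul_left 2 (Nat.lt_succ_iff.mp k.2)))).det
  have hP : ∀ t : ℝ, (Polynomial.evalRingHom t).mapMatrix P = V + t • (1 - V) := by
    intro t
    ext i j
    simp [P]
  have heval : ∀ k t, (p k).eval t = (((V + t • (1 - V))ᵀ * JMat n * (V + t • (1 - V))).submatrix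
      (Fin.castLE (Nat.mul_le_mul_left 2 (Nat.lt_succ_iff.mp k.2)))
      (Fin.castLE (Nat.mul_le_mul_left 2 (Nat.lt_succ_iff.mp k.2)))).det := by
    intro k t
    rw [← Polynomial.coe_evalRingHom, RingHom.map_det, ← hP t]
    congr 1
    have h1 : (Polynomial.evalRingHom t).mapMatrix (Pᵀ * Polynomial.C.mapMatrix (JMat n) * P) =
        ((Polynomial.evalRingHom t).mapMatrix P)ᵀ * JMat n *
          (Polynomial.evalRingHom t).mapMatrix P := by
      rw [map_mul, map_mul]
      congr 2
      ext i j
      simp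
    rw [← h1]
    rfl
  have hp : ∀ k, p k ≠ 0 := by
    intro k h0
    have h1 := heval k 1
    rw [h0, Polynomial.eval_zero, one_smul, add_sub_cancel, Matrix.transpose_one, Matrix.one_mul,
      Matrix.mul_one] at h1
    exact hasLeadingMinors_JMat n k (Nat.lt_succ_iff.mp k.2) h1.symm
  refine (Set.finite_iUnion fun k => (p k).rootSet_finite ℝ).subset fun t ht => ?_
  rw [Set.mem_ofPred_eq, HasLeadingMinors] at ht
  push Not at ht
  obtain ⟨k, hk, h0⟩ := ht
  refine Set.mem_iUnion.mpr ⟨⟨k, Nat.lt_succ_of_le hk⟩, ?_⟩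
  rw [Polynomial.mem_rootSet_of_ne (hp _), Polynomial.coe_aeval_eq_eval, heval]
  exact h0

/-- Sorting the blocks of a block diagonalization. -/
lemma exists_sorted {n : ℕ} {A V D : Matrix (Fin (2 * n)) (Fin (2 * n)) ℝ} (hV : IsUnit V)
    (hAV : A * V = V * D) (hD : IsSeparated D) (hdisc : ∀ k, blockDisc D k ≠ 0) :
    ∃ V' D' : Matrix (Fin (2 * n)) (Fin (2 * n)) ℝ, IsUnit V' ∧ A * V' = V' * D' ∧
      IsSeparated D' ∧ IsSorted D' := by
  let key : Fin n → ℕ := fun k => if 0 < blockDisc D k then 0 else 1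
  let σ := Tuple.sort key
  have hmono : Monotone (key ∘ σ) := Tuple.monotone_sort key
  let s : Equiv.Perm (Fin (2 * n)) :=
    (blockEquiv n).symm.trans ((Equiv.prodCongr (Equiv.refl _) σ).trans (blockEquiv n))
  have hs : ∀ p, s (blockEquiv n p) = blockEquiv n (p.1, σ p.2) := by
    rintro ⟨x, k⟩; simp [s]
  have hblk : ∀ i j, ((s i : ℕ) / 2 = (s j : ℕ) / 2) ↔ (i : ℕ) / 2 = (j : ℕ) / 2 := by
    intro i j
    obtain ⟨p, rfl⟩ := (blockEquiv n).surjective i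
    obtain ⟨q, rfl⟩ := (blockEquiv n).surjective j
    simp only [hs, blockEquiv_div, Fin.val_inj, σ.injective.eq_iff]
  have hdiag : ∀ N : Matrix (Fin (2 * n)) (Fin (2 * n)) ℝ, IsBlockDiag N →
      IsBlockDiag (N.submatrix s s) := fun N hN i j hij => hN _ _ fun h => hij ((hblk i j).mp h)
  have hdisc' : ∀ k, blockDisc (D.submatrix s s) k = blockDisc D (σ k) := by
    intro k
    simp only [blockDisc, Matrix.submatrix_apply, ← blockEquiv_zero, ← blockEquiv_one, hs]
  refine ⟨V.submatrix id s, D.submatrix s s, ?_, ?_, ⟨hdiag D hD.1, fun N hN => ?_⟩,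
    fun k => by rw [hdisc']; exact hdisc _, ?_⟩
  · refine isUnit_of_det_ne_zero ?_
    rw [Matrix.det_permute']
    exact mul_ne_zero (by simp) ((Matrix.isUnit_iff_isUnit_det V).mp hV).ne_zero
  · have h1 : A * V.submatrix id s = (A * V).submatrix id s := rfl
    rw [h1, hAV, Matrix.submatrix_mul_equiv]
  · have h1 : N.submatrix s.symm s.symm * D = D * N.submatrix s.symm s.symm := by
      have := congrArg (fun M => M.submatrix s.symm s.symm) hN
      simp only [← Matrix.submatrix_mul_equiv _ _ _ s.symm] at this
      simpa [Matrix.submatrix_submatrix] using this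
    have h2 := hdiag _ (hD.2 _ h1)
    simpa [Matrix.submatrix_submatrix] using h2
  · refine ⟨(Finset.univ.filter fun k : Fin n => 0 < blockDisc D (σ k)).card, ?_, fun k => ?_⟩
    · exact (Finset.card_le_univ _).trans (by simp)
    · rw [hdisc']
      have hlow : ∀ k l : Fin n, k ≤ l → 0 < blockDisc D (σ l) → 0 < blockDisc D (σ k) := by
        intro k l hkl hl
        by_contra hk
        have := hmono hkl
        simp [key, hl, hk] at this
      constructor
      · intro hk
        have hsub : Finset.Iic k ⊆ Finset.univ.filter fun k : Fin n => 0 < blockDisc D (σ k) :=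
          fun l hl => Finset.mem_filter.mpr ⟨Finset.mem_univ l, hlow l k (Finset.mem_Iic.mp hl) hk⟩
        have := Finset.card_le_card hsub
        rw [Fin.card_Iic] at this
        omega
      · intro hk
        by_contra hneg
        have hsub : (Finset.univ.filter fun k : Fin n => 0 < blockDisc D (σ k)) ⊆
            Finset.Iio k := by
          intro l hl
          rw [Finset.mem_Iio]
          by_contra hkl
          exact hneg (hlow k l (not_lt.mp hkl) (Finset.mem_filter.mp hl).2)
        have := Finset.card_le_card hsub
        rw [Fin.card_Iio] at this
        omega

lemma tendsto_conj {n : ℕ} {V : Matrix (Fin (2 * n)) (Fin (2 * n)) ℝ} (hV : IsUnit V)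
    (D : Matrix (Fin (2 * n)) (Fin (2 * n)) ℝ) :
    Filter.Tendsto (fun t : ℝ => (V + t • (1 - V)) * D * (V + t • (1 - V))⁻¹) (nhds 0)
      (nhds (V * D * V⁻¹)) := by
  have h0 : V + (0 : ℝ) • (1 - V) = V := by rw [zero_smul, add_zero]
  have hc : ContinuousAt (fun t : ℝ => V + t • (1 - V)) 0 := by
    have : Continuous fun t : ℝ => V + t • (1 - V) := by fun_prop
    exact this.continuousAt
  have hinv : ContinuousAt (fun M : Matrix (Fin (2 * n)) (Fin (2 * n)) ℝ => M⁻¹) V := by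
    simp only [Matrix.inv_def, Ring.inverse_eq_inv']
    refine ContinuousAt.smul (f := fun M : Matrix (Fin (2 * n)) (Fin (2 * n)) ℝ => M.det⁻¹)
      (g := fun M : Matrix (Fin (2 * n)) (Fin (2 * n)) ℝ => M.adjugate) ?_ ?_
    · exact (continuous_id.matrix_det.continuousAt).inv₀
        ((Matrix.isUnit_iff_isUnit_det V).mp hV).ne_zero
    · exact continuous_id.matrix_adjugate.continuousAt
  have h1 : Filter.Tendsto (fun t : ℝ => V + t • (1 - V)) (nhds 0) (nhds V) := by
    have := hc.tendsto
    rwa [h0] at this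
  exact (h1.mul_const D).mul (hinv.tendsto.comp h1)

/-- A split matrix can be block diagonalized with sorted blocks, but then the leading minors of
`Vᵀ 𝕁 V` may vanish; for almost all points of the segment from `V` to `1` they do not, and the
conjugates of the same `D` by those near `V` are interior points of the set. -/
theorem mem_closure_interior_isAdmissible {n : ℕ} (hn : 1 ≤ n)
    (A : Matrix (Fin (2 * n)) (Fin (2 * n)) ℝ) :
    A ∈ closure (interior {A | IsAdmissible A}) := by
  refine closure_minimal ?_ isClosed_closure (mem_closure_isSplit_JMat hn A)
  rintro A ⟨V, D, hAV, hD, hdisc, hV⟩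
  obtain ⟨V', D', hV', hAV', hD', hs⟩ := exists_sorted (isUnit_of_hasLeadingMinors hV) hAV hD hdisc
  have hA : V' * D' * V'⁻¹ = A := by
    rw [← hAV', Matrix.mul_assoc, mul_inv_cancel_of_isUnit hV', Matrix.mul_one]
  rw [← hA]
  refine mem_closure_of_frequently_of_tendsto ?_ (tendsto_conj hV' D')
  have hd : (0 : ℝ) ∈ closure _ := (finite_not_hasLeadingMinors V').countable.dense_compl ℝ 0
  refine (mem_closure_iff_frequently.mp hd).mono fun t ht => ?_
  rw [Set.mem_compl_iff, Set.mem_ofPred_eq, not_not] at ht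
  exact mem_interior_iff_mem_nhds.mpr (isAdmissible_mem_nhds hD' hs ht)

/-! ### Genericity -/

lemma isGeneric_of_interior {X : Type*} [TopologicalSpace X] {s : Set X}
    (h : ∀ x, x ∈ closure (interior s)) : IsGeneric s :=
  ⟨interior s, interior_subset, isOpen_interior, h⟩

lemma mem_interior_schur {n : ℕ} {A : Matrix (Fin (2 * n)) (Fin (2 * n)) ℝ}
    (hA : IsSplit (JMat n) Aᵀ) :
    A ∈ interior {A : Matrix (Fin (2 * n)) (Fin (2 * n)) ℝ | HasSymplecticSchur A} :=
  mem_interior_iff_mem_nhds.mpr (hasSymplecticSchur_mem_nhds hA)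

lemma mem_closure_interior_schur {n : ℕ} (hn : 1 ≤ n)
    (A : Matrix (Fin (2 * n)) (Fin (2 * n)) ℝ) :
    A ∈ closure (interior {A : Matrix (Fin (2 * n)) (Fin (2 * n)) ℝ | HasSymplecticSchur A}) := by
  have hc : Continuous fun A : Matrix (Fin (2 * n)) (Fin (2 * n)) ℝ => Aᵀ := by fun_prop
  have h := map_mem_closure hc (mem_closure_isSplit_JMat hn Aᵀ)
    (t := interior {A : Matrix (Fin (2 * n)) (Fin (2 * n)) ℝ | HasSymplecticSchur A})
    fun M hM => mem_interior_schur (by rwa [Matrix.transpose_transpose])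
  rwa [Matrix.transpose_transpose] at h

/-- Conjugation by `𝕁` turns the realizability condition of `(A, B)` into that of `(Aᵀ, 𝕁 B)`. -/
lemma dual_mem_realizablePairs {n m : ℕ} {A : Matrix (Fin (2 * n)) (Fin (2 * n)) ℝ}
    {B : Matrix (Fin (2 * n)) (Fin (2 * m)) ℝ} (h : (A, B) ∈ realizablePairs m (JMat n)) :
    (Aᵀ, JMat n * B) ∈ realizablePairs m (JMat n) := by
  rw [mem_realizablePairs] at h ⊢
  have h1 : -(JMat n * (A * JMat n + JMat n * Aᵀ + B * JMat m * Bᵀ) * JMat n) = 0 := by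
    rw [h, Matrix.mul_zero, Matrix.zero_mul, neg_zero]
  rw [← h1]
  simp only [Matrix.transpose_mul, Matrix.transpose_transpose, JMat_transpose, Matrix.mul_add,
    Matrix.add_mul, Matrix.mul_assoc, JMat_mul_self, JMat_mul_self_mul, Matrix.mul_neg,
    Matrix.neg_mul, Matrix.mul_one]
  abel

/-- The systems whose matrix `A` is in the interior of the set of matrices with a symplectic Schur
decomposition are dense among the realizable ones; `(A, B) ↦ (Aᵀ, 𝕁 B)` is a duality between upper
and lower block triangular forms. -/
lemma dense_realizablePairs {n m : ℕ} (hm : 1 ≤ m) (p : realizablePairs (n := n) m (JMat n)) :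
    p ∈ closure {q : realizablePairs (n := n) m (JMat n) | q.1.1 ∈
      interior {A : Matrix (Fin (2 * n)) (Fin (2 * n)) ℝ | HasSymplecticSchur A}} := by
  obtain ⟨⟨A, B⟩, hp⟩ := p
  rw [closure_subtype]
  have h := mem_closure_isSplit hm n (isUnit_JMat n) (JMat_transpose n)
    (dual_mem_realizablePairs hp)
  let f : Matrix (Fin (2 * n)) (Fin (2 * n)) ℝ × Matrix (Fin (2 * n)) (Fin (2 * m)) ℝ →
      Matrix (Fin (2 * n)) (Fin (2 * n)) ℝ × Matrix (Fin (2 * n)) (Fin (2 * m)) ℝ :=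
    fun q => (q.1ᵀ, -(JMat n * q.2))
  have hf : Continuous f := by fun_prop
  have hfp : f (Aᵀ, JMat n * B) = (A, B) := by
    simp only [f, Matrix.transpose_transpose, JMat_mul_self_mul, neg_neg]
  change (A, B) ∈ closure _
  rw [← hfp]
  refine map_mem_closure hf h ?_
  rintro ⟨A', B'⟩ ⟨hq, hsplit⟩
  refine ⟨⟨f (A', B'), ?_⟩, mem_interior_schur ?_, rfl⟩
  · have := dual_mem_realizablePairs hq
    rw [mem_realizablePairs] at this
    rw [mem_realizablePairs, ← this]
    simp
  · simpa [f] using hsplit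

/-- The system with given `D`, `A` and `B` whose `C` is the one that physical realizability
prescribes. -/
def linSysOfPair {n m : ℕ} (D : Matrix (Fin (2 * m)) (Fin (2 * m)) ℝ)
    (p : Matrix (Fin (2 * n)) (Fin (2 * n)) ℝ × Matrix (Fin (2 * n)) (Fin (2 * m)) ℝ) :
    LinSys n m :=
  ⟨p.1, p.2, D * JMat m * p.2ᵀ * JMat n, D⟩

lemma physicallyRealizable_linSysOfPair {n m : ℕ} {D : Matrix (Fin (2 * m)) (Fin (2 * m)) ℝ}
    (hD : D * JMat m * Dᵀ = JMat m)
    {p : Matrix (Fin (2 * n)) (Fin (2 * n)) ℝ × Matrix (Fin (2 * n)) (Fin (2 * m)) ℝ}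
    (hp : p ∈ realizablePairs m (JMat n)) : (linSysOfPair D p).PhysicallyRealizable := by
  refine ⟨hp, ?_, hD⟩
  simp [linSysOfPair, Matrix.transpose_mul, JMat_transpose, Matrix.mul_assoc, JMat_mul_self_mul]

lemma linSysOfPair_eq {n m : ℕ} {G : LinSys n m} (hG : G.PhysicallyRealizable) :
    linSysOfPair G.D (G.A, G.B) = G := by
  refine LinSys.ext rfl rfl ?_ rfl
  have h1 := congrArg (fun M => JMat n * M) (eq_neg_of_add_eq_zero_left hG.2.1)
  simp only [JMat_mul_self_mul, Matrix.mul_neg, neg_inj] at h1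
  have h2 := congrArg Matrix.transpose h1
  rw [Matrix.transpose_transpose] at h2
  rw [h2]
  simp [linSysOfPair, Matrix.transpose_mul, JMat_transpose, Matrix.mul_assoc]

lemma continuous_linSysOfPair {n m : ℕ} (D : Matrix (Fin (2 * m)) (Fin (2 * m)) ℝ) :
    Continuous (linSysOfPair (n := n) D) := by
  refine continuous_induced_rng.mpr ?_
  change Continuous fun p : Matrix (Fin (2 * n)) (Fin (2 * n)) ℝ ×
    Matrix (Fin (2 * n)) (Fin (2 * m)) ℝ => (p.1, p.2, D * JMat m * p.2ᵀ * JMat n, D)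
  fun_prop

lemma continuous_linSys_A {n m : ℕ} : Continuous fun G : LinSys n m => G.A :=
  continuous_fst.comp (continuous_induced_dom : Continuous (LinSys.toProd (n := n) (m := m)))

lemma isGeneric_linSys {n m : ℕ} (hn : 1 ≤ n) (hm : 1 ≤ m) :
    IsGeneric {G : {G : LinSys n m // G.PhysicallyRealizable} |
      G.1.HasPureCascadeRealization} := by
  refine ⟨{G | G.1.A ∈
    interior {A : Matrix (Fin (2 * n)) (Fin (2 * n)) ℝ | HasSymplecticSchur A}}, ?_, ?_, ?_⟩
  · intro G hG
    have h : G.1.A ∈ {A : Matrix (Fin (2 * n)) (Fin (2 * n)) ℝ | HasSymplecticSchur A} :=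
      interior_subset (Set.mem_ofPred_eq.mp hG)
    exact hasPureCascadeRealization_of_schur hn G.2 h
  · exact isOpen_interior.preimage (continuous_linSys_A.comp continuous_subtype_val)
  · rintro ⟨G, hG⟩
    have hp : (G.A, G.B) ∈ realizablePairs m (JMat n) := hG.1
    let φ : realizablePairs (n := n) m (JMat n) → {G : LinSys n m // G.PhysicallyRealizable} :=
      fun p => ⟨linSysOfPair G.D p.1, physicallyRealizable_linSysOfPair hG.2.2 p.2⟩
    have hφ : Continuous φ :=
      ((continuous_linSysOfPair G.D).comp continuous_subtype_val).subtype_mk _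
    have hφG : φ ⟨(G.A, G.B), hp⟩ = ⟨G, hG⟩ := Subtype.ext (linSysOfPair_eq hG)
    rw [← hφG]
    exact map_mem_closure hφ (dense_realizablePairs hm ⟨(G.A, G.B), hp⟩) fun q hq => hq

/-! ### The parameters as functions of `A` and `B` -/

/-- The coupling matrix `K` of a system with the matrix `B` and scattering matrix `1`: then
`B = 2 𝕁 M`, where the columns of `M` are alternately minus the imaginary parts and the real parts
of the rows of `K`. -/
noncomputable def couplingOf {n m : ℕ} (B : Matrix (Fin (2 * n)) (Fin (2 * m)) ℝ) :
    Matrix (Fin m) (Fin (2 * n)) ℂ :=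
  Matrix.of fun f i => ((-(1 / 2) * (JMat n * B) i (hi f) : ℝ) : ℂ) +
    ((1 / 2 * (JMat n * B) i (lo f) : ℝ) : ℂ) * Complex.I

/-- The matrix `B` of a system with coupling matrix `K` and scattering matrix `1`. -/
noncomputable def inputOf {n m : ℕ} (K : Matrix (Fin m) (Fin (2 * n)) ℂ) :
    Matrix (Fin (2 * n)) (Fin (2 * m)) ℝ :=
  (2 : ℝ) • (JMat n * Matrix.of fun i j =>
    if ((blockEquiv m).symm j).1 = 0 then -(K ((blockEquiv m).symm j).2 i).im
    else (K ((blockEquiv m).symm j).2 i).re)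

lemma JMat_mul_inputOf {n m : ℕ} (K : Matrix (Fin m) (Fin (2 * n)) ℂ) (i : Fin (2 * n))
    (f : Fin m) : (JMat n * inputOf K) i (lo f) = 2 * (K f i).im ∧
      (JMat n * inputOf K) i (hi f) = -(2 * (K f i).re) := by
  rw [inputOf, Matrix.mul_smul, JMat_mul_self_mul]
  simp [← blockEquiv_zero, ← blockEquiv_one]

lemma couplingOf_inputOf {n m : ℕ} (K : Matrix (Fin m) (Fin (2 * n)) ℂ) :
    couplingOf (inputOf K) = K := by
  ext f i
  obtain ⟨h1, h2⟩ := JMat_mul_inputOf K i f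
  rw [couplingOf, Matrix.of_apply, h1, h2]
  refine Complex.ext ?_ ?_ <;> simp

/-- In terms of `B`, the skew-symmetric matrix `Im (K† K)` is `𝕁 B 𝕁 Bᵀ 𝕁ᵀ / 4`. -/
lemma im_couplingOf {n m : ℕ} (B : Matrix (Fin (2 * n)) (Fin (2 * m)) ℝ) :
    ((couplingOf B)ᴴ * couplingOf B).map Complex.im =
      -((1 / 4 : ℝ) • (JMat n * (B * JMat m * Bᵀ) * JMat n)) := by
  have h1 : -((1 / 4 : ℝ) • (JMat n * (B * JMat m * Bᵀ) * JMat n)) =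
      (1 / 4 : ℝ) • ((JMat n * B) * JMat m * (JMat n * B)ᵀ) := by
    simp [Matrix.transpose_mul, JMat_transpose, Matrix.mul_assoc]
  rw [h1]
  ext i j
  rw [Matrix.smul_apply, mul_JMat_mul_transpose_apply, smul_eq_mul, Finset.mul_sum,
    Matrix.map_apply, Matrix.mul_apply, Complex.im_sum]
  refine Finset.sum_congr rfl fun f _ => ?_
  simp [couplingOf]
  ring

/-- Parameters with scattering matrix `S` whose matrix `A` and whose `B` (up to the action of `S`)
are given. -/
noncomputable def slhOfPair {n m : ℕ} {S : Matrix (Fin m) (Fin m) ℂ}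
    (hS : S ∈ Matrix.unitaryGroup (Fin m) ℂ) (p : realizablePairs (n := n) m (JMat n)) :
    SLHSys n m where
  S := S
  K := couplingOf p.1.2
  R := -((1 / 2 : ℝ) • (JMat n * p.1.1)) -
    ((couplingOf p.1.2)ᴴ * couplingOf p.1.2).map Complex.im
  unitary_S := hS
  symm_R := by
    obtain ⟨⟨A, B⟩, hp⟩ := p
    rw [mem_realizablePairs] at hp
    have h1 : B * JMat m * Bᵀ = -(A * JMat n + JMat n * Aᵀ) := eq_neg_of_add_eq_zero_right hp
    rw [im_couplingOf, h1]
    simp only [Matrix.transpose_sub, Matrix.transpose_neg, Matrix.transpose_smul,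
      Matrix.transpose_mul, Matrix.transpose_add, Matrix.transpose_transpose, JMat_transpose,
      Matrix.mul_add, Matrix.add_mul, Matrix.mul_neg, Matrix.neg_mul, Matrix.mul_assoc,
      JMat_mul_self, JMat_mul_self_mul, Matrix.mul_one, neg_neg]
    module

lemma toLinSys_slhOfPair_A {n m : ℕ} {S : Matrix (Fin m) (Fin m) ℂ}
    (hS : S ∈ Matrix.unitaryGroup (Fin m) ℂ) (p : realizablePairs (n := n) m (JMat n)) :
    (slhOfPair hS p).toLinSys.A = p.1.1 := by
  change (2 : ℝ) • (JMat n * (-((1 / 2 : ℝ) • (JMat n * p.1.1)) -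
    ((couplingOf p.1.2)ᴴ * couplingOf p.1.2).map Complex.im +
    ((couplingOf p.1.2)ᴴ * couplingOf p.1.2).map Complex.im)) = _
  rw [sub_add_cancel, Matrix.mul_neg, Matrix.mul_smul, JMat_mul_self_mul]
  module

lemma pair_mem_realizablePairs {n m : ℕ} (G : SLHSys n m) :
    (G.toLinSys.A, inputOf G.K) ∈ realizablePairs m (JMat n) := by
  have hskew : ((G.Kᴴ * G.K).map Complex.im)ᵀ = -(G.Kᴴ * G.K).map Complex.im := by
    have := map_im_conjTranspose (G.Kᴴ * G.K)
    rw [Matrix.conjTranspose_mul, Matrix.conjTranspose_conjTranspose] at this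
    nth_rewrite 2 [this]
    rw [neg_neg]
  have hB : inputOf G.K * JMat m * (inputOf G.K)ᵀ =
      -((4 : ℝ) • (JMat n * (G.Kᴴ * G.K).map Complex.im * JMat n)) := by
    have := im_couplingOf (inputOf G.K)
    rw [couplingOf_inputOf] at this
    rw [this]
    simp only [Matrix.mul_neg, Matrix.neg_mul, Matrix.mul_smul, Matrix.smul_mul, Matrix.mul_assoc,
      JMat_mul_self, JMat_mul_self_mul, Matrix.mul_one, neg_neg]
    module
  rw [mem_realizablePairs, hB]
  change (2 : ℝ) • (JMat n * (G.R + (G.Kᴴ * G.K).map Complex.im)) * JMat n +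
    JMat n * ((2 : ℝ) • (JMat n * (G.R + (G.Kᴴ * G.K).map Complex.im)))ᵀ + _ = 0
  simp only [Matrix.transpose_smul, Matrix.transpose_mul, Matrix.transpose_add, hskew, G.symm_R,
    JMat_transpose, Matrix.mul_add, Matrix.add_mul, Matrix.mul_smul, Matrix.smul_mul,
    Matrix.mul_neg, Matrix.neg_mul, Matrix.mul_assoc, smul_add]
  module

lemma slhOfPair_eq {n m : ℕ} (G : SLHSys n m) :
    slhOfPair G.unitary_S ⟨_, pair_mem_realizablePairs G⟩ = G := by
  refine SLHSys.ext rfl (couplingOf_inputOf G.K) ?_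
  change -((1 / 2 : ℝ) • (JMat n * ((2 : ℝ) • (JMat n * (G.R + (G.Kᴴ * G.K).map Complex.im))))) -
    ((couplingOf (inputOf G.K))ᴴ * couplingOf (inputOf G.K)).map Complex.im = G.R
  rw [couplingOf_inputOf, Matrix.mul_smul, JMat_mul_self_mul]
  module

lemma continuous_couplingOf {n m : ℕ} : Continuous (couplingOf (n := n) (m := m)) := by
  refine continuous_matrix fun f i => ?_
  change Continuous fun B : Matrix (Fin (2 * n)) (Fin (2 * m)) ℝ =>
    ((-(1 / 2) * (JMat n * B) i (hi f) : ℝ) : ℂ) +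
      ((1 / 2 * (JMat n * B) i (lo f) : ℝ) : ℂ) * Complex.I
  have h : Continuous fun B : Matrix (Fin (2 * n)) (Fin (2 * m)) ℝ => JMat n * B := by fun_prop
  have h1 := h.matrix_elem i (hi f)
  have h2 := h.matrix_elem i (lo f)
  fun_prop

lemma continuous_slhOfPair {n m : ℕ} {S : Matrix (Fin m) (Fin m) ℂ}
    (hS : S ∈ Matrix.unitaryGroup (Fin m) ℂ) : Continuous (slhOfPair (n := n) hS) := by
  refine continuous_induced_rng.mpr ?_
  have hK : Continuous fun p : realizablePairs (n := n) m (JMat n) => couplingOf p.1.2 :=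
    continuous_couplingOf.comp (continuous_snd.comp continuous_subtype_val)
  have hA : Continuous fun p : realizablePairs (n := n) m (JMat n) => p.1.1 :=
    continuous_fst.comp continuous_subtype_val
  refine continuous_const.prodMk (hK.prodMk ?_)
  exact ((continuous_const.matrix_mul hA).const_smul (1 / 2 : ℝ)).neg.sub
    ((hK.matrix_conjTranspose.matrix_mul hK).matrix_map Complex.continuous_im)

lemma continuous_toLinSys_A {n m : ℕ} : Continuous fun G : SLHSys n m => G.toLinSys.A := by
  have h : Continuous (SLHSys.toProd (n := n) (m := m)) := continuous_induced_dom
  have hK : Continuous fun G : SLHSys n m => G.K := continuous_fst.comp (continuous_snd.comp h)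
  have hR : Continuous fun G : SLHSys n m => G.R := continuous_snd.comp (continuous_snd.comp h)
  exact (continuous_const.matrix_mul (hR.add
    ((hK.matrix_conjTranspose.matrix_mul hK).matrix_map Complex.continuous_im))).const_smul (2 : ℝ)

lemma isGeneric_slhSys {n m : ℕ} (hn : 1 ≤ n) (hm : 1 ≤ m) :
    IsGeneric {G : SLHSys n m | G.HasPureCascadeRealization} := by
  refine ⟨{G | G.toLinSys.A ∈
    interior {A : Matrix (Fin (2 * n)) (Fin (2 * n)) ℝ | HasSymplecticSchur A}}, ?_, ?_, ?_⟩
  · intro G hG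
    have h : G.toLinSys.A ∈ {A : Matrix (Fin (2 * n)) (Fin (2 * n)) ℝ | HasSymplecticSchur A} :=
      interior_subset (Set.mem_ofPred_eq.mp hG)
    exact slh_hasPureCascadeRealization_of_schur hn h
  · exact isOpen_interior.preimage continuous_toLinSys_A
  · intro G
    rw [← slhOfPair_eq G]
    refine map_mem_closure (continuous_slhOfPair G.unitary_S)
      (dense_realizablePairs hm ⟨_, pair_mem_realizablePairs G⟩) fun q hq => ?_
    change (slhOfPair G.unitary_S q).toLinSys.A ∈
      interior {A : Matrix (Fin (2 * n)) (Fin (2 * n)) ℝ | HasSymplecticSchur A}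
    rw [toLinSys_slhOfPair_A]
    exact hq

end GenericCascade

open GenericCascade in
theorem mainTheorem1 (n : ℕ) (hn : 1 ≤ n) :
    IsGeneric {A : Matrix (Fin (2 * n)) (Fin (2 * n)) ℝ | IsAdmissible A} ∧
    IsGeneric {A : Matrix (Fin (2 * n)) (Fin (2 * n)) ℝ | HasSymplecticSchur A} ∧
    IsGeneric {A : Matrix (Fin (2 * n)) (Fin (2 * n)) ℝ |
      ∀ (m : ℕ) (G : LinSys n m), G.PhysicallyRealizable → G.A = A →
        G.HasPureCascadeRealization} ∧
    (∀ m : ℕ, 1 ≤ m →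
      IsGeneric {G : {G : LinSys n m // G.PhysicallyRealizable} |
        G.1.HasPureCascadeRealization}) ∧
    (∀ m : ℕ, 1 ≤ m →
      IsGeneric {G : SLHSys n m | G.HasPureCascadeRealization}) := by
  have hschur := isGeneric_of_interior (mem_closure_interior_schur hn)
  refine ⟨isGeneric_of_interior (mem_closure_interior_isAdmissible hn), hschur, ?_,
    fun m hm => isGeneric_linSys hn hm, fun m hm => isGeneric_slhSys hn hm⟩
  obtain ⟨U, hU, hopen, hdense⟩ := hschur
  exact ⟨U, fun A hA m G hG hGA =>
    hasPureCascadeRealization_of_schur hn hG (hGA ▸ hU hA), hopen, hdense⟩
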